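/- **Setting.** Let $|\cdot|$ be a norm on $\mathbb R^d$ and let $X=\{X_j\}_{j\in\mathbb Z}$ be a stationary, regularly varying $\mathbb R^d$-valued time series with tail index $\alpha>0$, so that $P(|X_0|>tx)/P(|X_0|>x)\to t^{-\alpha}$ as $x\to\infty$ for all $t>0$. Let $Y=\{Y_j\}_{j\in\mathbb Z}$ be its tail process: for all $i\le j$, the law of $x^{-1}(X_i,\dots,X_j)$ given $|X_0|>x$ converges weakly to the law of $(Y_i,\dots,Y_j)$ as $x\to\infty$. Put $\Theta_j=Y_j/|Y_0|$, and let $A_0(y)=\inf\{j:\sup_{l\le j}|y_l|=\sup_{l}|y_l|\}$. The cluster measure is $$\nu^*=\int_0^\infty E\big[\delta_{r\Theta}\mathbf 1\{A_0(\Theta)=0\}\big]\,\alpha r^{-\alpha-1}\,dr .$$ A finite block $x_{i,j}=(x_i,\dots,x_j)$ is identified with the bi-infinite sequence obtained by completing it with zeros. Write $\ell_0,\ell_1$ for the spaces of sequences $(x_j)_{j\in\mathbb Z}$ in $\mathbb R^d$ which tend to $0$ at $\pm\infty$, respectively are absolutely summable; put $x^*=\sup_j|x_j|$, $\mathcal E(x)=\sum_{j}\mathbf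 1\{|x_j|>1\}$ and, for a functional $H$ and $s>0$, $H_s(x)=H(x/s)$. **Conditions.** Let $r_n,\ell_n$ be sequences of integers and $u_n$ a real sequence, with $\ell_n\to\infty$, $\ell_n/r_n\to0$, and write $p_n=P(|X_0|>u_n)$. * $R(r_n,u_n)$: $u_n\to\infty$, $r_n\to\infty$, $np_n\to\infty$, $r_n/n\to0$, $r_np_n\to0$. * $DH(r_n,u_n)$: for all $x,y>0$, $\lim_{k\to\infty}\limsup_{n\to\infty}P(\max_{k\le|j|\le r_n}|X_j|>u_nx\mid|X_0|>u_ny)=0$. * $ANSJB(r_n,u_n)$: for all $\eta>0$, $\lim_{\epsilon\downarrow0}\limsup_{n\to\infty}\dfrac{P(\sum_{j=1}^{r_n}|X_j|\mathbf 1\{|X_j|\le\epsilon u_n\}>\eta u_n)}{r_np_n}=0$. * Mixing, with $\beta_j$ the $\beta$-mixing coefficient of $\sigma(X_i,i\le0)$ and $\sigma(X_i,i\ge j)$: $$(M1)\ \ \lim_{n\to\infty}\frac1{r_np_n}\sum_{j=\ell_n}^\infty\beta_j=0,\qquad (M2)\ \ \lim_{n\to\infty}\frac1{r_np_n}\sum_{j=1}^\infty\beta_{jr_n}=0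 .$$ **Classes.** All functionals are measurable and real-valued on $(\mathbb R^d)^{\mathbb Z}$. * $\mathcal A$: bounded functionals $H$ which are shift-invariant on $\ell_0$, vanish on $\{x\in\ell_0:x^*\le\epsilon\}$ for some $\epsilon>0$ and, on $\ell_0$ with the uniform norm, are either Lipschitz or, for every $s>0$, almost surely continuous with respect to the law of $sY$. * $\mathcal B$: functionals $H=\mathbf 1\{K>1\}$, where $K$ is shift-invariant on $\ell_1$, $K(\mathbf 0)=0$, $|K(x)-K(y)|\le L_K\sum_j|x_j-y_j|$ for $x,y\in\ell_1$, and $H$, restricted to $\ell_1$ with the $\ell_1$-norm, is almost surely continuous with respect to the law of $sY$ for every $s>0$. * A *uniform class* $\widetilde{\mathcal A}\subseteq\mathrm{span}(\mathcal A)$ (resp. $\widetilde{\mathcal B}\subseteq\mathrm{span}(\mathcal B)$) is a set $\mathcal G$ of functionals with a finite envelope $\sup_{H\in\mathcal G}|H(x)|<\infty$ for each $x$, with $\limsup_{n}\sup_{H\in\mathcal G}E|H(X_{1,r_n}/u_n)|/(r_np_n)<\infty$, and such that for each $H\in\mathcal G$ there are measurable $K^H_n:(\mathbb R^d)^{\ell_n}\to[0,\infty)$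 with, for all large $n$ and all $H\in\mathcal G$, almost surely $$\Big|H\big(X_{1,r_n}/u_n\big)-H\big(X_{1,r_n-\ell_n}/u_n\big)\Big|\le K_n^H(X_{r_n-\ell_n+1,r_n}),\qquad \lim_{n\to\infty}\sup_{H\in\mathcal G}\frac{E[K^H_n(X_{1,\ell_n})]}{r_np_n}=0 .$$ **Sliding blocks process.** With $q_n=n-r_n+1$ and $k_n=np_n$, $$\mathbb F_n(H)=\sqrt{k_n}\left\{\frac{\sum_{i=0}^{q_n-1}H(X_{i+1,i+r_n}/u_n)}{q_nr_np_n}-\nu^*(H)\right\}.$$ **Proposition.** Assume $R(r_n,u_n)$, $DH(r_n,u_n)$ and $(M1)$. Let $H,\widetilde H\in\widetilde{\mathcal A}$, or let $H,\widetilde H\in\widetilde{\mathcal B}$ and assume $ANSJB(r_n,u_n)$. Then the cluster indices $\nu^*(H)$, $\nu^*(\mathcal E_s)$, $\nu^*(H\widetilde H)$ (if $(M2)$ holds) and $\nu^*(H\mathcal E_s)$ below are integrals of $\nu^*$-integrable functions, and: 1. if $(M2)$ holds as well, then $\displaystyle\lim_{n\to\infty}\mathrm{Cov}(\mathbb F_n(H),\mathbb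 F_n(\widetilde H))=\nu^*(H\widetilde H)$; 2. for every $s>0$, $\displaystyle\lim_{n\to\infty}\mathrm{Cov}(\mathbb F_n(H),\mathbb F_n(\mathcal E_s))=\nu^*(H\mathcal E_s)=s^{-\alpha}E[H(sY)]$. -/

import Mathlib

open MeasureTheory ProbabilityTheory Filter Topology
open scoped ENNReal NNReal

namespace SlidingBlocks

noncomputable section

/-! ### Sequence spaces, blocks and functionals -/

/-- The space `ℓ₀(E)` of bi-infinite sequences tending to zero at `±∞`. -/
def l0 (E : Type*) [NormedAddCommGroup E] : Set (ℤ → E) :=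
  {x | Tendsto x cofinite (𝓝 0)}

/-- The space `ℓ₁(E)` of absolutely summable bi-infinite sequences. -/
def l1 (E : Type*) [NormedAddCommGroup E] : Set (ℤ → E) :=
  {x | Summable fun j => ‖x j‖}

/-- The block `X_{a,b} = (X_a, …, X_b)`, completed by zeros to a bi-infinite sequence. -/
def block {Ω E : Type*} [Zero E] (X : ℤ → Ω → E) (a b : ℤ) (ω : Ω) : ℤ → E :=
  fun j => if a ≤ j ∧ j ≤ b then X j ω else 0

/-- The scaled functional `H_s(x) = H(x / s)`. -/
def rescale {E : Type*} [NormedAddCommGroup E] [NormedSpace ℝ E]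
    (s : ℝ) (H : (ℤ → E) → ℝ) : (ℤ → E) → ℝ :=
  fun x => H (s⁻¹ • x)

open Classical in
/-- The exceedance functional `ℰ(x) = ∑_j 1{‖x_j‖ > 1}` (a finite sum for `x ∈ ℓ₀`). -/
def exc {E : Type*} [NormedAddCommGroup E] : (ℤ → E) → ℝ :=
  fun x => ∑' j : ℤ, if 1 < ‖x j‖ then (1 : ℝ) else 0

/-! ### Stationarity, tail index, tail process, cluster measure -/

/-- Strict stationarity of the time series `X`. -/
def IsStationary {Ω E : Type*} [MeasurableSpace Ω] [MeasurableSpace E]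
    (μ : Measure Ω) (X : ℤ → Ω → E) : Prop :=
  ∀ k : ℤ, μ.map (fun ω j => X (j + k) ω) = μ.map (fun ω j => X j ω)

/-- The tail probability `P(‖X₀‖ > x)`. -/
def tailProb {Ω E : Type*} [MeasurableSpace Ω] [NormedAddCommGroup E]
    (μ : Measure Ω) (X : ℤ → Ω → E) (x : ℝ) : ℝ :=
  μ.real {ω | x < ‖X 0 ω‖}

/-- `‖X₀‖` is regularly varying with tail index `α > 0`. -/
def HasTailIndex {Ω E : Type*} [MeasurableSpace Ω] [NormedAddCommGroup E]
    (μ : Measure Ω) (X : ℤ → Ω → E) (α : ℝ) : Prop :=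
  0 < α ∧ ∀ t : ℝ, 0 < t →
    Tendsto (fun x : ℝ => tailProb μ X (t * x) / tailProb μ X x) atTop (𝓝 (t ^ (-α)))

/-- `Y` is the tail process of `X`: for all `i, j`, the law of `x⁻¹ (X_i, …, X_j)` conditionally on
`‖X₀‖ > x` converges weakly, as `x → ∞`, to the law of `(Y_i, …, Y_j)`. -/
def IsTailProcess {Ω Ω' E : Type*} [MeasurableSpace Ω] [MeasurableSpace Ω']
    [NormedAddCommGroup E] [NormedSpace ℝ E]
    (μ : Measure Ω) (X : ℤ → Ω → E) (μ' : Measure Ω') (Y : ℤ → Ω' → E) : Prop :=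
  ∀ i j : ℤ, ∀ f : BoundedContinuousFunction (Set.Icc i j → E) ℝ,
    Tendsto
      (fun x : ℝ => ∫ ω, f (fun l => x⁻¹ • X l ω) ∂(cond μ {ω | x < ‖X 0 ω‖}))
      atTop (𝓝 (∫ ω, f (fun l => Y l ω) ∂μ'))

/-- The spectral tail process `Θ_j = Y_j / ‖Y₀‖`. -/
def spectral {Ω' E : Type*} [NormedAddCommGroup E] [NormedSpace ℝ E]
    (Y : ℤ → Ω' → E) (ω : Ω') : ℤ → E :=
  fun j => ‖Y 0 ω‖⁻¹ • Y j ω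

/-- The event `A₀(y) = 0` for the infargmax functional
`A₀(y) = inf {j : sup_{l ≤ j} ‖y_l‖ = sup_l ‖y_l‖}`. -/
def InfargmaxEqZero {E : Type*} [NormedAddCommGroup E] (y : ℤ → E) : Prop :=
  IsLeast {j : ℤ | (⨆ (l : ℤ) (_ : l ≤ j), ‖y l‖ₑ) = ⨆ l : ℤ, ‖y l‖ₑ} 0

/-- The cluster measure `ν* = ∫₀^∞ E[δ_{rΘ} 1{A₀(Θ) = 0}] α r^{-α-1} dr`. -/
def clusterMeasure {Ω' E : Type*} [MeasurableSpace Ω']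
    [NormedAddCommGroup E] [NormedSpace ℝ E] [MeasurableSpace E]
    (α : ℝ) (μ' : Measure Ω') (Y : ℤ → Ω' → E) : Measure (ℤ → E) :=
  Measure.map (fun p : ℝ × Ω' => p.1 • spectral Y p.2)
    (((volume.restrict (Set.Ioi (0 : ℝ))).withDensity
        fun r => ENNReal.ofReal (α * r ^ (-α - 1))).prod
      (μ'.restrict {ω | InfargmaxEqZero (spectral Y ω)}))

/-! ### Classes of functionals -/

/-- Lipschitz continuity on `ℓ₀` with respect to the uniform norm. -/
def LipschitzUniform {E : Type*} [NormedAddCommGroup E] (H : (ℤ → E) → ℝ) : Prop :=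
  ∃ L : ℝ, ∀ x ∈ l0 E, ∀ y ∈ l0 E, |H x - H y| ≤ L * ⨆ j : ℤ, ‖x j - y j‖

/-- Continuity at `x` of `H` on `ℓ₀` with respect to the uniform norm. -/
def ContinuousAtUniform {E : Type*} [NormedAddCommGroup E]
    (H : (ℤ → E) → ℝ) (x : ℤ → E) : Prop :=
  ∀ ε : ℝ, 0 < ε → ∃ δ : ℝ, 0 < δ ∧
    ∀ y ∈ l0 E, (∀ j, ‖y j - x j‖ ≤ δ) → |H y - H x| ≤ ε

/-- Continuity at `x` of `H` on `ℓ₁` with respect to the `ℓ₁`-norm. -/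
def ContinuousAtL1 {E : Type*} [NormedAddCommGroup E]
    (H : (ℤ → E) → ℝ) (x : ℤ → E) : Prop :=
  ∀ ε : ℝ, 0 < ε → ∃ δ : ℝ, 0 < δ ∧
    ∀ y ∈ l1 E, (∑' j : ℤ, ‖y j - x j‖ₑ) ≤ ENNReal.ofReal δ → |H y - H x| ≤ ε

/-- The class `𝒜`: bounded measurable functionals, Lipschitz with respect to the uniform norm or
almost surely continuous with respect to the law of `sY` for each `s > 0`, which are
shift-invariant and have support separated from zero. -/
def classA {Ω' E : Type*} [MeasurableSpace Ω']
    [NormedAddCommGroup E] [NormedSpace ℝ E] [MeasurableSpace E]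
    (μ' : Measure Ω') (Y : ℤ → Ω' → E) : Set ((ℤ → E) → ℝ) :=
  {H | Measurable H ∧ (∃ C : ℝ, ∀ x, |H x| ≤ C) ∧
    (LipschitzUniform H ∨
      ∀ s : ℝ, 0 < s → ∀ᵐ ω ∂μ', ContinuousAtUniform H (fun j => s • Y j ω)) ∧
    (∀ x ∈ l0 E, ∀ k : ℤ, H (fun j => x (j + k)) = H x) ∧
    ∃ ε : ℝ, 0 < ε ∧ ∀ x ∈ l0 E, (∀ j, ‖x j‖ ≤ ε) → H x = 0}

/-- The class `𝒦` of shift-invariant functionals on `ℓ₁`, Lipschitz with respect to the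
`ℓ₁`-norm, vanishing at the zero sequence. -/
def classK (E : Type*) [NormedAddCommGroup E] [MeasurableSpace E] : Set ((ℤ → E) → ℝ) :=
  {K | Measurable K ∧ K 0 = 0 ∧ (∀ x ∈ l1 E, ∀ k : ℤ, K (fun j => x (j + k)) = K x) ∧
    ∃ L : ℝ, ∀ x ∈ l1 E, ∀ y ∈ l1 E, |K x - K y| ≤ L * ∑' j : ℤ, ‖x j - y j‖}

/-- The class `ℬ` of functionals `H = 1{K > 1}` with `K ∈ 𝒦`, almost surely continuous (as
functionals on `ℓ₁`) with respect to the law of `sY` for each `s > 0`. -/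
def classB {Ω' E : Type*} [MeasurableSpace Ω']
    [NormedAddCommGroup E] [NormedSpace ℝ E] [MeasurableSpace E]
    (μ' : Measure Ω') (Y : ℤ → Ω' → E) : Set ((ℤ → E) → ℝ) :=
  {H | (∃ K ∈ classK E, H = Set.indicator {x | 1 < K x} 1) ∧
    ∀ s : ℝ, 0 < s → ∀ᵐ ω ∂μ', ContinuousAtL1 H (fun j => s • Y j ω)}

/-- The requirements which define the uniform classes `𝒜̃` and `ℬ̃`:
a finite envelope, `limsup_n sup_{H ∈ 𝒢} ν*_{n,r_n}(|H|) < ∞`, and the existence of functions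
`K_n^H ≥ 0` of `ℓ_n` variables which dominate the effect of deleting the last `ℓ_n` coordinates
of the block `X_{1,r_n}` and satisfy `sup_{H ∈ 𝒢} E[K_n^H(X_{1,ℓ_n})] = o(r_n P(‖X₀‖ > u_n))`. -/
def IsUniformClass {Ω E : Type*} [MeasurableSpace Ω]
    [NormedAddCommGroup E] [NormedSpace ℝ E] [MeasurableSpace E]
    (μ : Measure Ω) (X : ℤ → Ω → E) (r ℓ : ℕ → ℕ) (u : ℕ → ℝ)
    (𝒢 : Set ((ℤ → E) → ℝ)) : Prop :=
  (∀ x, ∃ C : ℝ, ∀ H ∈ 𝒢, |H x| ≤ C) ∧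
  limsup (fun n => ⨆ H ∈ 𝒢, (∫⁻ ω, ‖H ((u n)⁻¹ • block X 1 (r n) ω)‖ₑ ∂μ) /
      ENNReal.ofReal (r n * tailProb μ X (u n))) atTop < ∞ ∧
  ∃ K : ((ℤ → E) → ℝ) → (n : ℕ) → (Fin (ℓ n) → E) → ℝ≥0,
    (∀ H ∈ 𝒢, ∀ n, Measurable (K H n)) ∧
    (∀ᶠ n in atTop, ∀ H ∈ 𝒢, ∀ᵐ ω ∂μ,
      |H ((u n)⁻¹ • block X 1 (r n) ω) - H ((u n)⁻¹ • block X 1 ((r n : ℤ) - ℓ n) ω)|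
        ≤ K H n (fun i => X ((r n : ℤ) - ℓ n + 1 + (i : ℕ)) ω)) ∧
    Tendsto (fun n => ⨆ H ∈ 𝒢, (∫⁻ ω, (K H n (fun i => X (1 + (i : ℕ)) ω) : ℝ≥0∞) ∂μ) /
      ENNReal.ofReal (r n * tailProb μ X (u n))) atTop (𝓝 0)

/-! ### Conditions on the block lengths, the thresholds and the dependence -/

/-- Condition `R(r_n, u_n)`. -/
def ConditionR {Ω E : Type*} [MeasurableSpace Ω] [NormedAddCommGroup E]
    (μ : Measure Ω) (X : ℤ → Ω → E) (r : ℕ → ℕ) (u : ℕ → ℝ) : Prop :=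
  Tendsto u atTop atTop ∧ Tendsto r atTop atTop ∧
  Tendsto (fun n : ℕ => n * tailProb μ X (u n)) atTop atTop ∧
  Tendsto (fun n : ℕ => (r n : ℝ) / n) atTop (𝓝 0) ∧
  Tendsto (fun n : ℕ => r n * tailProb μ X (u n)) atTop (𝓝 0)

/-- The anticlustering condition `DH(r_n, u_n)`. -/
def ConditionDH {Ω E : Type*} [MeasurableSpace Ω] [NormedAddCommGroup E]
    (μ : Measure Ω) (X : ℤ → Ω → E) (r : ℕ → ℕ) (u : ℕ → ℝ) : Prop :=
  ∀ x y : ℝ, 0 < x → 0 < y →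
    Tendsto (fun k : ℕ => limsup (fun n : ℕ =>
        cond μ {ω | u n * y < ‖X 0 ω‖}
          {ω | ∃ j : ℤ, (k : ℤ) ≤ |j| ∧ |j| ≤ r n ∧ u n * x < ‖X j ω‖}) atTop)
      atTop (𝓝 0)

open Classical in
/-- The condition `ANSJB(r_n, u_n)` of asymptotic negligibility of small jumps. -/
def ConditionANSJB {Ω E : Type*} [MeasurableSpace Ω] [NormedAddCommGroup E]
    (μ : Measure Ω) (X : ℤ → Ω → E) (r : ℕ → ℕ) (u : ℕ → ℝ) : Prop :=
  ∀ η : ℝ, 0 < η →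
    Tendsto (fun ε : ℝ => limsup (fun n : ℕ =>
        μ {ω | η * u n <
            ∑ j ∈ Finset.Icc (1 : ℤ) (r n), if ‖X j ω‖ ≤ ε * u n then ‖X j ω‖ else 0} /
          ENNReal.ofReal (r n * tailProb μ X (u n))) atTop)
      (𝓝[>] 0) (𝓝 0)

/-- `A` is a finite measurable partition of `Ω` for the σ-field `m`. -/
def IsFinPartition {Ω : Type*} (m : MeasurableSpace Ω) {N : ℕ} (A : Fin N → Set Ω) : Prop :=
  (∀ i, MeasurableSet[m] (A i)) ∧ Pairwise (fun i j => Disjoint (A i) (A j)) ∧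
    (⋃ i, A i) = Set.univ

/-- The β-mixing (absolute regularity) coefficient between two σ-fields: the supremum over finite
partitions `(A_i)`, `(B_j)` of `½ ∑_{i,j} |P(A_i ∩ B_j) - P(A_i) P(B_j)|`. -/
def betaCoeff {Ω : Type*} [MeasurableSpace Ω] (μ : Measure Ω)
    (m₁ m₂ : MeasurableSpace Ω) : ℝ≥0∞ :=
  ⨆ (M : ℕ) (N : ℕ) (A : Fin M → Set Ω) (B : Fin N → Set Ω)
    (_ : IsFinPartition m₁ A) (_ : IsFinPartition m₂ B),
    ENNReal.ofReal (2⁻¹ * ∑ i, ∑ j, |μ.real (A i ∩ B j) - μ.real (A i) * μ.real (B j)|)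

/-- The β-mixing rates `β_n = β(σ(X_j, j ≤ 0), σ(X_j, j ≥ n))` of a stationary time series. -/
def betaRate {Ω E : Type*} [MeasurableSpace Ω] [mE : MeasurableSpace E]
    (μ : Measure Ω) (X : ℤ → Ω → E) (n : ℕ) : ℝ≥0∞ :=
  betaCoeff μ (⨆ (j : ℤ) (_ : j ≤ 0), mE.comap (X j))
    (⨆ (j : ℤ) (_ : (n : ℤ) ≤ j), mE.comap (X j))

/-- `lim_n (r_n P(‖X₀‖ > u_n))⁻¹ ∑_{j ≥ ℓ_n} β_j = 0`. -/
def MixingTail {Ω E : Type*} [MeasurableSpace Ω] [NormedAddCommGroup E] [MeasurableSpace E]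
    (μ : Measure Ω) (X : ℤ → Ω → E) (r ℓ : ℕ → ℕ) (u : ℕ → ℝ) : Prop :=
  Tendsto (fun n : ℕ => (∑' j : ℕ, betaRate μ X (ℓ n + j)) /
    ENNReal.ofReal (r n * tailProb μ X (u n))) atTop (𝓝 0)

/-- `lim_n (r_n P(‖X₀‖ > u_n))⁻¹ ∑_{j ≥ 1} β_{j r_n} = 0`. -/
def MixingBlocks {Ω E : Type*} [MeasurableSpace Ω] [NormedAddCommGroup E] [MeasurableSpace E]
    (μ : Measure Ω) (X : ℤ → Ω → E) (r : ℕ → ℕ) (u : ℕ → ℝ) : Prop :=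
  Tendsto (fun n : ℕ => (∑' j : ℕ, betaRate μ X ((j + 1) * r n)) /
    ENNReal.ofReal (r n * tailProb μ X (u n))) atTop (𝓝 0)

/-! ### The empirical cluster process of sliding blocks -/

/-- The number `q_n = n - r_n + 1` of sliding blocks (for `r_n ≤ n`). -/
def numBlocks (r : ℕ → ℕ) (n : ℕ) : ℕ := n + 1 - r n

/-- The sliding blocks statistic
`(q_n r_n P(‖X₀‖ > u_n))⁻¹ ∑_{i=0}^{q_n - 1} H(X_{i+1,i+r_n} / u_n)`. -/
def slidingStat {Ω E : Type*} [MeasurableSpace Ω]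
    [NormedAddCommGroup E] [NormedSpace ℝ E]
    (μ : Measure Ω) (X : ℤ → Ω → E) (r : ℕ → ℕ) (u : ℕ → ℝ) (n : ℕ)
    (H : (ℤ → E) → ℝ) (ω : Ω) : ℝ :=
  (∑ i ∈ Finset.range (numBlocks r n),
      H ((u n)⁻¹ • block X ((i : ℤ) + 1) ((i : ℤ) + r n) ω)) /
    (numBlocks r n * r n * tailProb μ X (u n))

/-- The empirical cluster process of sliding blocks
`𝔽_n(H) = √k_n (ν̃_n(H) - ν*(H))`, with `k_n = n P(‖X₀‖ > u_n)`, where `ν̃_n` is the sliding blocks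
statistic and `ν` stands for the cluster measure `ν*`. -/
def empProcess {Ω E : Type*} [MeasurableSpace Ω]
    [NormedAddCommGroup E] [NormedSpace ℝ E] [MeasurableSpace E]
    (μ : Measure Ω) (X : ℤ → Ω → E) (ν : Measure (ℤ → E)) (r : ℕ → ℕ) (u : ℕ → ℝ) (n : ℕ)
    (H : (ℤ → E) → ℝ) (ω : Ω) : ℝ :=
  Real.sqrt (n * tailProb μ X (u n)) * (slidingStat μ X r u n H ω - ∫ x, H x ∂ν)

end

end SlidingBlocks

/-!
# Covariances of sliding blocks statistics of regularly varying time series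

Everything is done on path space: `P n` is the law of the rescaled series `X / u_n`, `Q` the law of
the tail process and `p n` the exceedance probability. What is needed of the series is collected
in `BlockLimit` (stationarity, weak convergence of finite windows around an exceedance,
anticlustering; see `blockLimit_pathLaw`) and in `WeakDep` (see `weakDep_mixRate`).

*The cluster measure.* By stationarity the tail process satisfies a time change formula
(`BlockLimit.integral_timeChange`). Hence the measures `s^{-α} P(sY ∈ ·)` on `{‖x₀‖ > s}` are the
restrictions of a single measure `tailMeasure`, which is shift-invariant away from the paths
vanishing at the origin. The cluster measure is its restriction to the paths whose norm is maximal
for the first time at `0` (`BlockLimit.clusterMeasure_eq`), and a mass transport argument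
(`BlockLimit.massTransport`) gives, for shift-invariant `q` and a weight `w` vanishing on
`{‖z‖ ≤ s}`,
`ν*((∑_j w(x_j)) q(x)) = s^{-α} E[w(sY₀) q(sY)]`.
For the indicator `w` of `{‖z‖ > s}` this is the formula `ν*(H ℰ_s) = s^{-α} E[H(sY)]`.

*Local limits.* Let `N` be the uniform norm or the `ℓ₁`-norm. Anticlustering, together with the
negligibility of the small jumps in the case of `ℓ₁`, makes the part of a block away from a given
exceedance small in the norm `N` (`TailSmall`). A functional which is almost surely continuous at
`sY` with respect to `N` is squeezed between its Lipschitz envelopes (`upper`), which are continuous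
on finite windows; so the functional of a block containing an exceedance is asymptotically a
functional of a finite window around it, and converges to the tail process
(`BlockLimit.eventually_localize`, `BlockLimit.eventually_window`).

*Overlapping blocks.* The weights `bump s ‖x_j‖ * damp s x` form a partition of unity on the blocks
with a large value, and the remaining blocks are negligible as `s → 0`. Splitting the first of two
blocks at lag `k` over its exceedances, those in the first block only are unlikely to meet an
exceedance in the second, and each of the about `r - k` others contributes the local limit, that
is, `p ν*(H H')` by mass transport (`Admissible.overlap`). Summing the resulting covariances
`(r - |k|) p ν*(H H')` over the lags `|k| < r` gives `r² p ν*(H H')`, which is the normalisation of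
`F_n`.

*Distant blocks.* The β-mixing covariance inequality (`abs_cov_le_betaCoeff`) bounds the covariance
of blocks separated by a gap. The first `ℓ_n` gaps are few compared with `r_n`, and over the others
the rates sum to `o(r_n p_n)` (`sum_far_le`), so that the lags `|k| ≥ r` do not contribute
(`Admissible.tendsto_cov`). The covariance with the exceedance functional is a double sum of
covariances of a block with a single exceedance and is treated in the same way
(`Admissible.tendsto_cov_countExceed`).

Both classes of functionals consist of `Admissible` functionals
(`BlockLimit.admissible_of_mem_classA`, `BlockLimit.admissible_of_mem_classB`), and admissibility
passes to linear spans.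
-/

set_option linter.unusedSectionVars false

namespace SlidingBlocks

/-! ### Shifts and truncations of sequences -/

/-- The shift `(B^k x)_j = x_{j+k}`. -/
def shift {E : Type*} (k : ℤ) (x : ℤ → E) : ℤ → E := fun j => x (j + k)

/-- The block `(x_a, …, x_b)` completed by zeros. -/
def trunc {E : Type*} [Zero E] (a b : ℤ) (x : ℤ → E) : ℤ → E :=
  fun j => if a ≤ j ∧ j ≤ b then x j else 0

/-- The symmetric window `(x_{-m}, …, x_m)` completed by zeros. -/
abbrev window {E : Type*} [Zero E] (m : ℕ) (x : ℤ → E) : ℤ → E := trunc (-m) m x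

section basic

variable {E : Type*}

lemma shift_apply (k : ℤ) (x : ℤ → E) (j : ℤ) : shift k x j = x (j + k) := rfl

lemma shift_shift (k l : ℤ) (x : ℤ → E) : shift k (shift l x) = shift (k + l) x := by
  funext j; simp [shift, add_assoc]

lemma shift_zero' (x : ℤ → E) : shift 0 x = x := by funext j; simp [shift]

lemma trunc_apply [Zero E] (a b : ℤ) (x : ℤ → E) (j : ℤ) :
    trunc a b x j = if a ≤ j ∧ j ≤ b then x j else 0 := rfl

lemma shift_trunc [Zero E] (k a b : ℤ) (x : ℤ → E) :
    shift k (trunc a b x) = trunc (a - k) (b - k) (shift k x) := by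
  funext j
  simp only [shift, trunc]
  exact if_congr (by constructor <;> rintro ⟨_, _⟩ <;> constructor <;> omega) rfl rfl

lemma trunc_trunc [Zero E] (a b c d : ℤ) (x : ℤ → E) :
    trunc a b (trunc c d x) = trunc (max a c) (min b d) x := by
  funext j
  simp only [trunc]
  split_ifs <;> first | rfl | (exfalso; omega)

lemma trunc_support_finite [Zero E] (a b : ℤ) (x : ℤ → E) :
    (Function.support (trunc a b x)).Finite := by
  refine (Set.finite_Icc a b).subset fun j hj => ?_
  by_contra h
  exact hj (if_neg h)

lemma measurable_shift [MeasurableSpace E] (k : ℤ) : Measurable (shift (E := E) k) :=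
  measurable_pi_lambda _ fun j => measurable_pi_apply (j + k)

lemma continuous_shift [TopologicalSpace E] (k : ℤ) : Continuous (shift (E := E) k) :=
  continuous_pi fun j => continuous_apply (j + k)

lemma measurable_trunc [Zero E] [MeasurableSpace E] (a b : ℤ) :
    Measurable (trunc (E := E) a b) := by
  refine measurable_pi_lambda _ fun j => ?_
  by_cases h : a ≤ j ∧ j ≤ b
  · simpa [trunc, h] using measurable_pi_apply j
  · simp [trunc, h]

lemma smul_trunc [AddZeroClass E] {R : Type*} [SMulZeroClass R E] (c : R) (a b : ℤ) (x : ℤ → E) :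
    c • trunc a b x = trunc a b (c • x) := by
  funext j
  simp only [trunc, Pi.smul_apply]
  split_ifs <;> simp

lemma trunc_sub [AddGroup E] (a b : ℤ) (x y : ℤ → E) :
    trunc a b (x - y) = trunc a b x - trunc a b y := by
  funext j
  simp only [trunc, Pi.sub_apply]
  split_ifs <;> simp

lemma norm_trunc_le [NormedAddCommGroup E] (a b : ℤ) (x : ℤ → E) (j : ℤ) :
    ‖trunc a b x j‖ ≤ ‖x j‖ := by
  simp only [trunc]; split_ifs <;> simp

lemma measurable_norm_apply [NormedAddCommGroup E] [MeasurableSpace E]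
    [OpensMeasurableSpace E] (j : ℤ) : Measurable fun x : ℤ → E => ‖x j‖ :=
  (measurable_pi_apply j).norm

lemma finite_le_norm_of_mem_l0 [NormedAddCommGroup E] {x : ℤ → E} (hx : x ∈ l0 E) {ε : ℝ}
    (hε : 0 < ε) : {l : ℤ | ε ≤ ‖x l‖}.Finite := by
  have hx' : Tendsto (fun l => ‖x l‖) cofinite (𝓝 0) := by
    simpa using (show Tendsto x cofinite (𝓝 0) from hx).norm
  have := Filter.eventually_cofinite.1 (hx'.eventually_lt_const hε)
  simpa only [not_lt] using this

lemma mem_l0_of_support [NormedAddCommGroup E] {x : ℤ → E} (h : (Function.support x).Finite) :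
    x ∈ l0 E :=
  tendsto_nhds_of_eventually_eq (Filter.eventually_cofinite.2 (h.subset fun _ hj => hj))

end basic

/-- The asymptotic framework on path space. `P n` is the law of the rescaled series `X / u_n`,
`Q` is the law of the tail process and `p n` plays the role of `P(‖X₀‖ > u_n)`: the laws `P n` are
shift-invariant, on finite windows `P n` converges to `Q` conditionally on `‖x₀‖ > s`
(in unnormalised form, for every level `s`), and exceedances do not cluster at distances between
`m` and `r n` (anticlustering). -/
structure BlockLimit {E : Type*} [NormedAddCommGroup E] [NormedSpace ℝ E] [MeasurableSpace E]
    (P : ℕ → Measure (ℤ → E)) (Q : Measure (ℤ → E)) (α : ℝ) (p : ℕ → ℝ) (r : ℕ → ℕ) : Prop where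
  prob : ∀ n, IsProbabilityMeasure (P n)
  probQ : IsProbabilityMeasure Q
  α_pos : 0 < α
  p_pos : ∀ᶠ n in atTop, 0 < p n
  shift_inv : ∀ n k, (P n).map (shift k) = P n
  r_top : Tendsto r atTop atTop
  rp_zero : Tendsto (fun n => r n * p n) atTop (𝓝 0)
  tendsto_window : ∀ s : ℝ, 0 < s → ∀ (m : ℕ) (F : (ℤ → E) → ℝ), Continuous F →
    (∃ C, ∀ x, |F x| ≤ C) → (∀ x, F (window m x) = F x) →
    Tendsto (fun n => (∫ x in {x | s < ‖x 0‖}, F x ∂(P n)) / p n) atTop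
      (𝓝 (s ^ (-α) * ∫ y, F (s • y) ∂Q))
  anticluster : ∀ s η δ : ℝ, 0 < s → 0 < η → 0 < δ → ∀ᶠ m : ℕ in atTop, ∀ᶠ n in atTop,
    (P n).real {x | s < ‖x 0‖ ∧ ∃ i : ℤ, (m : ℤ) ≤ |i| ∧ |i| ≤ r n ∧ η < ‖x i‖} ≤ δ * p n

section framework

variable {E : Type*} [NormedAddCommGroup E] [NormedSpace ℝ E] [MeasurableSpace E] [BorelSpace E]

lemma measurableSet_exceed (s : ℝ) (j : ℤ) : MeasurableSet {x : ℤ → E | s < ‖x j‖} :=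
  measurableSet_lt measurable_const (measurable_norm_apply j)

variable {P : ℕ → Measure (ℤ → E)} {Q : Measure (ℤ → E)} {α : ℝ} {p : ℕ → ℝ} {r : ℕ → ℕ}

lemma BlockLimit.measurePreserving (h : BlockLimit P Q α p r) (n : ℕ) (k : ℤ) :
    MeasurePreserving (shift k) (P n) (P n) := ⟨measurable_shift k, h.shift_inv n k⟩

/-- The shift as a measurable equivalence. -/
def shiftEquiv (k : ℤ) : (ℤ → E) ≃ᵐ (ℤ → E) where
  toFun := shift k
  invFun := shift (-k)
  left_inv x := by simp [shift_shift, shift_zero']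
  right_inv x := by simp [shift_shift, shift_zero']
  measurable_toFun := measurable_shift k
  measurable_invFun := measurable_shift (-k)

lemma BlockLimit.integral_shift (h : BlockLimit P Q α p r) (n : ℕ) (k : ℤ) (f : (ℤ → E) → ℝ) :
    ∫ x, f (shift k x) ∂(P n) = ∫ x, f x ∂(P n) :=
  (h.measurePreserving n k).integral_comp (shiftEquiv (E := E) k).measurableEmbedding f

lemma BlockLimit.setIntegral_shift (h : BlockLimit P Q α p r) (n : ℕ) (k : ℤ)
    (A : Set (ℤ → E)) (f : (ℤ → E) → ℝ) :
    ∫ x in (shift k) ⁻¹' A, f (shift k x) ∂(P n) = ∫ x in A, f x ∂(P n) :=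
  (h.measurePreserving n k).setIntegral_preimage_emb
    (shiftEquiv (E := E) k).measurableEmbedding f A

lemma BlockLimit.real_shift (h : BlockLimit P Q α p r) (n : ℕ) (k : ℤ) (A : Set (ℤ → E)) :
    (P n).real ((shift k) ⁻¹' A) = (P n).real A := by
  rw [measureReal_def, (h.measurePreserving n k).measure_preimage_emb
    (shiftEquiv (E := E) k).measurableEmbedding, measureReal_def]

lemma BlockLimit.tendsto_tail (h : BlockLimit P Q α p r) {s : ℝ} (hs : 0 < s) :
    Tendsto (fun n => (P n).real {x | s < ‖x 0‖} / p n) atTop (𝓝 (s ^ (-α))) := by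
  have := h.tendsto_window s hs 0 (fun _ => 1) continuous_const ⟨1, by simp⟩ (by simp)
  have := h.probQ
  simp_all

/-- Exceedance probabilities are of order `p n`. -/
lemma BlockLimit.tail_le (h : BlockLimit P Q α p r) {s : ℝ} (hs : 0 < s) :
    ∀ᶠ n in atTop, (P n).real {x | s < ‖x 0‖} ≤ (s ^ (-α) + 1) * p n := by
  filter_upwards [(h.tendsto_tail hs).eventually_lt_const (lt_add_one _), h.p_pos] with n hn hp
  exact ((div_lt_iff₀ hp).1 hn).le

end framework

/-! ### The tail measure and its shift-invariance -/

section tail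

variable {E : Type*} [NormedAddCommGroup E] [NormedSpace ℝ E] [MeasurableSpace E] [BorelSpace E]
variable {P : ℕ → Measure (ℤ → E)} {Q : Measure (ℤ → E)} {α : ℝ} {p : ℕ → ℝ} {r : ℕ → ℕ}

lemma window_window_of_le {m M : ℕ} (h : m ≤ M) (x : ℤ → E) :
    window m (window M x) = window m x := by
  rw [window, window, trunc_trunc]
  congr 1 <;> omega

lemma eq_of_window_le {m M : ℕ} (h : m ≤ M) {F : (ℤ → E) → ℝ} (hF : ∀ x, F (window m x) = F x)
    (x : ℤ → E) : F (window M x) = F x := by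
  rw [← hF, window_window_of_le h, hF]

/-- The time-change formula for the tail process: both sides are the limit of
`∫ G dP_n / p_n`, by stationarity of `P_n`. -/
lemma BlockLimit.integral_timeChange (h : BlockLimit P Q α p r) {s t : ℝ} (hs : 0 < s)
    (ht : 0 < t) (j : ℤ) (m : ℕ) {G : (ℤ → E) → ℝ} (hc : Continuous G)
    (hb : ∃ C, ∀ x, |G x| ≤ C) (hw : ∀ x, G (window m x) = G x)
    (h0 : ∀ x, G x ≠ 0 → s < ‖x 0‖ ∧ t < ‖x j‖) :
    s ^ (-α) * ∫ y, G (s • y) ∂Q = t ^ (-α) * ∫ y, G (shift (-j) (t • y)) ∂Q := by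
  have T1 := h.tendsto_window s hs m G hc hb hw
  have T2 := h.tendsto_window t ht (m + j.natAbs) (fun x => G (shift (-j) x))
    (hc.comp (continuous_shift _)) (by obtain ⟨C, hC⟩ := hb; exact ⟨C, fun x => hC _⟩) (by
      intro x
      rw [← hw, ← hw (shift (-j) x)]
      congr 1
      rw [window, shift_trunc, trunc_trunc]
      simp only [Nat.cast_add]
      congr 1 <;> omega)
  refine tendsto_nhds_unique T1 (T2.congr fun n => ?_)
  congr 1
  rw [setIntegral_eq_integral_of_forall_compl_eq_zero,
    setIntegral_eq_integral_of_forall_compl_eq_zero, h.integral_shift]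
  · intro x hx
    by_contra hne
    exact hx (h0 x hne).1
  · intro x hx
    by_contra hne
    have := (h0 _ hne).2
    simp only [shift_apply, add_neg_cancel] at this
    exact hx this

/-- Finite measures on path space are determined by the integrals of bounded continuous functions
of finitely many coordinates. -/
lemma ext_of_window [SecondCountableTopology E] {μ ν : Measure (ℤ → E)} [IsFiniteMeasure μ]
    [IsFiniteMeasure ν]
    (h : ∀ (m : ℕ) (F : (ℤ → E) → ℝ), Continuous F → (∃ C, ∀ x, |F x| ≤ C) →
      (∀ x, F (window m x) = F x) → ∫ x, F x ∂μ = ∫ x, F x ∂ν) : μ = ν := by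
  refine IsProjectiveLimit.unique (P := fun I : Finset ℤ => μ.map I.restrict)
    (fun I => rfl) (fun I => ?_)
  have hI : Measurable (I.restrict (π := fun _ : ℤ => E)) := Finset.measurable_restrict I
  refine ext_of_forall_integral_eq_of_IsFiniteMeasure fun f => ?_
  have hc : Continuous (I.restrict (π := fun _ : ℤ => E)) := Finset.continuous_restrict I
  rw [integral_map hI.aemeasurable f.continuous.aestronglyMeasurable,
    integral_map hI.aemeasurable f.continuous.aestronglyMeasurable]
  refine (h (I.sup Int.natAbs) (fun x => f (I.restrict x)) (f.continuous.comp hc)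
    ⟨‖f‖, fun x => f.norm_coe_le_norm _⟩ fun x => ?_).symm
  congr 1
  funext i
  have : i.1.natAbs ≤ I.sup Int.natAbs := Finset.le_sup (f := Int.natAbs) i.2
  simp only [Finset.restrict, window, trunc]
  exact if_pos ⟨by omega, by omega⟩

/-- The measure `s^{-α} P(sY ∈ ·)`, the restriction of the tail measure to `{‖x₀‖ > s}`. -/
noncomputable def tailAt (Q : Measure (ℤ → E)) (α s : ℝ) : Measure (ℤ → E) :=
  ENNReal.ofReal (s ^ (-α)) • Q.map (fun y => s • y)

lemma measurable_smul_path (s : ℝ) : Measurable fun y : ℤ → E => s • y :=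
  measurable_pi_lambda _ fun j => (measurable_pi_apply j).const_smul s

instance [IsFiniteMeasure Q] (s : ℝ) : IsFiniteMeasure (tailAt Q α s) := by
  unfold tailAt
  exact Measure.smul_finite _ ENNReal.ofReal_ne_top

lemma integral_tailAt {s : ℝ} (hs : 0 < s) {F : (ℤ → E) → ℝ} (hF : Measurable F) :
    ∫ x, F x ∂(tailAt Q α s) = s ^ (-α) * ∫ y, F (s • y) ∂Q := by
  rw [tailAt, integral_smul_measure, integral_map (measurable_smul_path s).aemeasurable
    hF.aestronglyMeasurable, ENNReal.toReal_ofReal (Real.rpow_nonneg hs.le _), smul_eq_mul]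

lemma tailAt_apply (s : ℝ) {A : Set (ℤ → E)} (hA : MeasurableSet A) :
    tailAt Q α s A = ENNReal.ofReal (s ^ (-α)) * Q {y | s • y ∈ A} := by
  rw [tailAt, Measure.smul_apply, Measure.map_apply (measurable_smul_path s) hA, smul_eq_mul]
  rfl

/-- A ramp approximating the indicator of `(s, ∞)` from below. -/
noncomputable def ramp (k : ℕ) (s t : ℝ) : ℝ := min 1 (k * max 0 (t - s))

lemma ramp_nonneg (k : ℕ) (s t : ℝ) : 0 ≤ ramp k s t := by unfold ramp; positivity

lemma ramp_le_one (k : ℕ) (s t : ℝ) : ramp k s t ≤ 1 := min_le_left _ _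

lemma continuous_ramp (k : ℕ) (s : ℝ) : Continuous (ramp k s) := by unfold ramp; fun_prop

lemma lt_of_ramp_ne_zero {k : ℕ} {s t : ℝ} (h : ramp k s t ≠ 0) : s < t := by
  by_contra! hst
  exact h (by simp [ramp, max_eq_left (sub_nonpos.2 hst)])

lemma tendsto_ramp (s t : ℝ) :
    Tendsto (fun k => ramp k s t) atTop (𝓝 (if s < t then 1 else 0)) := by
  split_ifs with h
  · refine tendsto_const_nhds.congr' ?_
    obtain ⟨K, hK⟩ := exists_nat_gt (t - s)⁻¹
    filter_upwards [eventually_ge_atTop K] with k hk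
    have h1 : (t - s)⁻¹ < k := hK.trans_le (by exact_mod_cast hk)
    have h2 : 0 < t - s := sub_pos.2 h
    rw [ramp, max_eq_right h2.le, eq_comm, min_eq_left]
    rw [inv_lt_iff_one_lt_mul₀ h2] at h1
    exact h1.le
  · refine tendsto_const_nhds.congr fun k => ?_
    by_contra hne
    exact h (lt_of_ramp_ne_zero (Ne.symm hne))

variable [SecondCountableTopology E]

/-- Shift-invariance of the tail measure, away from the paths vanishing at time `0` or `j`. -/
lemma BlockLimit.tailAt_restrict (h : BlockLimit P Q α p r) {s t : ℝ} (hs : 0 < s)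
    (ht : 0 < t) (j : ℤ) :
    (tailAt Q α s).restrict {x | s < ‖x 0‖ ∧ t < ‖x j‖} =
      ((tailAt Q α t).map (shift (-j))).restrict {x | s < ‖x 0‖ ∧ t < ‖x j‖} := by
  have := h.probQ
  set O : Set (ℤ → E) := {x | s < ‖x 0‖ ∧ t < ‖x j‖} with hO
  have hOm : MeasurableSet O := (measurableSet_exceed s 0).inter (measurableSet_exceed t j)
  let ψ : ℕ → (ℤ → E) → ℝ := fun k x => ramp k s ‖x 0‖ * ramp k t ‖x j‖
  have hψ0 : ∀ k x, 0 ≤ ψ k x := fun k x => mul_nonneg (ramp_nonneg _ _ _) (ramp_nonneg _ _ _)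
  have hψ1 : ∀ k x, ψ k x ≤ 1 := fun k x =>
    mul_le_one₀ (ramp_le_one _ _ _) (ramp_nonneg _ _ _) (ramp_le_one _ _ _)
  have hψc : ∀ k, Continuous (ψ k) := fun k =>
    ((continuous_ramp k s).comp (continuous_apply 0).norm).mul
      ((continuous_ramp k t).comp (continuous_apply j).norm)
  refine ext_of_window fun m F hF hb hw => ?_
  obtain ⟨C, hC⟩ := hb
  have lim : ∀ μ : Measure (ℤ → E), IsFiniteMeasure μ →
      Tendsto (fun k => ∫ x, F x * ψ k x ∂μ) atTop (𝓝 (∫ x in O, F x ∂μ)) := by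
    intro μ _
    rw [← integral_indicator hOm]
    refine tendsto_integral_of_dominated_convergence (fun _ => C)
      (fun k => (hF.mul (hψc k)).aestronglyMeasurable) (integrable_const C)
      (fun k => Eventually.of_forall fun x => ?_) (Eventually.of_forall fun x => ?_)
    · rw [Real.norm_eq_abs, abs_mul, abs_of_nonneg (hψ0 k x)]
      exact (mul_le_of_le_one_right (abs_nonneg _) (hψ1 k x)).trans (hC x)
    · have := ((tendsto_ramp s ‖x 0‖).mul (tendsto_ramp t ‖x j‖)).const_mul (F x)
      convert! this using 2
      by_cases h1 : s < ‖x 0‖ <;> by_cases h2 : t < ‖x j‖ <;> simp [O, h1, h2]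
  refine tendsto_nhds_unique (lim (tailAt Q α s) inferInstance)
    ((lim ((tailAt Q α t).map (shift (-j))) inferInstance).congr fun k => ?_)
  have hG : Continuous fun x => F x * ψ k x := hF.mul (hψc k)
  have key := h.integral_timeChange hs ht j (max m j.natAbs) hG
    ⟨C, fun x => by
      rw [abs_mul, abs_of_nonneg (hψ0 k x)]
      exact (mul_le_of_le_one_right (abs_nonneg _) (hψ1 k x)).trans (hC x)⟩
    (fun x => by
      rw [eq_of_window_le (le_max_left _ _) hw]
      congr 1
      have e0 : window (max m j.natAbs) x 0 = x 0 := if_pos ⟨by omega, by omega⟩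
      have ej : window (max m j.natAbs) x j = x j := if_pos ⟨by omega, by omega⟩
      simp only [ψ, e0, ej])
    (fun x hx => ⟨lt_of_ramp_ne_zero (left_ne_zero_of_mul (right_ne_zero_of_mul hx)),
      lt_of_ramp_ne_zero (right_ne_zero_of_mul (right_ne_zero_of_mul hx))⟩)
  rw [integral_map (measurable_shift _).aemeasurable hG.aestronglyMeasurable,
    integral_tailAt hs hG.measurable,
    integral_tailAt (F := fun x => F (shift (-j) x) * ψ k (shift (-j) x)) ht
      (hG.measurable.comp (measurable_shift _)), key]

/-- `P(‖Y₀‖ > 1) = 1`. -/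
lemma BlockLimit.one_lt_norm (h : BlockLimit P Q α p r) : ∀ᵐ y ∂Q, 1 < ‖y 0‖ := by
  have := h.probQ
  suffices hv : ∀ v : ℝ, 1 < v → v ^ (-α) ≤ Q.real {y | 1 < ‖y 0‖} by
    have h1 : (1 : ℝ) ≤ Q.real {y | 1 < ‖y 0‖} := by
      have : Tendsto (fun v : ℝ => v ^ (-α)) (𝓝[>] 1) (𝓝 ((1 : ℝ) ^ (-α))) :=
        ((Real.continuousAt_rpow_const 1 (-α) (Or.inl one_ne_zero)).tendsto).mono_left
          nhdsWithin_le_nhds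
      rw [Real.one_rpow] at this
      exact le_of_tendsto this (eventually_nhdsWithin_of_forall hv)
    have h2 : Q.real {y | 1 < ‖y 0‖} = 1 := le_antisymm measureReal_le_one h1
    have h3 : Q {y : ℤ → E | 1 < ‖y 0‖} = 1 := by
      rw [measureReal_def] at h2
      rw [← ENNReal.ofReal_toReal (measure_ne_top Q {y : ℤ → E | 1 < ‖y 0‖}), h2,
        ENNReal.ofReal_one]
    exact (mem_ae_iff_prob_eq_one (measurableSet_exceed 1 0)).2 h3
  intro v hv
  let g : ℝ → ℝ := fun t => min 1 (max 0 ((t - 1) / (v - 1)))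
  have hv1 : 0 < v - 1 := sub_pos.2 hv
  have hg : Continuous g := by simp only [g]; fun_prop
  have hg0 : ∀ t, 0 ≤ g t := fun t => by simp only [g]; positivity
  have hg1 : ∀ t, g t ≤ 1 := fun t => min_le_left _ _
  have hgc : Continuous fun x : ℤ → E => g ‖x 0‖ := hg.comp (continuous_apply 0).norm
  have hgv : ∀ t, v < t → g t = 1 := fun t ht => by
    have : 1 ≤ (t - 1) / (v - 1) := by rw [le_div_iff₀ hv1]; linarith
    exact min_eq_left (this.trans (le_max_right _ _))
  have T1 := h.tendsto_window 1 one_pos 0 (fun x => g ‖x 0‖) hgc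
    ⟨1, fun x => by rw [abs_of_nonneg (hg0 _)]; exact hg1 _⟩ (fun x => by simp [window, trunc])
  have T2 := h.tendsto_tail (zero_lt_one.trans hv)
  have hle : v ^ (-α) ≤ ∫ y, g ‖y 0‖ ∂Q := by
    have hle := le_of_tendsto_of_tendsto T2 T1 ?_
    · simpa using hle
    filter_upwards [h.p_pos] with n hn
    have := h.prob n
    refine div_le_div_of_nonneg_right ?_ hn.le
    have hsub : {x : ℤ → E | v < ‖x 0‖} ⊆ {x | 1 < ‖x 0‖} := fun x hx => hv.trans hx
    have hint : IntegrableOn (fun x : ℤ → E => g ‖x 0‖) {x | 1 < ‖x 0‖} (P n) :=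
      (Integrable.of_bound hgc.aestronglyMeasurable 1 (Eventually.of_forall fun x => by
        rw [Real.norm_eq_abs, abs_of_nonneg (hg0 _)]; exact hg1 _)).integrableOn
    calc (P n).real {x | v < ‖x 0‖} = ∫ x in {x | v < ‖x 0‖}, (1 : ℝ) ∂(P n) := by simp
      _ = ∫ x in {x | v < ‖x 0‖}, g ‖x 0‖ ∂(P n) :=
        setIntegral_congr_fun (measurableSet_exceed v 0) fun x hx => (hgv _ hx).symm
      _ ≤ _ := setIntegral_mono_set hint (Eventually.of_forall fun x => hg0 _)
        (Eventually.of_forall hsub)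
  refine hle.trans ?_
  rw [← integral_indicator_one (measurableSet_exceed 1 0)]
  refine integral_mono_of_nonneg (Eventually.of_forall fun y => hg0 _)
    ((integrable_const (1 : ℝ)).indicator (measurableSet_exceed 1 0))
    (Eventually.of_forall fun y => ?_)
  by_cases hy : 1 < ‖y 0‖
  · simpa [Set.indicator, hy] using hg1 _
  · have : g ‖y 0‖ = 0 := by
      have : (‖y 0‖ - 1) / (v - 1) ≤ 0 :=
        div_nonpos_of_nonpos_of_nonneg (by linarith [not_lt.1 hy]) hv1.le
      simp [g, max_eq_left this]
    simp [Set.indicator, hy, this]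

/-- The normalisation `x ↦ x / ‖x₀‖` of a path. -/
noncomputable def normalize (x : ℤ → E) : ℤ → E := ‖x 0‖⁻¹ • x

lemma measurable_normalize : Measurable (normalize (E := E)) :=
  measurable_pi_lambda _ fun j =>
    ((measurable_norm_apply 0).inv).smul (measurable_pi_apply j)

lemma normalize_smul {s : ℝ} (hs : 0 < s) (x : ℤ → E) : normalize (s • x) = normalize x := by
  funext j
  simp only [normalize, Pi.smul_apply, norm_smul, Real.norm_eq_abs, abs_of_pos hs, smul_smul]
  congr 1
  rw [mul_inv_rev, mul_assoc, inv_mul_cancel₀ hs.ne', mul_one]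

lemma smul_normalize {x : ℤ → E} (hx : x 0 ≠ 0) : ‖x 0‖ • normalize x = x := by
  rw [normalize, smul_smul, mul_inv_cancel₀ (norm_ne_zero_iff.2 hx), one_smul]

lemma norm_normalize_zero {x : ℤ → E} (hx : x 0 ≠ 0) : ‖normalize x 0‖ = 1 := by
  simp only [normalize, Pi.smul_apply, norm_smul, norm_inv, norm_norm]
  exact inv_mul_cancel₀ (norm_ne_zero_iff.2 hx)

/-- `‖Y₀‖ > v` has probability `v^{-α}`, independently of the spectral tail process `Y / ‖Y₀‖`: this
is `tailAt_restrict` at lag `0`, that is, the homogeneity of the tail measure. -/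
lemma BlockLimit.measure_norm_gt (h : BlockLimit P Q α p r) {v : ℝ} (hv : 1 ≤ v)
    {A : Set (ℤ → E)} (hA : MeasurableSet A) :
    Q {y | v < ‖y 0‖ ∧ normalize y ∈ A} = ENNReal.ofReal (v ^ (-α)) * Q (normalize ⁻¹' A) := by
  have hv0 : 0 < v := zero_lt_one.trans_le hv
  have key := h.tailAt_restrict one_pos hv0 0
  have hB : MeasurableSet (normalize ⁻¹' A) := measurable_normalize hA
  have hm : MeasurableSet ({x : ℤ → E | v < ‖x 0‖} ∩ normalize ⁻¹' A) :=
    (measurableSet_exceed v 0).inter hB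
  have hset : ({x : ℤ → E | v < ‖x 0‖} ∩ normalize ⁻¹' A) ∩ {x | 1 < ‖x 0‖ ∧ v < ‖x 0‖} =
      {x : ℤ → E | v < ‖x 0‖} ∩ normalize ⁻¹' A := by
    ext x; constructor
    · exact fun hx => hx.1
    · exact fun hx => ⟨hx, hv.trans_lt hx.1, hx.1⟩
  have e := congrArg (fun ν => ν ({x : ℤ → E | v < ‖x 0‖} ∩ normalize ⁻¹' A)) key
  simp only [Measure.restrict_apply hm, hset] at e
  have hid : (shift (-0) : (ℤ → E) → ℤ → E) = id := by funext x; simp [shift_zero']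
  rw [hid, Measure.map_id, tailAt_apply _ hm, tailAt_apply _ hm] at e
  simp only [one_smul, Real.one_rpow, ENNReal.ofReal_one, one_mul] at e
  refine Eq.trans (by rfl) (e.trans ?_)
  congr 1
  refine measure_congr ?_
  filter_upwards [h.one_lt_norm] with y hy
  refine propext ⟨fun hx => ?_, fun hx => ?_⟩
  · have := hx.2
    rwa [Set.mem_preimage, normalize_smul hv0] at this
  · refine ⟨?_, ?_⟩
    · simp only [Set.mem_ofPred_eq, Pi.smul_apply, norm_smul, Real.norm_eq_abs, abs_of_pos hv0]
      nlinarith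
    · rw [Set.mem_preimage, normalize_smul hv0]; exact hx

/-- The radial measure `α r^{-α-1} dr` on `(0, ∞)`. -/
noncomputable def radial (α : ℝ) : Measure ℝ :=
  (volume.restrict (Set.Ioi (0 : ℝ))).withDensity fun r => ENNReal.ofReal (α * r ^ (-α - 1))

instance (α : ℝ) : SFinite (radial α) := by unfold radial; infer_instance

lemma radial_Ioi {α : ℝ} (hα : 0 < α) {v : ℝ} (hv : 0 < v) :
    radial α (Set.Ioi v) = ENNReal.ofReal (v ^ (-α)) := by
  rw [radial, withDensity_apply _ measurableSet_Ioi,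
    Measure.restrict_restrict measurableSet_Ioi, Set.Ioi_inter_Ioi, sup_eq_left.2 hv.le,
    ← ofReal_integral_eq_lintegral_ofReal]
  · rw [integral_const_mul, integral_Ioi_rpow_of_lt (by linarith) hv]
    congr 1
    have : -α - 1 + 1 = -α := by ring
    rw [this]
    field_simp
  · exact (integrableOn_Ioi_rpow_of_lt (by linarith) hv).const_mul α
  · refine (ae_restrict_iff' measurableSet_Ioi).2 (Eventually.of_forall fun x hx => ?_)
    have : 0 < x := hv.trans hx
    positivity

lemma radial_Iic_zero (α : ℝ) : radial α (Set.Iic 0) = 0 := by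
  rw [radial]
  refine withDensity_absolutelyContinuous _ _ ?_
  rw [Measure.restrict_apply measurableSet_Iic]
  simp [Set.Iic_inter_Ioi]

/-- Finite measures on `ℝ` agreeing on the right half-lines and in total mass are equal. -/
lemma ext_of_Ioi_real {μ ν : Measure ℝ} [IsFiniteMeasure μ]
    [IsFiniteMeasure ν] (huniv : μ Set.univ = ν Set.univ)
    (h : ∀ a, μ (Set.Ioi a) = ν (Set.Ioi a)) : μ = ν := by
  refine Measure.ext_of_Iic μ ν fun a => ?_
  rw [← Set.compl_Ioi, measure_compl measurableSet_Ioi (measure_ne_top _ _),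
    measure_compl measurableSet_Ioi (measure_ne_top _ _), huniv, h]

lemma isFiniteMeasure_radial_Ioi {α : ℝ} (hα : 0 < α) {v : ℝ} (hv : 0 < v) :
    IsFiniteMeasure ((radial α).restrict (Set.Ioi v)) :=
  ⟨by rw [Measure.restrict_apply_univ, radial_Ioi hα hv]; exact ENNReal.ofReal_lt_top⟩

/-- Homogeneity of the radial measure. -/
lemma radial_restrict {α : ℝ} (hα : 0 < α) {s : ℝ} (hs : 0 < s) :
    (radial α).restrict (Set.Ioi s) =
      ENNReal.ofReal (s ^ (-α)) • ((radial α).restrict (Set.Ioi 1)).map (fun v => s * v) := by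
  have := isFiniteMeasure_radial_Ioi hα hs
  have := isFiniteMeasure_radial_Ioi hα one_pos
  have hm : Measurable fun v : ℝ => s * v := measurable_const_mul s
  have : IsFiniteMeasure (ENNReal.ofReal (s ^ (-α)) •
      ((radial α).restrict (Set.Ioi 1)).map (fun v => s * v)) :=
    Measure.smul_finite _ ENNReal.ofReal_ne_top
  refine ext_of_Ioi_real ?_ fun a => ?_
  · rw [Measure.smul_apply, Measure.map_apply hm MeasurableSet.univ, Set.preimage_univ,
      Measure.restrict_apply_univ, Measure.restrict_apply_univ, radial_Ioi hα hs,
      radial_Ioi hα one_pos]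
    simp
  · have hpre : (fun v : ℝ => s * v) ⁻¹' Set.Ioi a = Set.Ioi (a / s) := by
      ext v; simp [div_lt_iff₀ hs, mul_comm]
    rw [Measure.smul_apply, Measure.map_apply hm measurableSet_Ioi, hpre,
      Measure.restrict_apply measurableSet_Ioi, Measure.restrict_apply measurableSet_Ioi,
      Set.Ioi_inter_Ioi, Set.Ioi_inter_Ioi, radial_Ioi hα (hs.trans_le le_sup_right),
      radial_Ioi hα (one_pos.trans_le le_sup_right), smul_eq_mul,
      ← ENNReal.ofReal_mul (by positivity),
      ← Real.mul_rpow hs.le (zero_le_one.trans le_sup_right)]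
    congr 2
    change max a s = s * max (a / s) 1
    rw [mul_max_of_nonneg _ _ hs.le, mul_div_cancel₀ _ hs.ne', mul_one]

/-- `‖Y₀‖` is Pareto distributed and independent of the spectral tail process. -/
lemma BlockLimit.map_polar (h : BlockLimit P Q α p r) :
    Q.map (fun y => (‖y 0‖, normalize y)) =
      ((radial α).restrict (Set.Ioi 1)).prod (Q.map normalize) := by
  have := h.probQ
  have := isFiniteMeasure_radial_Ioi h.α_pos one_pos
  have hm : Measurable fun y : ℤ → E => (‖y 0‖, normalize y) :=
    (measurable_norm_apply 0).prodMk measurable_normalize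
  refine (Measure.prod_eq fun B A hB hA => ?_).symm
  rw [Measure.map_apply hm (hB.prod hA), Measure.map_apply measurable_normalize hA]
  have hpre : MeasurableSet (normalize (E := E) ⁻¹' A) := measurable_normalize hA
  suffices heq : ((Q.restrict (normalize ⁻¹' A)).map fun y => ‖y 0‖) =
      Q (normalize ⁻¹' A) • ((radial α).restrict (Set.Ioi 1)) by
    have := congrArg (fun ν => ν B) heq
    simp only [Measure.map_apply (measurable_norm_apply 0) hB, Measure.smul_apply,
      smul_eq_mul, Measure.restrict_apply ((measurable_norm_apply 0) hB)] at this
    rw [mul_comm, ← this]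
    rfl
  have : IsFiniteMeasure (Q (normalize ⁻¹' A) • ((radial α).restrict (Set.Ioi 1))) :=
    Measure.smul_finite _ (measure_ne_top _ _)
  have hge : ∀ a : ℝ, 1 ≤ a → ((Q.restrict (normalize ⁻¹' A)).map fun y => ‖y 0‖) (Set.Ioi a) =
      (Q (normalize ⁻¹' A) • ((radial α).restrict (Set.Ioi 1))) (Set.Ioi a) := by
    intro a ha
    rw [Measure.map_apply (measurable_norm_apply 0) measurableSet_Ioi,
      Measure.restrict_apply ((measurable_norm_apply 0) measurableSet_Ioi), Measure.smul_apply,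
      Measure.restrict_apply measurableSet_Ioi, Set.Ioi_inter_Ioi, sup_eq_left.2 ha,
      radial_Ioi h.α_pos (one_pos.trans_le ha), smul_eq_mul, mul_comm, ← h.measure_norm_gt ha hA]
    rfl
  have hsup : ∀ a : ℝ, ((Q.restrict (normalize ⁻¹' A)).map fun y => ‖y 0‖) (Set.Ioi a) =
      ((Q.restrict (normalize ⁻¹' A)).map fun y => ‖y 0‖) (Set.Ioi (a ⊔ 1)) := by
    intro a
    rw [Measure.map_apply (measurable_norm_apply 0) measurableSet_Ioi,
      Measure.map_apply (measurable_norm_apply 0) measurableSet_Ioi]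
    refine measure_congr ?_
    filter_upwards [ae_restrict_of_ae h.one_lt_norm] with y hy
    refine propext ⟨fun hx => ?_, fun hx => ?_⟩
    · exact max_lt hx hy
    · exact (le_max_left a 1).trans_lt (show max a 1 < ‖y 0‖ from hx)
  have hsup' : ∀ a : ℝ, (Q (normalize ⁻¹' A) • ((radial α).restrict (Set.Ioi 1))) (Set.Ioi a) =
      (Q (normalize ⁻¹' A) • ((radial α).restrict (Set.Ioi 1))) (Set.Ioi (a ⊔ 1)) := by
    intro a
    rw [Measure.smul_apply, Measure.smul_apply, Measure.restrict_apply measurableSet_Ioi,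
      Measure.restrict_apply measurableSet_Ioi, Set.Ioi_inter_Ioi, Set.Ioi_inter_Ioi,
      sup_assoc, sup_idem]
  have hall : ∀ a : ℝ, ((Q.restrict (normalize ⁻¹' A)).map fun y => ‖y 0‖) (Set.Ioi a) =
      (Q (normalize ⁻¹' A) • ((radial α).restrict (Set.Ioi 1))) (Set.Ioi a) := fun a => by
    rw [hsup, hsup', hge _ le_sup_right]
  refine ext_of_Ioi_real ?_ hall
  rw [Measure.map_apply (measurable_norm_apply 0) MeasurableSet.univ, Set.preimage_univ,
    Measure.restrict_apply_univ, Measure.smul_apply, Measure.restrict_apply_univ,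
    radial_Ioi h.α_pos one_pos]
  simp

end tail

/-! ### Polar form of the tail measure and mass transport -/

section tailMeasure

variable {E : Type*} [NormedAddCommGroup E] [NormedSpace ℝ E] [MeasurableSpace E] [BorelSpace E]
variable {P : ℕ → Measure (ℤ → E)} {Q : Measure (ℤ → E)} {α : ℝ} {p : ℕ → ℝ} {r : ℕ → ℕ}

/-- The tail measure restricted to the paths which do not vanish at time `0`, in polar form. -/
noncomputable def tailMeasure (Q : Measure (ℤ → E)) (α : ℝ) : Measure (ℤ → E) :=
  ((radial α).prod Q).map fun q => q.1 • normalize q.2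

variable [SecondCountableTopology E]

lemma measurable_polar : Measurable fun q : ℝ × (ℤ → E) => q.1 • normalize q.2 :=
  measurable_pi_lambda _ fun j =>
    measurable_fst.smul ((measurable_pi_apply j).comp (measurable_normalize.comp measurable_snd))

lemma BlockLimit.ae_prod (h : BlockLimit P Q α p r) :
    ∀ᵐ q ∂((radial α).prod Q), 0 < q.1 ∧ 1 < ‖q.2 0‖ := by
  have := h.probQ
  have h1 : ∀ᵐ v ∂(radial α), 0 < v := by
    rw [ae_iff]
    simpa [Set.Iic_def] using radial_Iic_zero α
  have h2 := Measure.quasiMeasurePreserving_fst (μ := radial α) (ν := Q) |>.ae h1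
  have h3 := Measure.quasiMeasurePreserving_snd (μ := radial α) (ν := Q) |>.ae h.one_lt_norm
  filter_upwards [h2, h3] with q a b using ⟨a, b⟩

lemma ne_zero_of_one_lt_norm {x : E} (h : 1 < ‖x‖) : x ≠ 0 := by
  rintro rfl; simp at h; linarith

/-- On `{‖x₀‖ > s}` the tail measure is `s^{-α} P(sY ∈ ·)`. -/
lemma BlockLimit.tailMeasure_restrict (h : BlockLimit P Q α p r) {s : ℝ} (hs : 0 < s) :
    (tailMeasure Q α).restrict {x | s < ‖x 0‖} = tailAt Q α s := by
  have := h.probQ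
  have := isFiniteMeasure_radial_Ioi h.α_pos one_pos
  have hmul : Measurable fun v : ℝ => s * v := measurable_const_mul s
  have hpre : (fun q : ℝ × (ℤ → E) => q.1 • normalize q.2) ⁻¹' {x | s < ‖x 0‖}
      =ᵐ[(radial α).prod Q] Set.Ioi s ×ˢ Set.univ := by
    filter_upwards [h.ae_prod] with q hq
    refine propext ?_
    change s < ‖q.1 • normalize q.2 0‖ ↔ _
    rw [norm_smul, norm_normalize_zero (ne_zero_of_one_lt_norm hq.2), mul_one,
      Real.norm_eq_abs, abs_of_pos hq.1]
    exact ⟨fun hx => ⟨hx, trivial⟩, fun hx => hx.1⟩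
  have hdec : (fun q : ℝ × (ℤ → E) => q.1 • normalize q.2) ∘
      (Prod.map (fun v : ℝ => s * v) id) = fun q => (s * q.1) • normalize q.2 := rfl
  have hdec2 : (fun q : ℝ × (ℤ → E) => (s * q.1) • normalize q.2) =
      (fun q : ℝ × (ℤ → E) => (s * q.1) • q.2) ∘ (Prod.map id normalize) := rfl
  have hmG : Measurable fun q : ℝ × (ℤ → E) => (s * q.1) • q.2 :=
    measurable_pi_lambda _ fun j =>
      (hmul.comp measurable_fst).smul ((measurable_pi_apply j).comp measurable_snd)
  rw [tailMeasure, Measure.restrict_map measurable_polar (measurableSet_exceed s 0),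
    Measure.restrict_congr_set hpre, ← Measure.prod_restrict, Measure.restrict_univ,
    radial_restrict h.α_pos hs, Measure.prod_smul_left, Measure.map_smul, tailAt]
  congr 1
  have e1 : (((radial α).restrict (Set.Ioi 1)).map fun v => s * v).prod Q =
      (((radial α).restrict (Set.Ioi 1)).prod Q).map (Prod.map (fun v => s * v) id) := by
    rw [← Measure.map_prod_map _ _ hmul measurable_id, Measure.map_id]
  have e2 : ((radial α).restrict (Set.Ioi 1)).prod (Q.map normalize) =
      (((radial α).restrict (Set.Ioi 1)).prod Q).map (Prod.map id normalize) := by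
    rw [← Measure.map_prod_map _ _ measurable_id measurable_normalize, Measure.map_id]
  rw [e1, Measure.map_map measurable_polar (hmul.prodMap measurable_id), hdec, hdec2,
    ← Measure.map_map hmG (measurable_id.prodMap measurable_normalize), ← e2, ← h.map_polar,
    Measure.map_map hmG ((measurable_norm_apply 0).prodMk measurable_normalize)]
  refine Measure.map_congr ?_
  filter_upwards [h.one_lt_norm] with y hy
  change (s * ‖y 0‖) • normalize y = s • y
  rw [mul_smul, smul_normalize (ne_zero_of_one_lt_norm hy)]

/-- A property of all the positive multiples of the tail process holds almost everywhere for the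
tail measure. -/
lemma BlockLimit.ae_tailMeasure (h : BlockLimit P Q α p r) {φ : (ℤ → E) → Prop}
    (hφ : ∀ᵐ y ∂Q, ∀ c : ℝ, 0 < c → φ (c • y)) (hm : MeasurableSet {x | φ x}) :
    ∀ᵐ x ∂(tailMeasure Q α), φ x := by
  have := h.probQ
  rw [tailMeasure, ae_map_iff measurable_polar.aemeasurable hm]
  have h3 := Measure.quasiMeasurePreserving_snd (μ := radial α) (ν := Q) |>.ae hφ
  filter_upwards [h.ae_prod, h3] with q hq hq3
  have : 0 < ‖q.2 0‖ := one_pos.trans hq.2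
  rw [normalize, smul_smul]
  exact hq3 _ (mul_pos hq.1 (inv_pos.2 this))

lemma measurableSet_ne_zero (j : ℤ) : MeasurableSet {x : ℤ → E | x j ≠ 0} :=
  (measurableSet_singleton (0 : E)).compl.preimage (measurable_pi_apply j)

lemma BlockLimit.ae_ne_zero (h : BlockLimit P Q α p r) :
    ∀ᵐ x ∂(tailMeasure Q α), x 0 ≠ 0 := by
  refine h.ae_tailMeasure ?_ (measurableSet_ne_zero 0)
  filter_upwards [h.one_lt_norm] with y hy c hc
  exact smul_ne_zero hc.ne' (ne_zero_of_one_lt_norm hy)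

/-- Integration of functions vanishing on `{‖x₀‖ ≤ s}` against the tail measure. -/
lemma BlockLimit.lintegral_tailMeasure (h : BlockLimit P Q α p r) {s : ℝ} (hs : 0 < s)
    {g : (ℤ → E) → ℝ≥0∞} (hg : Measurable g) (h0 : ∀ x, ‖x 0‖ ≤ s → g x = 0) :
    ∫⁻ x, g x ∂(tailMeasure Q α) = ENNReal.ofReal (s ^ (-α)) * ∫⁻ y, g (s • y) ∂Q := by
  have hset : ∫⁻ x, g x ∂(tailMeasure Q α) =
      ∫⁻ x in {x | s < ‖x 0‖}, g x ∂(tailMeasure Q α) := by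
    rw [← lintegral_indicator (measurableSet_exceed s 0)]
    refine lintegral_congr fun x => ?_
    by_cases hx : s < ‖x 0‖
    · rw [Set.indicator_of_mem (by exact hx)]
    · rw [Set.indicator_of_notMem (by exact hx), h0 x (not_lt.1 hx)]
  rw [hset, h.tailMeasure_restrict hs, tailAt, lintegral_smul_measure,
    lintegral_map hg (measurable_smul_path s), smul_eq_mul]

/-- Shift-invariance of the tail measure. -/
lemma BlockLimit.tailMeasure_shift (h : BlockLimit P Q α p r) (j : ℤ) :
    (tailMeasure Q α).restrict {x | x 0 ≠ 0 ∧ x j ≠ 0} =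
      ((tailMeasure Q α).map (shift (-j))).restrict {x | x 0 ≠ 0 ∧ x j ≠ 0} := by
  have hO : MeasurableSet {x : ℤ → E | x 0 ≠ 0 ∧ x j ≠ 0} :=
    (measurableSet_ne_zero 0).inter (measurableSet_ne_zero j)
  ext A hA
  rw [Measure.restrict_apply hA, Measure.restrict_apply hA,
    Measure.map_apply (measurable_shift _) (hA.inter hO)]
  let S : ℕ → Set (ℤ → E) := fun n =>
    {x | 1 / ((n : ℝ) + 1) < ‖x 0‖ ∧ 1 / ((n : ℝ) + 1) < ‖x j‖}
  have hSm : ∀ n, MeasurableSet (S n) := fun n =>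
    (measurableSet_exceed _ 0).inter (measurableSet_exceed _ j)
  have hmono : Monotone S := fun n m hnm x hx => by
    have : 1 / ((m : ℝ) + 1) ≤ 1 / ((n : ℝ) + 1) :=
      one_div_le_one_div_of_le (by positivity) (by exact_mod_cast Nat.succ_le_succ hnm)
    exact ⟨this.trans_lt hx.1, this.trans_lt hx.2⟩
  have hU : A ∩ {x | x 0 ≠ 0 ∧ x j ≠ 0} = ⋃ n, A ∩ S n := by
    rw [← Set.inter_iUnion]
    congr 1
    ext x
    simp only [Set.mem_iUnion]
    constructor
    · rintro ⟨h0, hj⟩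
      obtain ⟨n, hn⟩ := exists_nat_one_div_lt (lt_min (norm_pos_iff.2 h0) (norm_pos_iff.2 hj))
      exact ⟨n, hn.trans_le (min_le_left _ _), hn.trans_le (min_le_right _ _)⟩
    · rintro ⟨n, h0, hj⟩
      have : (0 : ℝ) < 1 / ((n : ℝ) + 1) := by positivity
      exact ⟨norm_pos_iff.1 (this.trans h0), norm_pos_iff.1 (this.trans hj)⟩
  have hAmono : Monotone fun n => A ∩ S n := fun n m hnm =>
    Set.inter_subset_inter_right _ (hmono hnm)
  rw [hU, Set.preimage_iUnion]
  refine tendsto_nhds_unique (tendsto_measure_iUnion_atTop hAmono)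
    ((tendsto_measure_iUnion_atTop fun n m hnm =>
      Set.preimage_mono (hAmono hnm)).congr fun n => ?_)
  have hs : (0 : ℝ) < 1 / ((n : ℝ) + 1) := by positivity
  have hm : MeasurableSet (A ∩ S n) := hA.inter (hSm n)
  have key := congrArg (fun ν => ν (A ∩ S n)) (h.tailAt_restrict hs hs j)
  simp only [Measure.restrict_apply hm] at key
  have hin : A ∩ S n ∩ {x | 1 / ((n : ℝ) + 1) < ‖x 0‖ ∧ 1 / ((n : ℝ) + 1) < ‖x j‖} = A ∩ S n :=
    Set.inter_eq_left.2 Set.inter_subset_right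
  rw [hin, Measure.map_apply (measurable_shift _) hm, ← h.tailMeasure_restrict hs,
    Measure.restrict_apply hm, Measure.restrict_apply ((measurable_shift _) hm)] at key
  have e1 : A ∩ S n ∩ {x | 1 / ((n : ℝ) + 1) < ‖x 0‖} = A ∩ S n :=
    Set.inter_eq_left.2 fun x hx => hx.2.1
  have e2 : shift (-j) ⁻¹' (A ∩ S n) ∩ {x | 1 / ((n : ℝ) + 1) < ‖x 0‖} =
      shift (-j) ⁻¹' (A ∩ S n) :=
    Set.inter_eq_left.2 fun x hx => by
      have := hx.2.2
      simpa [shift_apply] using this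
  rw [e1, e2] at key
  exact key.symm

/-- Shift-invariance of the tail measure, for integrals. The restriction to `{x_{-j} ≠ 0}` is needed
since the tail measure only charges paths which do not vanish at time `0`. -/
lemma BlockLimit.lintegral_shift_tail (h : BlockLimit P Q α p r) (j : ℤ)
    {f : (ℤ → E) → ℝ≥0∞} (hf : Measurable f) (h0 : ∀ x, x j = 0 → f x = 0) :
    ∫⁻ x, f x ∂(tailMeasure Q α) =
      ∫⁻ x in {x | x (-j) ≠ 0}, f (shift (-j) x) ∂(tailMeasure Q α) := by
  have hO : MeasurableSet {x : ℤ → E | x 0 ≠ 0 ∧ x j ≠ 0} :=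
    (measurableSet_ne_zero 0).inter (measurableSet_ne_zero j)
  have h1 : ∫⁻ x, f x ∂(tailMeasure Q α) =
      ∫⁻ x in {x | x 0 ≠ 0 ∧ x j ≠ 0}, f x ∂(tailMeasure Q α) := by
    rw [← lintegral_indicator hO]
    refine lintegral_congr_ae ?_
    filter_upwards [h.ae_ne_zero] with x hx
    by_cases hj : x j = 0
    · simp [Set.indicator, hj, h0 x hj]
    · simp [Set.indicator, hj, hx]
  rw [h1, h.tailMeasure_shift j, Measure.restrict_map (measurable_shift _) hO,
    lintegral_map hf (measurable_shift _)]
  refine setLIntegral_congr ?_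
  filter_upwards [h.ae_ne_zero] with x hx
  refine propext ?_
  change (shift (-j) x 0 ≠ 0 ∧ shift (-j) x j ≠ 0) ↔ x (-j) ≠ 0
  simp [shift_apply, hx]

/-! ### The anchor of a path -/

/-- The set of times `j` at which the running maximum of `‖x‖` up to `j` is the global one. -/
def argSet (x : ℤ → E) : Set ℤ := {j | (⨆ (l : ℤ) (_ : l ≤ j), ‖x l‖ₑ) = ⨆ l : ℤ, ‖x l‖ₑ}

/-- Anchoring at `j`: the path seen from `j` is anchored at `0` exactly if `j` is the first time at
which the maximum is reached. -/
lemma infargmax_shift_iff (j : ℤ) (x : ℤ → E) :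
    InfargmaxEqZero (shift j x) ↔ IsLeast (argSet x) j := by
  have hg : (⨆ l : ℤ, ‖shift j x l‖ₑ) = ⨆ l : ℤ, ‖x l‖ₑ :=
    (Equiv.addRight j).iSup_comp (g := fun l => ‖x l‖ₑ)
  have hl : ∀ i : ℤ, (⨆ (l : ℤ) (_ : l ≤ i), ‖shift j x l‖ₑ) =
      ⨆ (l : ℤ) (_ : l ≤ i + j), ‖x l‖ₑ := by
    intro i
    rw [← (Equiv.addRight j).iSup_comp (g := fun l => ⨆ (_ : l ≤ i + j), ‖x l‖ₑ)]
    refine iSup_congr fun l => ?_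
    simp [shift_apply]
  have hs : ∀ i : ℤ, i ∈ {i : ℤ | (⨆ (l : ℤ) (_ : l ≤ i), ‖shift j x l‖ₑ) =
      ⨆ l : ℤ, ‖shift j x l‖ₑ} ↔ i + j ∈ argSet x := by
    intro i
    simp only [Set.mem_ofPred_eq, argSet, hg, hl]
  unfold InfargmaxEqZero
  constructor
  · rintro ⟨h0, hlb⟩
    refine ⟨by simpa using (hs 0).1 h0, fun i hi => ?_⟩
    have := hlb ((hs (i - j)).2 (by simpa using hi))
    linarith
  · rintro ⟨h0, hlb⟩
    refine ⟨(hs 0).2 (by simpa using h0), fun i hi => ?_⟩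
    have := hlb ((hs i).1 hi)
    linarith

lemma ne_zero_of_isLeast_argSet {x : ℤ → E} {j : ℤ} (h : IsLeast (argSet x) j) : x j ≠ 0 := by
  intro h0
  have : j - 1 ∈ argSet x := by
    have hj : (⨆ (l : ℤ) (_ : l ≤ j), ‖x l‖ₑ) = ⨆ l : ℤ, ‖x l‖ₑ := h.1
    change (⨆ (l : ℤ) (_ : l ≤ j - 1), ‖x l‖ₑ) = ⨆ l : ℤ, ‖x l‖ₑ
    rw [← hj]
    refine le_antisymm (iSup₂_le fun l hl => le_iSup₂_of_le l (by omega) le_rfl)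
      (iSup₂_le fun l hl => ?_)
    rcases hl.lt_or_eq with hl | rfl
    · exact le_iSup₂_of_le l (by omega) le_rfl
    · simp [h0]
  have := h.2 this
  omega

/-- A nonzero path tending to zero at infinity has an anchor: it is smaller than `‖x_k‖ / 2` off a
finite set of times. -/
lemma exists_isLeast_argSet {x : ℤ → E} (hx : x ∈ l0 E) {k : ℤ} (hk : x k ≠ 0) :
    ∃ j, IsLeast (argSet x) j := by
  have hk' : 0 < ‖x k‖ := norm_pos_iff.2 hk
  have hfin := finite_le_norm_of_mem_l0 hx (half_pos hk')
  obtain ⟨b, hb⟩ := hfin.bddAbove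
  obtain ⟨a, ha⟩ := hfin.bddBelow
  have hkm : k ∈ {l : ℤ | ‖x k‖ / 2 ≤ ‖x l‖} := by simp only [Set.mem_ofPred_eq]; linarith
  have hsmall : ∀ l, l ∉ {l : ℤ | ‖x k‖ / 2 ≤ ‖x l‖} → ‖x l‖ₑ ≤ ENNReal.ofReal (‖x k‖ / 2) := by
    intro l hl
    rw [← ofReal_norm]
    exact ENNReal.ofReal_le_ofReal (not_le.1 hl).le
  have hne : (argSet x).Nonempty := by
    refine ⟨b, le_antisymm (iSup₂_le fun l _ => le_iSup (fun l => ‖x l‖ₑ) l)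
      (iSup_le fun l => ?_)⟩
    by_cases hl : l ∈ {l : ℤ | ‖x k‖ / 2 ≤ ‖x l‖}
    · exact le_iSup₂_of_le l (hb hl) le_rfl
    · refine (hsmall l hl).trans (le_iSup₂_of_le k (hb hkm) ?_)
      rw [← ofReal_norm]
      exact ENNReal.ofReal_le_ofReal (by linarith)
  have hbd : ∀ i ∈ argSet x, a ≤ i := by
    intro i hi
    by_contra! hia
    have h1 : (⨆ (l : ℤ) (_ : l ≤ i), ‖x l‖ₑ) ≤ ENNReal.ofReal (‖x k‖ / 2) :=
      iSup₂_le fun l hl => hsmall l fun hl' => by have := ha hl'; omega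
    have h2 : ‖x k‖ₑ ≤ ⨆ l : ℤ, ‖x l‖ₑ := le_iSup (fun l => ‖x l‖ₑ) k
    rw [← show (⨆ (l : ℤ) (_ : l ≤ i), ‖x l‖ₑ) = ⨆ l : ℤ, ‖x l‖ₑ from hi] at h2
    have h3 := h2.trans h1
    rw [← ofReal_norm, ENNReal.ofReal_le_ofReal_iff (by positivity)] at h3
    linarith
  obtain ⟨j, hj, hlb⟩ := Int.exists_least_of_bdd ⟨a, hbd⟩ hne
  exact ⟨j, hj, fun i hi => hlb i hi⟩

lemma infargmax_smul_iff {c : ℝ} (hc : 0 < c) (x : ℤ → E) :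
    InfargmaxEqZero (c • x) ↔ InfargmaxEqZero x := by
  have he : ‖c‖ₑ ≠ 0 := by simpa using hc.ne'
  have ht : ‖c‖ₑ ≠ ∞ := enorm_ne_top
  unfold InfargmaxEqZero
  simp only [Pi.smul_apply, enorm_smul, ← ENNReal.mul_iSup]
  simp only [ENNReal.mul_right_inj he ht]

lemma measurableSet_infargmax : MeasurableSet {x : ℤ → E | InfargmaxEqZero x} := by
  have hm : ∀ j : ℤ, MeasurableSet {x : ℤ → E | j ∈ argSet x} := fun j =>
    measurableSet_eq_fun
      (Measurable.iSup fun l => Measurable.iSup fun _ => (measurable_pi_apply l).enorm)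
      (Measurable.iSup fun l => (measurable_pi_apply l).enorm)
  have : {x : ℤ → E | InfargmaxEqZero x} =
      {x | (0 : ℤ) ∈ argSet x} ∩ ⋂ j : ℤ, ⋂ (_ : ¬ 0 ≤ j), {x | j ∈ argSet x}ᶜ := by
    ext x
    simp only [Set.mem_ofPred_eq, Set.mem_inter_iff, Set.mem_iInter, Set.mem_compl_iff]
    refine and_congr Iff.rfl ⟨fun h j hj hm => hj (h hm), fun h j hj => ?_⟩
    by_contra hneg
    exact h j hneg hj
  rw [this]
  exact (hm 0).inter (MeasurableSet.iInter fun j => MeasurableSet.iInter fun _ => (hm j).compl)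

lemma measurableSet_l0 : MeasurableSet (l0 E) := by
  have : l0 E = ⋂ n : ℕ, ⋃ m : ℕ, ⋂ j : ℤ, ⋂ (_ : (m : ℤ) < |j|),
      {x : ℤ → E | ‖x j‖ ≤ 1 / ((n : ℝ) + 1)} := by
    ext x
    simp only [Set.mem_iInter, Set.mem_iUnion, Set.mem_ofPred_eq]
    constructor
    · intro hx n
      have := finite_le_norm_of_mem_l0 hx (show (0 : ℝ) < 1 / ((n : ℝ) + 1) by positivity)
      obtain ⟨M, hM⟩ := (this.image fun j => |j|).bddAbove
      refine ⟨M.natAbs, fun j hj => ?_⟩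
      by_contra hneg
      have := hM ⟨j, (not_le.1 hneg).le, rfl⟩
      simp only at this
      omega
    · intro h
      change Tendsto x cofinite (𝓝 0)
      rw [Metric.tendsto_nhds]
      intro ε hε
      obtain ⟨n, hn⟩ := exists_nat_one_div_lt hε
      obtain ⟨m, hm⟩ := h n
      rw [Filter.eventually_cofinite]
      refine (Set.finite_Icc (-(m : ℤ)) m).subset fun j hj => ?_
      by_contra hneg
      refine hj ?_
      rw [dist_zero_right]
      refine (hm j ?_).trans_lt hn
      rw [Set.mem_Icc, ← abs_le] at hneg
      omega
  rw [this]
  exact MeasurableSet.iInter fun n => MeasurableSet.iUnion fun m => MeasurableSet.iInter fun j =>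
    MeasurableSet.iInter fun _ => measurableSet_le (measurable_norm_apply j) measurable_const

/-- The cluster measure is the tail measure restricted to the paths anchored at `0`. -/
lemma BlockLimit.clusterMeasure_eq {Ω' : Type*} [MeasurableSpace Ω'] {μ' : Measure Ω'}
    {Y : ℤ → Ω' → E} (hY : ∀ j, Measurable (Y j))
    (h : BlockLimit P (μ'.map fun ω j => Y j ω) α p r) :
    clusterMeasure α μ' Y =
      (tailMeasure (μ'.map fun ω j => Y j ω) α).restrict {x | InfargmaxEqZero x} := by
  have hYm : Measurable fun ω j => Y j ω := measurable_pi_lambda _ hY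
  set Q := μ'.map fun ω j => Y j ω with hQ
  have := h.probQ
  have hfin : IsFiniteMeasure μ' :=
    ⟨by have := measure_lt_top Q Set.univ
        rwa [hQ, Measure.map_apply hYm MeasurableSet.univ, Set.preimage_univ] at this⟩
  have hpre : (fun q : ℝ × (ℤ → E) => q.1 • normalize q.2) ⁻¹' {x | InfargmaxEqZero x}
      =ᵐ[(radial α).prod Q] Set.univ ×ˢ (normalize ⁻¹' {x | InfargmaxEqZero x}) := by
    filter_upwards [h.ae_prod] with q hq
    refine propext ?_
    change InfargmaxEqZero (q.1 • normalize q.2) ↔ _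
    rw [infargmax_smul_iff hq.1]
    exact ⟨fun hx => ⟨trivial, hx⟩, fun hx => hx.2⟩
  have hN : MeasurableSet (normalize ⁻¹' {x : ℤ → E | InfargmaxEqZero x}) :=
    measurable_normalize measurableSet_infargmax
  rw [tailMeasure, Measure.restrict_map measurable_polar measurableSet_infargmax,
    Measure.restrict_congr_set hpre, ← Measure.prod_restrict, Measure.restrict_univ, hQ,
    Measure.restrict_map hYm hN]
  have e : (radial α).prod (Measure.map (fun ω j => Y j ω)
      (μ'.restrict ((fun ω j => Y j ω) ⁻¹' (normalize ⁻¹' {x | InfargmaxEqZero x})))) =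
      ((radial α).prod (μ'.restrict ((fun ω j => Y j ω) ⁻¹'
        (normalize ⁻¹' {x | InfargmaxEqZero x})))).map (Prod.map id fun ω j => Y j ω) := by
    rw [← Measure.map_prod_map _ _ measurable_id hYm, Measure.map_id]
  rw [e, Measure.map_map measurable_polar (measurable_id.prodMap hYm)]
  rfl

/-- The mass transport formula between the tail measure and the cluster measure: integrating `g`
against the tail measure amounts to integrating `∑_j g(B^j x)` over anchored paths. -/
lemma BlockLimit.massTransport (h : BlockLimit P Q α p r)
    (hl0 : ∀ᵐ y ∂Q, y ∈ l0 E) {g : (ℤ → E) → ℝ≥0∞} (hg : Measurable g)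
    (h0 : ∀ x, x 0 = 0 → g x = 0) :
    ∫⁻ x, g x ∂(tailMeasure Q α) =
      ∫⁻ x in {x | InfargmaxEqZero x}, ∑' j, g (shift j x) ∂(tailMeasure Q α) := by
  have hl0' : ∀ᵐ x ∂(tailMeasure Q α), x ∈ l0 E := by
    refine h.ae_tailMeasure ?_ measurableSet_l0
    filter_upwards [hl0] with y hy c _
    have : Tendsto (fun j => c • y j) cofinite (𝓝 (c • (0 : E))) :=
      (show Tendsto y cofinite (𝓝 0) from hy).const_smul c
    rw [smul_zero] at this
    exact this
  set Z : Set (ℤ → E) := {x | InfargmaxEqZero x} with hZ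
  have hZm : MeasurableSet Z := measurableSet_infargmax
  have hZj : ∀ j, MeasurableSet (shift j ⁻¹' Z) := fun j => (measurable_shift j) hZm
  -- almost every path has exactly one anchor `j`; split the integral according to it
  have h1 : ∫⁻ x, g x ∂(tailMeasure Q α) =
      ∫⁻ x, ∑' j, (shift j ⁻¹' Z).indicator g x ∂(tailMeasure Q α) := by
    refine lintegral_congr_ae ?_
    filter_upwards [hl0', h.ae_ne_zero] with x hx hx0
    obtain ⟨j, hj⟩ := exists_isLeast_argSet hx hx0
    rw [tsum_eq_single j, Set.indicator_of_mem]
    · exact (infargmax_shift_iff j x).2 hj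
    · intro i hi
      refine Set.indicator_of_notMem (fun hi' => hi ?_) _
      exact ((infargmax_shift_iff i x).1 hi').unique hj
  have h2 : ∀ j : ℤ, ∫⁻ x, (shift j ⁻¹' Z).indicator g x ∂(tailMeasure Q α) =
      ∫⁻ x in Z, g (shift (-j) x) ∂(tailMeasure Q α) := by
    intro j
    rw [h.lintegral_shift_tail j (hg.indicator (hZj j)), ← lintegral_indicator hZm,
      ← lintegral_indicator (measurableSet_ne_zero (-j))]
    · refine lintegral_congr fun x => ?_
      have hmem : shift (-j) x ∈ shift j ⁻¹' Z ↔ x ∈ Z := by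
        rw [Set.mem_preimage, shift_shift, add_neg_cancel, shift_zero']
      by_cases hx : x (-j) = 0
      · have : g (shift (-j) x) = 0 := h0 _ (by simpa [shift_apply] using hx)
        simp [Set.indicator, hx, this]
      · by_cases hxZ : x ∈ Z <;> simp [Set.indicator, hx, hmem, hxZ]
    · intro x hx
      refine Set.indicator_of_notMem (fun hmem => ?_) _
      exact ne_zero_of_isLeast_argSet ((infargmax_shift_iff j x).1 hmem) hx
  rw [h1, lintegral_tsum fun j => (hg.indicator (hZj j)).aemeasurable,
    lintegral_tsum (f := fun j x => g (shift j x))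
      fun j => (hg.comp (measurable_shift j)).aemeasurable]
  simp_rw [h2]
  exact (Equiv.neg ℤ).tsum_eq fun j => ∫⁻ x in Z, g (shift j x) ∂(tailMeasure Q α)

end tailMeasure

/-! ### Norms on sequences and Lipschitz envelopes -/

/-- The features shared by the uniform norm and the `ℓ₁`-norm on sequences. -/
structure SeqNorm {E : Type*} [NormedAddCommGroup E] [MeasurableSpace E]
    (N : (ℤ → E) → ℝ≥0∞) : Prop where
  measurable : Measurable N
  add_le : ∀ x y, N (x + y) ≤ N x + N y
  mono : ∀ x y, (∀ j, ‖x j‖ ≤ ‖y j‖) → N x ≤ N y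
  enorm_le : ∀ x j, ‖x j‖ₑ ≤ N x
  le_tsum : ∀ x, N x ≤ ∑' j, ‖x j‖ₑ
  le_iSup_window : ∀ x, N x ≤ ⨆ m : ℕ, N (window m x)

/-- The truncated distance `min(N(x - y), 1)`. -/
noncomputable def sdist {E : Type*} [NormedAddCommGroup E] (N : (ℤ → E) → ℝ≥0∞)
    (x y : ℤ → E) : ℝ := (min (N (x - y)) 1).toReal

/-- Continuity at `x` of `H` with respect to `N` along finitely supported sequences. -/
def FinCont {E : Type*} [NormedAddCommGroup E] (N : (ℤ → E) → ℝ≥0∞)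
    (H : (ℤ → E) → ℝ) (x : ℤ → E) : Prop :=
  ∀ ε : ℝ, 0 < ε → ∃ δ : ℝ, 0 < δ ∧ ∀ y : ℤ → E, (Function.support y).Finite →
    N (y - x) ≤ ENNReal.ofReal δ → |H y - H x| ≤ ε

/-- The `k`-Lipschitz upper envelope of `H` over finitely supported sequences. -/
noncomputable def upper {E : Type*} [NormedAddCommGroup E] (N : (ℤ → E) → ℝ≥0∞)
    (H : (ℤ → E) → ℝ) (k : ℕ) (x : ℤ → E) : ℝ :=
  ⨆ y : {y : ℤ → E // (Function.support y).Finite}, (H y.1 - k * sdist N x y.1)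

/-- The parts of the block around an exceedance at time `0` which lie outside of a window of
radius `m` are `N`-negligible, on average over the position `j` of the exceedance in the block. -/
def TailSmall {E : Type*} [NormedAddCommGroup E] [MeasurableSpace E]
    (P : ℕ → Measure (ℤ → E)) (p : ℕ → ℝ) (r : ℕ → ℕ) (N : (ℤ → E) → ℝ≥0∞) : Prop :=
  ∀ s η δ : ℝ, 0 < s → 0 < η → 0 < δ → ∀ᶠ m : ℕ in atTop, ∀ᶠ n in atTop,
    ∑ j ∈ Finset.Icc (1 : ℤ) (r n), (P n).real {x | s < ‖x 0‖ ∧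
      ENNReal.ofReal η < N (trunc (1 - j) (r n - j) (x - window m x))} ≤ δ * (r n * p n)

section seqNorm

variable {E : Type*} [NormedAddCommGroup E] [MeasurableSpace E]
variable {N : (ℤ → E) → ℝ≥0∞}

lemma SeqNorm.zero (hN : SeqNorm N) : N 0 = 0 := by
  simpa using hN.le_tsum 0

lemma SeqNorm.sub_comm (hN : SeqNorm N) (x y : ℤ → E) : N (x - y) = N (y - x) :=
  le_antisymm (hN.mono _ _ fun j => by simp [norm_sub_rev])
    (hN.mono _ _ fun j => by simp [norm_sub_rev])

lemma SeqNorm.sub_le (hN : SeqNorm N) (x y z : ℤ → E) : N (x - z) ≤ N (x - y) + N (y - z) := by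
  have := hN.add_le (x - y) (y - z)
  rwa [sub_add_sub_cancel] at this

lemma sdist_nonneg (x y : ℤ → E) : 0 ≤ sdist N x y := ENNReal.toReal_nonneg

lemma sdist_le_one (x y : ℤ → E) : sdist N x y ≤ 1 :=
  ENNReal.toReal_le_of_le_ofReal zero_le_one (by simp)

lemma sdist_comm (hN : SeqNorm N) (x y : ℤ → E) : sdist N x y = sdist N y x := by
  rw [sdist, hN.sub_comm, sdist]

lemma sdist_self (hN : SeqNorm N) (x : ℤ → E) : sdist N x x = 0 := by
  simp [sdist, hN.zero]

lemma sdist_le_of_le {x y : ℤ → E} {η : ℝ} (hη : 0 ≤ η) (h : N (x - y) ≤ ENNReal.ofReal η) :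
    sdist N x y ≤ η :=
  ENNReal.toReal_le_of_le_ofReal hη ((min_le_left _ _).trans h)

lemma le_of_sdist_lt {x y : ℤ → E} {δ : ℝ} (h : sdist N x y < δ) (h1 : δ ≤ 1) :
    N (x - y) ≤ ENNReal.ofReal δ := by
  have h2 : min (N (x - y)) 1 < ENNReal.ofReal δ := by
    rw [ENNReal.lt_ofReal_iff_toReal_lt (ne_top_of_le_ne_top ENNReal.one_ne_top (min_le_right _ _))]
    exact h
  rcases min_lt_iff.1 h2 with h3 | h3
  · exact h3.le
  · exact absurd h3 (not_lt.2 (by simpa using ENNReal.ofReal_le_ofReal h1))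

lemma sdist_triangle (hN : SeqNorm N) (x y z : ℤ → E) :
    sdist N x z ≤ sdist N x y + sdist N y z := by
  have hf : ∀ a : ℝ≥0∞, min a 1 ≠ ∞ := fun a =>
    ne_top_of_le_ne_top ENNReal.one_ne_top (min_le_right _ _)
  rw [sdist, sdist, sdist, ← ENNReal.toReal_add (hf _) (hf _)]
  refine ENNReal.toReal_mono (ENNReal.add_ne_top.2 ⟨hf _, hf _⟩) ?_
  rcases le_total (N (x - y)) 1 with h1 | h1
  · rcases le_total (N (y - z)) 1 with h2 | h2
    · rw [min_eq_left h1, min_eq_left h2]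
      exact (min_le_left _ _).trans (hN.sub_le x y z)
    · rw [min_eq_right h2]
      exact (min_le_right _ _).trans le_add_self
  · rw [min_eq_right h1]
    exact (min_le_right _ _).trans le_self_add

lemma SeqNorm.trunc_le_sum (hN : SeqNorm N) (a b : ℤ) (x : ℤ → E) :
    N (trunc a b x) ≤ ENNReal.ofReal (∑ j ∈ Finset.Icc a b, ‖x j‖) := by
  refine (hN.le_tsum _).trans ?_
  rw [tsum_eq_sum (s := Finset.Icc a b), ENNReal.ofReal_sum_of_nonneg fun _ _ => norm_nonneg _]
  · refine Finset.sum_le_sum fun j hj => ?_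
    rw [ofReal_norm, trunc_apply, if_pos (Finset.mem_Icc.1 hj)]
  · intro j hj
    rw [trunc_apply, if_neg (fun h => hj (Finset.mem_Icc.2 h)), enorm_zero]

/-- A function with this Lipschitz property, for finitely many coordinates, is continuous for the
product topology. -/
lemma continuous_of_sum_bound {f : (ℤ → E) → ℝ} (K : ℝ) (s : Finset ℤ)
    (h : ∀ x x', |f x - f x'| ≤ K * ∑ j ∈ s, ‖x j - x' j‖) : Continuous f := by
  refine continuous_iff_continuousAt.2 fun x => ?_
  rw [ContinuousAt, tendsto_iff_norm_sub_tendsto_zero]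
  have hc : Continuous fun x' : ℤ → E => K * ∑ j ∈ s, ‖x' j - x j‖ := by fun_prop
  have := hc.tendsto x
  simp only [sub_self, norm_zero, Finset.sum_const_zero, mul_zero] at this
  exact squeeze_zero (fun _ => norm_nonneg _) (fun x' => h x' x) this

lemma sdist_trunc_le (hN : SeqNorm N) (a b : ℤ) (x y : ℤ → E) :
    sdist N (trunc a b x) (trunc a b y) ≤ ∑ j ∈ Finset.Icc a b, ‖x j - y j‖ := by
  refine sdist_le_of_le (Finset.sum_nonneg fun _ _ => norm_nonneg _) ?_
  rw [← trunc_sub]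
  exact hN.trunc_le_sum a b (x - y)

section upper

variable {H : (ℤ → E) → ℝ} {C : ℝ}

lemma upper_bddAbove (hC : ∀ x, |H x| ≤ C) (k : ℕ) (x : ℤ → E) :
    BddAbove (Set.range fun y : {y : ℤ → E // (Function.support y).Finite} =>
      H y.1 - k * sdist N x y.1) := by
  refine ⟨C, ?_⟩
  rintro _ ⟨y, rfl⟩
  have := (le_abs_self _).trans (hC y.1)
  have h2 : 0 ≤ k * sdist N x y.1 := mul_nonneg k.cast_nonneg (sdist_nonneg _ _)
  simp only
  linarith

lemma sub_le_upper (hC : ∀ x, |H x| ≤ C) (k : ℕ) (x : ℤ → E) {y : ℤ → E}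
    (hy : (Function.support y).Finite) : H y - k * sdist N x y ≤ upper N H k x :=
  le_ciSup (upper_bddAbove (N := N) hC k x) ⟨y, hy⟩

lemma le_upper (hN : SeqNorm N) (hC : ∀ x, |H x| ≤ C) (k : ℕ) {y : ℤ → E}
    (hy : (Function.support y).Finite) : H y ≤ upper N H k y := by
  simpa [sdist_self hN] using sub_le_upper (N := N) hC k y hy

instance : Nonempty {y : ℤ → E // (Function.support y).Finite} := ⟨0, by simp⟩

lemma upper_le (hC : ∀ x, |H x| ≤ C) (k : ℕ) (x : ℤ → E) : upper N H k x ≤ C :=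
  ciSup_le fun y => by
    have := (le_abs_self _).trans (hC y.1)
    have h2 : 0 ≤ k * sdist N x y.1 := mul_nonneg k.cast_nonneg (sdist_nonneg _ _)
    linarith

lemma abs_upper_le (hC : ∀ x, |H x| ≤ C) (k : ℕ) (x : ℤ → E) : |upper N H k x| ≤ C + k := by
  have hk : (0 : ℝ) ≤ k := k.cast_nonneg
  refine abs_le.2 ⟨?_, (upper_le hC k x).trans (by linarith)⟩
  have h0 := sub_le_upper (N := N) hC k x (y := 0) (by simp)
  have h1 := (abs_le.1 (hC 0)).1
  have h2 := mul_le_mul_of_nonneg_left (sdist_le_one (N := N) x 0) hk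
  linarith

lemma upper_le_add (hN : SeqNorm N) (hC : ∀ x, |H x| ≤ C) (k : ℕ) (x x' : ℤ → E) :
    upper N H k x ≤ upper N H k x' + k * sdist N x x' :=
  ciSup_le fun y => by
    have h1 := sub_le_upper (N := N) hC k x' y.2
    have h2 := mul_le_mul_of_nonneg_left (sdist_triangle hN x' x y.1) (k.cast_nonneg (α := ℝ))
    rw [sdist_comm hN x' x] at h2
    linarith

lemma abs_upper_sub_le (hN : SeqNorm N) (hC : ∀ x, |H x| ≤ C) (k : ℕ) (x x' : ℤ → E) :
    |upper N H k x - upper N H k x'| ≤ k * sdist N x x' := by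
  have h1 := upper_le_add hN hC k x x'
  have h2 := upper_le_add hN hC k x' x
  rw [sdist_comm hN] at h2
  exact abs_le.2 ⟨by linarith, by linarith⟩

lemma continuous_upper_trunc (hN : SeqNorm N) (hC : ∀ x, |H x| ≤ C) (k : ℕ) (a b : ℤ) :
    Continuous fun x => upper N H k (trunc a b x) :=
  continuous_of_sum_bound k (Finset.Icc a b) fun x x' =>
    (abs_upper_sub_le hN hC k _ _).trans
      (mul_le_mul_of_nonneg_left (sdist_trunc_le hN a b x x') k.cast_nonneg)

lemma tendsto_sdist_window {x : ℤ → E}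
    (hx : Tendsto (fun m : ℕ => N (x - window m x)) atTop (𝓝 0)) :
    Tendsto (fun m : ℕ => sdist N x (window m x)) atTop (𝓝 0) := by
  have h : Tendsto (fun m : ℕ => min (N (x - window m x)) 1) atTop (𝓝 (min 0 1)) :=
    hx.min tendsto_const_nhds
  rw [min_eq_left zero_le_one] at h
  exact (ENNReal.tendsto_toReal ENNReal.zero_ne_top).comp h

lemma tendsto_upper_window (hN : SeqNorm N) (hC : ∀ x, |H x| ≤ C) (k : ℕ) {x : ℤ → E}
    (hx : Tendsto (fun m : ℕ => N (x - window m x)) atTop (𝓝 0)) :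
    Tendsto (fun m : ℕ => upper N H k (window m x)) atTop (𝓝 (upper N H k x)) := by
  rw [tendsto_iff_norm_sub_tendsto_zero]
  refine squeeze_zero (fun _ => norm_nonneg _) (fun m => ?_)
    (by simpa using (tendsto_sdist_window hx).const_mul (k : ℝ))
  rw [Real.norm_eq_abs, abs_sub_comm]
  exact abs_upper_sub_le hN hC k _ _

/-- On the finitely supported sequences `H ≤ upper N H k` by definition; the inequality persists at
the continuity points of `H` which are limits of their windows. -/
lemma le_upper_of_finCont (hN : SeqNorm N) (hC : ∀ x, |H x| ≤ C) (k : ℕ) {x : ℤ → E}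
    (hx : Tendsto (fun m : ℕ => N (x - window m x)) atTop (𝓝 0)) (hH : FinCont N H x) :
    H x ≤ upper N H k x := by
  refine le_of_forall_pos_le_add fun ε hε => ?_
  obtain ⟨δ, hδ, h⟩ := hH ε hε
  have hev : ∀ᶠ m : ℕ in atTop, H x - k * sdist N x (window m x) ≤ upper N H k x + ε := by
    filter_upwards [hx.eventually_le_const (ENNReal.ofReal_pos.2 hδ)] with m hm
    have h1 := h (window m x) (trunc_support_finite _ _ _) (by rwa [hN.sub_comm])
    have h2 := sub_le_upper (N := N) hC k x (trunc_support_finite (-m) m x)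
    have := (abs_le.1 h1).1
    linarith
  have hlim : Tendsto (fun m : ℕ => H x - k * sdist N x (window m x)) atTop (𝓝 (H x)) := by
    simpa using ((tendsto_sdist_window hx).const_mul (k : ℝ)).const_sub (H x)
  exact le_of_tendsto hlim hev

/-- The upper envelopes converge at the continuity points of `H`. -/
lemma tendsto_upper (hN : SeqNorm N) (hC : ∀ x, |H x| ≤ C) {x : ℤ → E}
    (hx : Tendsto (fun m : ℕ => N (x - window m x)) atTop (𝓝 0)) (hH : FinCont N H x) :
    Tendsto (fun k => upper N H k x) atTop (𝓝 (H x)) := by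
  refine Metric.tendsto_atTop.2 fun ε hε => ?_
  obtain ⟨δ, hδ, h⟩ := hH (ε / 2) (half_pos hε)
  set d := min δ 1 with hd
  have hd0 : 0 < d := lt_min hδ one_pos
  obtain ⟨K, hK⟩ := exists_nat_gt (2 * C / d)
  refine ⟨K, fun k hk => ?_⟩
  have hkd : 2 * C ≤ k * d := by
    have h1 : 2 * C / d < k := hK.trans_le (by exact_mod_cast hk)
    exact ((div_lt_iff₀ hd0).1 h1).le
  have h1 := le_upper_of_finCont hN hC k hx hH
  have h2 : upper N H k x ≤ H x + ε / 2 := by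
    refine ciSup_le fun y => ?_
    have hCy := (abs_le.1 (hC y.1)).2
    have hCx := (abs_le.1 (hC x)).1
    have hk0 : (0 : ℝ) ≤ k := k.cast_nonneg
    rcases lt_or_ge (sdist N x y.1) d with hlt | hge
    · have h3 := le_of_sdist_lt hlt (min_le_right _ _)
      have h4 := h y.1 y.2 (by
        rw [hN.sub_comm]; exact h3.trans (ENNReal.ofReal_le_ofReal (min_le_left _ _)))
      have := (abs_le.1 h4).2
      have h5 : 0 ≤ k * sdist N x y.1 := mul_nonneg hk0 (sdist_nonneg _ _)
      linarith
    · have h5 := mul_le_mul_of_nonneg_left hge hk0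
      linarith
  rw [Real.dist_eq, abs_lt]
  constructor <;> linarith

/-- The oscillation of `H` between two finitely supported sequences is controlled by envelopes. -/
lemma abs_sub_le_upper (hC : ∀ x, |H x| ≤ C) (k : ℕ) {x y : ℤ → E}
    (hN : SeqNorm N) (hx : (Function.support x).Finite) (hy : (Function.support y).Finite) :
    |H x - H y| ≤ upper N H k y + upper N (fun z => -H z) k y + k * sdist N x y := by
  have hC' : ∀ x, |(fun z => -H z) x| ≤ C := fun x => by simpa using hC x
  have a1 := sub_le_upper (N := N) hC k y hx
  have a2 := sub_le_upper (N := N) hC' k y hx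
  have a3 := le_upper hN hC k hy
  have a4 := le_upper hN hC' k hy
  rw [sdist_comm hN y x] at a1 a2
  exact abs_le.2 ⟨by linarith, by linarith⟩

end upper

end seqNorm

/-! ### Local limits around an exceedance -/

section limits

variable {E : Type*} [NormedAddCommGroup E] [NormedSpace ℝ E] [MeasurableSpace E] [BorelSpace E]
  [SecondCountableTopology E]
variable {P : ℕ → Measure (ℤ → E)} {Q : Measure (ℤ → E)} {α : ℝ} {p : ℕ → ℝ} {r : ℕ → ℕ}
variable {N : (ℤ → E) → ℝ≥0∞}

lemma measurable_sub_path {f g : (ℤ → E) → ℤ → E} (hf : Measurable f) (hg : Measurable g) :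
    Measurable fun x => f x - g x :=
  measurable_pi_lambda _ fun j =>
    ((measurable_pi_apply j).comp hf).sub ((measurable_pi_apply j).comp hg)

lemma norm_sub_window_le {m m' : ℕ} (h : m ≤ m') (x : ℤ → E) (j : ℤ) :
    ‖(x - window m' x) j‖ ≤ ‖(x - window m x) j‖ := by
  simp only [Pi.sub_apply, window, trunc]
  split_ifs with h1 h2
  · simp
  · simp
  · exfalso; omega
  · exact le_rfl

/-- The smallness of the blocks outside of a window passes to the tail process. Every window of
radius `M` is contained in the block for all but `2M` of the `r n` positions of the exceedance, so
that a bound on the sum over the positions bounds the probability for the window. -/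
lemma BlockLimit.measure_tail_le (h : BlockLimit P Q α p r) (hN : SeqNorm N)
    (hT : TailSmall P p r N) {s η γ : ℝ} (hs : 0 < s) (hη : 0 < η) (hγ : 0 < γ) :
    ∀ᶠ m : ℕ in atTop, Q {y | ENNReal.ofReal (2 * η) < N (s • y - window m (s • y))} ≤
      ENNReal.ofReal γ := by
  have := h.probQ
  have hsα : 0 < s ^ (-α) := Real.rpow_pos_of_pos hs _
  set δ := γ * s ^ (-α) / 2 with hδ
  have hδ0 : 0 < δ := by positivity
  filter_upwards [hT s η δ hs hη hδ0] with m hm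
  have hmeas : ∀ M : ℕ, Measurable fun x : ℤ → E => N (window M (x - window m x)) := fun M =>
    hN.measurable.comp ((measurable_trunc _ _).comp
      (measurable_sub_path measurable_id (measurable_trunc _ _)))
  have hfin : ∀ (M : ℕ) (x : ℤ → E), N (window M x) ≠ ∞ := fun M x =>
    ne_top_of_le_ne_top ENNReal.ofReal_ne_top (hN.trunc_le_sum _ _ _)
  -- the bound for a finite window, uniformly in its size `M`
  have hM : ∀ M : ℕ, Q {y | ENNReal.ofReal (2 * η) < N (window M (s • y - window m (s • y)))} ≤
      ENNReal.ofReal γ := by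
    intro M
    set nn : (ℤ → E) → ℝ := fun x => (N (window M (x - window m x))).toReal with hnn
    have hnn_cont : Continuous nn := by
      refine continuous_of_sum_bound 1 (Finset.Icc (-M) M) fun x x' => ?_
      have key : ∀ x x' : ℤ → E, nn x ≤ nn x' + ∑ j ∈ Finset.Icc (-(M : ℤ)) M, ‖x j - x' j‖ := by
        intro x x'
        have h1 := hN.add_le (window M (x' - window m x'))
          (window M (x - window m x) - window M (x' - window m x'))
        rw [add_sub_cancel] at h1
        have h2 : N (window M (x - window m x) - window M (x' - window m x')) ≤
            N (window M (x - x')) := by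
          refine hN.mono _ _ fun j => ?_
          simp only [Pi.sub_apply, window, trunc]
          split_ifs <;> simp
        have h3 := hN.trunc_le_sum (-M) M (x - x')
        have h4 := h1.trans (add_le_add_right (h2.trans h3) _)
        have h5 := ENNReal.toReal_mono (ENNReal.add_ne_top.2 ⟨hfin _ _, ENNReal.ofReal_ne_top⟩) h4
        rwa [ENNReal.toReal_add (hfin _ _) ENNReal.ofReal_ne_top, ENNReal.toReal_ofReal
          (Finset.sum_nonneg fun _ _ => norm_nonneg _)] at h5
      have k1 := key x x'
      have k2 := key x' x
      simp_rw [norm_sub_rev (x' _) (x _)] at k2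
      rw [one_mul]
      exact abs_le.2 ⟨by linarith, by linarith⟩
    -- a continuous function between the indicators of `{nn > 2η}` and of `{nn > η}`
    let f : (ℤ → E) → ℝ := fun x => min 1 (max 0 ((nn x - η) / η))
    have hf : Continuous f := by simp only [f]; fun_prop
    have hf0 : ∀ x, 0 ≤ f x := fun x => by simp only [f]; positivity
    have hf1 : ∀ x, f x ≤ 1 := fun x => min_le_left _ _
    have hfb : ∀ x, |f x| ≤ 1 := fun x => by rw [abs_of_nonneg (hf0 x)]; exact hf1 x
    have hfw : ∀ x, f (window M x) = f x := by
      intro x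
      simp only [f, nn]
      have : window M (window M x - window m (window M x)) = window M (x - window m x) := by
        funext j
        simp only [Pi.sub_apply, window, trunc]
        split_ifs <;> simp
      rw [this]
    have hfsupp : ∀ x, f x ≠ 0 → ENNReal.ofReal η < N (window M (x - window m x)) := by
      intro x hx
      by_contra! hle
      have : nn x ≤ η := ENNReal.toReal_le_of_le_ofReal hη.le hle
      exact hx (by
        have : (nn x - η) / η ≤ 0 := div_nonpos_of_nonpos_of_nonneg (by linarith) hη.le
        simp [f, max_eq_left this])
    have hfone : ∀ x, ENNReal.ofReal (2 * η) < N (window M (x - window m x)) → f x = 1 := by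
      intro x hx
      have : 2 * η < nn x := (ENNReal.ofReal_lt_iff_lt_toReal (by positivity) (hfin _ _)).1 hx
      have : 1 ≤ (nn x - η) / η := by rw [le_div_iff₀ hη]; linarith
      exact min_eq_left (this.trans (le_max_right _ _))
    have T := h.tendsto_window s hs M f hf ⟨1, hfb⟩ hfw
    have hle : s ^ (-α) * ∫ y, f (s • y) ∂Q ≤ 2 * δ := by
      refine le_of_tendsto T ?_
      filter_upwards [hm, h.p_pos, h.r_top.eventually_ge_atTop (4 * M + 1)] with n hn hp hr
      have := h.prob n
      rw [div_le_iff₀ hp]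
      set S : Set (ℤ → E) := {x | s < ‖x 0‖ ∧
        ENNReal.ofReal η < N (window M (x - window m x))} with hS
      have hSm : MeasurableSet S := (measurableSet_exceed s 0).inter
        (measurableSet_lt measurable_const (hmeas M))
      have i1 : ∫ x in {x | s < ‖x 0‖}, f x ∂(P n) ≤ (P n).real S := by
        rw [← integral_indicator (measurableSet_exceed s 0), ← integral_indicator_one hSm]
        refine integral_mono_of_nonneg
          (Eventually.of_forall fun x => Set.indicator_nonneg (fun x _ => hf0 x) x)
          ((integrable_const (1 : ℝ)).indicator hSm) (Eventually.of_forall fun x => ?_)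
        by_cases hx : s < ‖x 0‖
        · rw [Set.indicator_of_mem (by exact hx)]
          by_cases hx' : f x = 0
          · rw [hx']; exact Set.indicator_nonneg (fun _ _ => zero_le_one) x
          · rw [Set.indicator_of_mem (show x ∈ S from ⟨hx, hfsupp x hx'⟩)]
            exact hf1 x
        · rw [Set.indicator_of_notMem (by exact hx)]
          exact Set.indicator_nonneg (fun _ _ => zero_le_one) x
      have i2 : ∑ _j ∈ Finset.Icc (1 + M : ℤ) (r n - M), (P n).real S ≤
          ∑ j ∈ Finset.Icc (1 : ℤ) (r n), (P n).real {x | s < ‖x 0‖ ∧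
            ENNReal.ofReal η < N (trunc (1 - j) (r n - j) (x - window m x))} := by
        refine (Finset.sum_le_sum fun j hj => ?_).trans
          (Finset.sum_le_sum_of_subset_of_nonneg (Finset.Icc_subset_Icc (by omega) (by omega))
            fun _ _ _ => measureReal_nonneg)
        rw [Finset.mem_Icc] at hj
        refine measureReal_mono fun x hx => ⟨hx.1, hx.2.trans_le (hN.mono _ _ fun i => ?_)⟩
        simp only [Pi.sub_apply, window, trunc]
        by_cases hi : -(M : ℤ) ≤ i ∧ i ≤ M
        · have h2 : 1 - j ≤ i ∧ i ≤ r n - j := ⟨by omega, by omega⟩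
          rw [if_pos hi, if_pos h2]
        · rw [if_neg hi, norm_zero]; exact norm_nonneg _
      rw [Finset.sum_const, nsmul_eq_mul, Int.card_Icc] at i2
      have hcard : ((((r n : ℤ) - M + 1 - (1 + M)).toNat : ℕ) : ℝ) = r n - 2 * M := by
        have : (((r n : ℤ) - M + 1 - (1 + M)).toNat : ℤ) = r n - 2 * M := by omega
        exact_mod_cast this
      rw [hcard] at i2
      have hrr : (4 * M + 1 : ℝ) ≤ r n := by exact_mod_cast hr
      have hr0 : (0 : ℝ) < r n := by
        have : (0 : ℝ) ≤ M := M.cast_nonneg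
        linarith
      have i3 := i2.trans hn
      have hPS : (0 : ℝ) ≤ (P n).real S := measureReal_nonneg
      -- at least half of the positions are at distance more than `M` from the ends of the block
      have i4 : r n / 2 * (P n).real S ≤ r n / 2 * (2 * δ * p n) := by
        refine (mul_le_mul_of_nonneg_right ?_ hPS).trans (i3.trans (le_of_eq (by ring)))
        linarith
      exact i1.trans (le_of_mul_le_mul_left i4 (by positivity))
    have hlast : Q.real {y | ENNReal.ofReal (2 * η) < N (window M (s • y - window m (s • y)))} ≤
        ∫ y, f (s • y) ∂Q := by
      have hms : MeasurableSet {y : ℤ → E |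
          ENNReal.ofReal (2 * η) < N (window M (s • y - window m (s • y)))} :=
        measurableSet_lt measurable_const ((hmeas M).comp (measurable_smul_path s))
      rw [← integral_indicator_one hms]
      refine integral_mono_of_nonneg
        (Eventually.of_forall fun x => Set.indicator_nonneg (fun _ _ => zero_le_one) x)
        (Integrable.of_bound (hf.measurable.comp
          (measurable_smul_path s)).aestronglyMeasurable 1
          (Eventually.of_forall fun x => hfb _)) (Eventually.of_forall fun y => ?_)
      by_cases hy : ENNReal.ofReal (2 * η) < N (window M (s • y - window m (s • y)))
      · rw [Set.indicator_of_mem (by exact hy)]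
        exact (hfone _ hy).ge
      · rw [Set.indicator_of_notMem (by exact hy)]; exact hf0 _
    rw [← ENNReal.ofReal_toReal (measure_ne_top Q _)]
    refine ENNReal.ofReal_le_ofReal (hlast.trans ?_)
    have : s ^ (-α) * ∫ y, f (s • y) ∂Q ≤ s ^ (-α) * γ := hle.trans (le_of_eq (by rw [hδ]; ring))
    exact le_of_mul_le_mul_left this hsα
  have hmono : Monotone fun M : ℕ =>
      {y : ℤ → E | ENNReal.ofReal (2 * η) < N (window M (s • y - window m (s • y)))} := by
    intro M M' hMM y hy
    refine lt_of_lt_of_le (show _ < _ from hy) (hN.mono _ _ fun j => ?_)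
    simp only [window, trunc]
    split_ifs with h1 h2
    · exact le_rfl
    · exfalso; omega
    · simp
    · exact le_rfl
  refine (measure_mono fun y hy => ?_).trans
    (le_of_tendsto' (tendsto_measure_iUnion_atTop hmono) hM)
  rw [Set.mem_iUnion]
  exact lt_iSup_iff.1 ((show _ < _ from hy).trans_le (hN.le_iSup_window _))

/-- The tail process is almost surely an `N`-limit of its finite windows. -/
lemma BlockLimit.ae_tendsto_window (h : BlockLimit P Q α p r) (hN : SeqNorm N)
    (hT : TailSmall P p r N) {s : ℝ} (hs : 0 < s) :
    ∀ᵐ y ∂Q, Tendsto (fun m : ℕ => N (s • y - window m (s • y))) atTop (𝓝 0) := by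
  have := h.probQ
  have hz : ∀ k : ℕ, ∀ᵐ y ∂Q, ∃ m : ℕ, N (s • y - window m (s • y)) ≤
      ENNReal.ofReal (2 * (1 / ((k : ℝ) + 1))) := by
    intro k
    rw [ae_iff]
    refine le_antisymm (ENNReal.le_of_forall_pos_le_add fun γ hγ _ => ?_) bot_le
    obtain ⟨m, hm⟩ := (h.measure_tail_le hN hT hs
      (show (0 : ℝ) < 1 / ((k : ℝ) + 1) by positivity) (NNReal.coe_pos.2 hγ)).exists
    rw [zero_add]
    refine (measure_mono fun y hy => ?_).trans (hm.trans (by simp))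
    simp only [Set.mem_ofPred_eq, not_exists, not_le] at hy ⊢
    exact hy m
  filter_upwards [ae_all_iff.2 hz] with y hy
  rw [ENNReal.tendsto_atTop_zero]
  intro ε hε
  obtain ⟨k, hk⟩ : ∃ k : ℕ, ENNReal.ofReal (2 * (1 / ((k : ℝ) + 1))) ≤ ε := by
    by_cases ht : ε = ∞
    · exact ⟨0, by rw [ht]; exact le_top⟩
    · have h0 : 0 < ε.toReal := ENNReal.toReal_pos hε.ne' ht
      obtain ⟨k, hk⟩ := exists_nat_one_div_lt (half_pos h0)
      refine ⟨k, ENNReal.ofReal_le_of_le_toReal (by linarith)⟩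
  obtain ⟨m, hm⟩ := hy k
  exact ⟨m, fun m' hmm => (hN.mono _ _ fun j => norm_sub_window_le hmm _ j).trans (hm.trans hk)⟩

variable {H : (ℤ → E) → ℝ} {C : ℝ}

lemma BlockLimit.integrable_of_bound (h : BlockLimit P Q α p r) {n : ℕ} {f : (ℤ → E) → ℝ}
    (hf : Measurable f) {C : ℝ} (hC : ∀ x, |f x| ≤ C) : Integrable f (P n) := by
  have := h.prob n
  exact Integrable.of_bound hf.aestronglyMeasurable C (Eventually.of_forall hC)

/-- The envelopes of the windows around an exceedance are asymptotically no larger than the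
functional of the tail process: let first `n → ∞` (weak convergence), then `m → ∞` (windows exhaust
the tail process), then `k → ∞` (envelopes decrease to `H` at continuity points). -/
lemma BlockLimit.eventually_integral_upper_le (h : BlockLimit P Q α p r) (hN : SeqNorm N)
    (hT : TailSmall P p r N) {s : ℝ} (hs : 0 < s) (hC : ∀ x, |H x| ≤ C)
    (hH : ∀ᵐ y ∂Q, FinCont N H (s • y)) {δ : ℝ} (hδ : 0 < δ) :
    ∀ᶠ k : ℕ in atTop, ∀ᶠ m : ℕ in atTop, ∀ᶠ n in atTop,
      ∫ x in {x | s < ‖x 0‖}, upper N H k (window m x) ∂(P n) ≤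
        (s ^ (-α) * ∫ y, H (s • y) ∂Q + δ) * p n := by
  have := h.probQ
  have hY := h.ae_tendsto_window hN hT hs
  have hcw : ∀ k m : ℕ, Continuous fun x : ℤ → E => upper N H k (window m x) := fun k m =>
    continuous_upper_trunc hN hC k _ _
  have hT1 : ∀ k : ℕ, Tendsto (fun m : ℕ => ∫ y, upper N H k (window m (s • y)) ∂Q) atTop
      (𝓝 (∫ y, upper N H k (s • y) ∂Q)) := fun k =>
    tendsto_integral_of_dominated_convergence (fun _ => C + k)
      (fun m => ((hcw k m).measurable.comp (measurable_smul_path s)).aestronglyMeasurable)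
      (integrable_const _) (fun m => Eventually.of_forall fun y => abs_upper_le hC k _)
      (hY.mono fun y hy => tendsto_upper_window hN hC k hy)
  have hmeas : ∀ k : ℕ, AEStronglyMeasurable (fun y => upper N H k (s • y)) Q := fun k =>
    aestronglyMeasurable_of_tendsto_ae atTop
      (fun m => ((hcw k m).measurable.comp (measurable_smul_path s)).aestronglyMeasurable)
      (hY.mono fun y hy => tendsto_upper_window hN hC k hy)
  have hT2 : Tendsto (fun k : ℕ => ∫ y, upper N H k (s • y) ∂Q) atTop
      (𝓝 (∫ y, H (s • y) ∂Q)) := by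
    refine tendsto_integral_of_dominated_convergence (fun _ => C) hmeas
      (integrable_const _) (fun k => ?_) ?_
    · filter_upwards [hY, hH] with y hy hHy
      refine abs_le.2 ⟨?_, upper_le hC k _⟩
      exact (abs_le.1 (hC _)).1.trans (le_upper_of_finCont hN hC k hy hHy)
    · filter_upwards [hY, hH] with y hy hHy using tendsto_upper hN hC hy hHy
  have e1 : ∀ᶠ k : ℕ in atTop, s ^ (-α) * ∫ y, upper N H k (s • y) ∂Q <
      s ^ (-α) * ∫ y, H (s • y) ∂Q + δ :=
    (hT2.const_mul _).eventually_lt_const (by linarith)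
  filter_upwards [e1] with k hk
  have e2 := ((hT1 k).const_mul (s ^ (-α))).eventually_lt_const hk
  filter_upwards [e2] with m hm
  have T := h.tendsto_window s hs m (fun x => upper N H k (window m x)) (hcw k m)
    ⟨C + k, fun x => abs_upper_le hC k _⟩ (fun x => by rw [window_window_of_le le_rfl])
  filter_upwards [T.eventually_lt_const hm, h.p_pos] with n hn hp
  exact ((div_lt_iff₀ hp).1 hn).le

/-- One-sided local limit: the window around an exceedance converges to the tail process. -/
lemma BlockLimit.eventually_window_le (h : BlockLimit P Q α p r) (hN : SeqNorm N)
    (hT : TailSmall P p r N) {s : ℝ} (hs : 0 < s) (hm : Measurable H) (hC : ∀ x, |H x| ≤ C)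
    (hH : ∀ᵐ y ∂Q, FinCont N H (s • y)) {δ : ℝ} (hδ : 0 < δ) :
    ∀ᶠ m : ℕ in atTop, ∀ᶠ n in atTop,
      ∫ x in {x | s < ‖x 0‖}, H (window m x) ∂(P n) ≤
        (s ^ (-α) * ∫ y, H (s • y) ∂Q + δ) * p n := by
  obtain ⟨k, hk⟩ := (h.eventually_integral_upper_le hN hT hs hC hH hδ).exists
  filter_upwards [hk] with m hm'
  filter_upwards [hm'] with n hn
  refine le_trans (setIntegral_mono ?_ ?_ fun x => ?_) hn
  · exact (h.integrable_of_bound (hm.comp (measurable_trunc _ _)) fun x => hC _).integrableOn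
  · exact (h.integrable_of_bound (continuous_upper_trunc hN hC k _ _).measurable
      fun x => abs_upper_le hC k _).integrableOn
  · exact le_upper hN hC k (trunc_support_finite _ _ _)

lemma FinCont.neg {x : ℤ → E} (h : FinCont N H x) : FinCont N (fun z => -H z) x := by
  intro ε hε
  obtain ⟨δ, hδ, hy⟩ := h ε hε
  refine ⟨δ, hδ, fun y h1 h2 => ?_⟩
  have := hy y h1 h2
  rwa [show -H y - -H x = -(H y - H x) by ring, abs_neg]

/-- Local limit: the window around an exceedance converges to the tail process. -/
lemma BlockLimit.eventually_window (h : BlockLimit P Q α p r) (hN : SeqNorm N)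
    (hT : TailSmall P p r N) {s : ℝ} (hs : 0 < s) (hm : Measurable H) (hC : ∀ x, |H x| ≤ C)
    (hH : ∀ᵐ y ∂Q, FinCont N H (s • y)) {δ : ℝ} (hδ : 0 < δ) :
    ∀ᶠ m : ℕ in atTop, ∀ᶠ n in atTop,
      |∫ x in {x | s < ‖x 0‖}, H (window m x) ∂(P n) -
        (s ^ (-α) * ∫ y, H (s • y) ∂Q) * p n| ≤ δ * p n := by
  have hC' : ∀ x, |(fun z => -H z) x| ≤ C := fun x => by simpa using hC x
  filter_upwards [h.eventually_window_le hN hT hs hm hC hH hδ,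
    h.eventually_window_le (H := fun z => -H z) hN hT hs hm.neg hC'
      (hH.mono fun y hy => hy.neg) hδ] with m h1 h2
  filter_upwards [h1, h2] with n h1 h2
  rw [integral_neg, integral_neg] at h2
  rw [abs_le]
  constructor <;> nlinarith

/-- Localisation: the block around an exceedance may be replaced by a window of large radius. The
oscillation of `H` between the two is bounded by the envelopes of `H` and `-H`, whose sum is small
on average, and by the distance of the block to the window. -/
lemma BlockLimit.eventually_localize (h : BlockLimit P Q α p r) (hN : SeqNorm N)
    (hT : TailSmall P p r N) {s : ℝ} (hs : 0 < s) (hm : Measurable H) (hC : ∀ x, |H x| ≤ C)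
    (hH : ∀ᵐ y ∂Q, FinCont N H (s • y)) {δ : ℝ} (hδ : 0 < δ) :
    ∀ᶠ m : ℕ in atTop, ∀ᶠ n in atTop,
      ∑ j ∈ Finset.Icc (1 + m : ℤ) (r n - m), ∫ x in {x | s < ‖x 0‖},
        |H (trunc (1 - j) (r n - j) x) - H (window m x)| ∂(P n) ≤ δ * (r n * p n) := by
  have hC' : ∀ x, |(fun z => -H z) x| ≤ C := fun x => by simpa using hC x
  have hδ4 : 0 < δ / 4 := by positivity
  obtain ⟨k, hk1, hk2⟩ := ((h.eventually_integral_upper_le hN hT hs hC hH hδ4).and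
    (h.eventually_integral_upper_le hN hT hs hC' (hH.mono fun y hy => hy.neg) hδ4)).exists
  have hsα : 0 < s ^ (-α) + 1 := by positivity
  have hk0 : (0 : ℝ) ≤ k := k.cast_nonneg
  -- each of the two envelopes, the distances below `η` and the events `B j` contribute `δ / 4`
  set η := δ / (4 * (k + 1) * (s ^ (-α) + 1)) with hη
  have hη0 : 0 < η := by positivity
  have hδk : 0 < δ / (4 * (k + 1)) := by positivity
  filter_upwards [hk1, hk2, hT s η _ hs hη0 hδk] with m h1 h2 h3
  filter_upwards [h1, h2, h3, h.tail_le hs, h.p_pos] with n h1 h2 h3 h4 hp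
  have hprob := h.prob n
  have hA := measurableSet_exceed (E := E) s 0
  set A : Set (ℤ → E) := {x | s < ‖x 0‖} with hAdef
  set U : (ℤ → E) → ℝ := fun x => upper N H k (window m x) with hU
  set V : (ℤ → E) → ℝ := fun x => upper N (fun z => -H z) k (window m x) with hV
  have hUi : IntegrableOn U A (P n) :=
    (h.integrable_of_bound (continuous_upper_trunc hN hC k _ _).measurable
      fun x => abs_upper_le hC k _).integrableOn
  have hVi : IntegrableOn V A (P n) :=
    (h.integrable_of_bound (continuous_upper_trunc hN hC' k _ _).measurable
      fun x => abs_upper_le hC' k _).integrableOn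
  set B : ℤ → Set (ℤ → E) := fun j => {x | s < ‖x 0‖ ∧
      ENNReal.ofReal η < N (trunc (1 - j) (r n - j) (x - window m x))} with hB
  have hBm : ∀ j, MeasurableSet (B j) := fun j => (measurableSet_exceed s 0).inter
    (measurableSet_lt measurable_const (hN.measurable.comp ((measurable_trunc _ _).comp
      (measurable_sub_path measurable_id (measurable_trunc _ _)))))
  have hterm : ∀ j ∈ Finset.Icc (1 + m : ℤ) (r n - m), ∫ x in A,
      |H (trunc (1 - j) (r n - j) x) - H (window m x)| ∂(P n) ≤
      (∫ x in A, U x ∂(P n) + ∫ x in A, V x ∂(P n) + k * η * (P n).real A)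
        + k * (P n).real (B j) := by
    intro j hj
    rw [Finset.mem_Icc] at hj
    -- off `B j` the truncated distance is at most `η`, on `B j` at most `1`
    have hpt : ∀ x ∈ A, |H (trunc (1 - j) (r n - j) x) - H (window m x)| ≤
        U x + V x + k * η + k * (B j).indicator 1 x := by
      intro x hx
      refine (abs_sub_le_upper hC k hN (trunc_support_finite _ _ _)
        (trunc_support_finite _ _ _)).trans ?_
      rw [add_assoc (U x + V x), ← mul_add]
      refine (add_le_add_iff_left (U x + V x)).2 ?_
      refine mul_le_mul_of_nonneg_left ?_ hk0
      have heq : trunc (1 - j) (r n - j) x - window m x =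
          trunc (1 - j) (r n - j) (x - window m x) := by
        rw [trunc_sub, window, trunc_trunc, max_eq_right (by omega), min_eq_right (by omega)]
      by_cases hxB : x ∈ B j
      · rw [Set.indicator_of_mem hxB]
        have := sdist_le_one (N := N) (trunc (1 - j) (r n - j) x) (window m x)
        simp only [Pi.one_apply]
        linarith
      · rw [Set.indicator_of_notMem hxB, add_zero]
        refine sdist_le_of_le hη0.le ?_
        rw [heq]
        by_contra! hlt
        exact hxB ⟨hx, hlt⟩
    have hind : IntegrableOn (fun x => (B j).indicator (1 : (ℤ → E) → ℝ) x) A (P n) :=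
      (((integrable_const (1 : ℝ)).indicator (hBm j)) : Integrable _ (P n)).integrableOn
    have hci : IntegrableOn (fun _ : ℤ → E => (k : ℝ) * η) A (P n) :=
      (integrable_const _).integrableOn
    refine (setIntegral_mono_on ?_ (((hUi.add hVi).add hci).add (hind.const_mul _)) hA
      hpt).trans (le_of_eq ?_)
    · exact (h.integrable_of_bound (f := fun x =>
        |H (trunc (1 - j) (r n - j) x) - H (window m x)|)
        ((hm.comp (measurable_trunc _ _)).sub (hm.comp (measurable_trunc _ _))).abs
        (C := C + C) fun x => by
          rw [abs_abs]
          exact (norm_sub_le (H _) (H _)).trans (add_le_add (hC _) (hC _))).integrableOn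
    · have e1 : ∫ x in A, (B j).indicator (1 : (ℤ → E) → ℝ) x ∂(P n) = (P n).real (B j) := by
        rw [integral_indicator_one (hBm j), measureReal_restrict_apply (hBm j)]
        congr 1
        exact Set.inter_eq_left.2 fun x hx => hx.1
      have e2 := integral_add ((hUi.add hVi).add hci) (hind.const_mul (k : ℝ))
      have e3 := integral_add (hUi.add hVi) hci
      have e4 := integral_add hUi hVi
      simp only [Pi.add_apply] at e2 e3 e4
      change ∫ x in A, (U x + V x + k * η + k * (B j).indicator 1 x) ∂(P n) = _
      rw [e2, e3, e4, setIntegral_const, integral_const_mul, e1, smul_eq_mul]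
      ring
  refine (Finset.sum_le_sum hterm).trans ?_
  rw [Finset.sum_add_distrib, Finset.sum_const, nsmul_eq_mul, ← Finset.mul_sum]
  have hcard : ((Finset.Icc (1 + m : ℤ) (r n - m)).card : ℝ) ≤ r n := by
    rw [Int.card_Icc]
    have : ((r n : ℤ) - m + 1 - (1 + m)).toNat ≤ r n := by omega
    exact_mod_cast this
  have hAp : (P n).real A ≤ (s ^ (-α) + 1) * p n := h4
  have hbr : ∫ x in A, U x ∂(P n) + ∫ x in A, V x ∂(P n) + k * η * (P n).real A ≤
      3 * (δ / 4) * p n := by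
    have hneg : ∫ y, (fun z => -H z) (s • y) ∂Q = -∫ y, H (s • y) ∂Q := integral_neg _
    rw [hneg] at h2
    have h5 : k * η * (P n).real A ≤ δ / 4 * p n := by
      calc k * η * (P n).real A ≤ k * η * ((s ^ (-α) + 1) * p n) :=
            mul_le_mul_of_nonneg_left hAp (by positivity)
        _ = (k / (k + 1)) * (δ / 4 * p n) := by rw [hη]; field_simp
        _ ≤ 1 * (δ / 4 * p n) := by
            refine mul_le_mul_of_nonneg_right ?_ (by positivity)
            rw [div_le_one (by positivity)]; linarith
        _ = _ := one_mul _
    have h1' : ∫ x in A, U x ∂(P n) ≤ (s ^ (-α) * ∫ y, H (s • y) ∂Q + δ / 4) * p n := h1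
    have h2' : ∫ x in A, V x ∂(P n) ≤ (s ^ (-α) * (-∫ y, H (s • y) ∂Q) + δ / 4) * p n := h2
    linarith
  have hsum : ∑ j ∈ Finset.Icc (1 + m : ℤ) (r n - m), (P n).real (B j) ≤
      δ / (4 * (k + 1)) * (r n * p n) :=
    (Finset.sum_le_sum_of_subset_of_nonneg (Finset.Icc_subset_Icc (by omega) (by omega))
      fun _ _ _ => measureReal_nonneg).trans h3
  have hlast : k * ∑ j ∈ Finset.Icc (1 + m : ℤ) (r n - m), (P n).real (B j) ≤
      δ / 4 * (r n * p n) := by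
    calc _ ≤ k * (δ / (4 * (k + 1)) * (r n * p n)) := mul_le_mul_of_nonneg_left hsum hk0
      _ = (k / (k + 1)) * (δ / 4 * (r n * p n)) := by field_simp
      _ ≤ 1 * (δ / 4 * (r n * p n)) := by
          refine mul_le_mul_of_nonneg_right ?_ (by positivity)
          rw [div_le_one (by positivity)]; linarith
      _ = _ := one_mul _
  have hmain := mul_le_mul_of_nonneg_left hbr
    (Nat.cast_nonneg (α := ℝ) (Finset.Icc (1 + m : ℤ) (r n - m)).card)
  have hmain2 := mul_le_mul_of_nonneg_right hcard (show 0 ≤ 3 * (δ / 4) * p n by positivity)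
  linarith

end limits

/-! ### The uniform and the summable norm -/

/-- The uniform norm of a sequence. -/
noncomputable def supNorm {E : Type*} [NormedAddCommGroup E] (x : ℤ → E) : ℝ≥0∞ := ⨆ j, ‖x j‖ₑ

/-- The `ℓ₁`-norm of a sequence. -/
noncomputable def sumNorm {E : Type*} [NormedAddCommGroup E] (x : ℤ → E) : ℝ≥0∞ := ∑' j, ‖x j‖ₑ

/-- Asymptotic negligibility of small jumps, on path space. -/
def SmallJumps {E : Type*} [NormedAddCommGroup E] [MeasurableSpace E]
    (P : ℕ → Measure (ℤ → E)) (p : ℕ → ℝ) (r : ℕ → ℕ) : Prop :=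
  ∀ η δ : ℝ, 0 < η → 0 < δ → ∀ᶠ ε in 𝓝[>] (0 : ℝ), ∀ᶠ n in atTop,
    (P n).real {x | η < ∑ j ∈ Finset.Icc (1 : ℤ) (r n), if ‖x j‖ ≤ ε then ‖x j‖ else 0} ≤
      δ * (r n * p n)

section norms

variable {E : Type*} [NormedAddCommGroup E] [MeasurableSpace E] [BorelSpace E]

lemma enorm_le_enorm {F : Type*} [NormedAddCommGroup F] {a b : F} (h : ‖a‖ ≤ ‖b‖) :
    ‖a‖ₑ ≤ ‖b‖ₑ := by
  rw [← ofReal_norm, ← ofReal_norm]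
  exact ENNReal.ofReal_le_ofReal h

lemma window_apply_natAbs (x : ℤ → E) (j : ℤ) {m : ℕ} (h : j.natAbs ≤ m) : window m x j = x j :=
  if_pos ⟨by omega, by omega⟩

lemma seqNorm_supNorm : SeqNorm (supNorm (E := E)) where
  measurable := Measurable.iSup fun j => (measurable_pi_apply j).enorm
  add_le x y := iSup_le fun j => (enorm_add_le _ _).trans
    (add_le_add (le_iSup (fun j => ‖x j‖ₑ) j) (le_iSup (fun j => ‖y j‖ₑ) j))
  mono x y h := iSup_mono fun j => enorm_le_enorm (h j)
  enorm_le x j := le_iSup (fun j => ‖x j‖ₑ) j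
  le_tsum x := iSup_le fun j => ENNReal.le_tsum j
  le_iSup_window x := iSup_le fun j => le_iSup_of_le j.natAbs (by
    rw [← window_apply_natAbs x j le_rfl]
    exact le_iSup (fun i => ‖window j.natAbs x i‖ₑ) j)

lemma seqNorm_sumNorm : SeqNorm (sumNorm (E := E)) where
  measurable := Measurable.tsum fun j => (measurable_pi_apply j).enorm
  add_le x y := by
    unfold sumNorm
    rw [← ENNReal.tsum_add]
    exact ENNReal.tsum_le_tsum fun j => enorm_add_le _ _
  mono x y h := ENNReal.tsum_le_tsum fun j => enorm_le_enorm (h j)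
  enorm_le x j := ENNReal.le_tsum j
  le_tsum x := le_rfl
  le_iSup_window x := by
    unfold sumNorm
    rw [ENNReal.tsum_eq_iSup_sum]
    refine iSup_le fun t => le_iSup_of_le (t.sup Int.natAbs) ?_
    refine le_trans (Finset.sum_le_sum fun j hj => ?_) (ENNReal.sum_le_tsum t)
    rw [window_apply_natAbs x j (Finset.le_sup (f := Int.natAbs) hj)]

/-- Paths approximated uniformly by their windows tend to zero. -/
lemma mem_l0_of_tendsto {x : ℤ → E}
    (h : Tendsto (fun m : ℕ => supNorm (x - window m x)) atTop (𝓝 0)) : x ∈ l0 E := by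
  change Tendsto x cofinite (𝓝 0)
  rw [Metric.tendsto_nhds]
  intro ε hε
  obtain ⟨m, hm⟩ := (h.eventually_lt_const (ENNReal.ofReal_pos.2 hε)).exists
  rw [Filter.eventually_cofinite]
  refine (Set.finite_Icc (-(m : ℤ)) m).subset fun j hj => ?_
  by_contra hneg
  refine hj ?_
  have h1 := (seqNorm_supNorm.enorm_le (x - window m x) j).trans_lt hm
  have h2 : (x - window m x) j = x j := by
    rw [Pi.sub_apply, window, trunc_apply, if_neg (by simpa using hneg), sub_zero]
  rw [h2, ← ofReal_norm, ENNReal.ofReal_lt_ofReal_iff hε] at h1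
  rwa [dist_zero_right]

/-- Paths approximated in `ℓ₁` by their windows are summable. -/
lemma mem_l1_of_tendsto {x : ℤ → E}
    (h : Tendsto (fun m : ℕ => sumNorm (x - window m x)) atTop (𝓝 0)) : x ∈ l1 E := by
  obtain ⟨m, hm⟩ := (h.eventually_lt_const zero_lt_one).exists
  have h1 : sumNorm x ≠ ∞ := by
    have e1 := seqNorm_sumNorm.add_le (x - window m x) (window m x)
    rw [sub_add_cancel] at e1
    exact ne_top_of_le_ne_top (ENNReal.add_ne_top.2 ⟨(hm.trans ENNReal.one_lt_top).ne,
      ne_top_of_le_ne_top ENNReal.ofReal_ne_top (seqNorm_sumNorm.trunc_le_sum _ _ _)⟩) e1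
  change Summable fun j => ‖x j‖
  have := ENNReal.summable_toReal h1
  simpa using this

lemma mem_l1_of_support {x : ℤ → E} (h : (Function.support x).Finite) : x ∈ l1 E :=
  summable_of_hasFiniteSupport (h.subset fun j hj hx => hj (by simp [hx]))

lemma l1_subset_l0 : l1 E ⊆ l0 E := fun x hx => by
  have : Tendsto (fun j => ‖x j‖) cofinite (𝓝 0) := (show Summable _ from hx).tendsto_cofinite_zero
  exact tendsto_zero_iff_norm_tendsto_zero.2 this

lemma finCont_of_continuousAtUniform {H : (ℤ → E) → ℝ} {x : ℤ → E}
    (h : ContinuousAtUniform H x) : FinCont supNorm H x := by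
  intro ε hε
  obtain ⟨δ, hδ, hy⟩ := h ε hε
  refine ⟨δ, hδ, fun y hfin hle => hy y (mem_l0_of_support hfin) fun j => ?_⟩
  have := (seqNorm_supNorm.enorm_le (y - x) j).trans hle
  rwa [← ofReal_norm, ENNReal.ofReal_le_ofReal_iff hδ.le] at this

lemma finCont_of_continuousAtL1 {H : (ℤ → E) → ℝ} {x : ℤ → E}
    (h : ContinuousAtL1 H x) : FinCont sumNorm H x := by
  intro ε hε
  obtain ⟨δ, hδ, hy⟩ := h ε hε
  exact ⟨δ, hδ, fun y hfin hle => hy y (mem_l1_of_support hfin) hle⟩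

lemma finCont_of_lipschitz {H : (ℤ → E) → ℝ} {x : ℤ → E} (h : LipschitzUniform H)
    (hx : x ∈ l0 E) : FinCont supNorm H x := by
  obtain ⟨L, hL⟩ := h
  intro ε hε
  refine ⟨ε / (|L| + 1), by positivity, fun y hfin hle => ?_⟩
  have hpt : ∀ j, ‖y j - x j‖ ≤ ε / (|L| + 1) := fun j => by
    have := (seqNorm_supNorm.enorm_le (y - x) j).trans hle
    rwa [← ofReal_norm, ENNReal.ofReal_le_ofReal_iff (by positivity)] at this
  have hs : (⨆ j : ℤ, ‖y j - x j‖) ≤ ε / (|L| + 1) := ciSup_le hpt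
  have hs0 : 0 ≤ ⨆ j : ℤ, ‖y j - x j‖ := Real.iSup_nonneg fun _ => norm_nonneg _
  calc |H y - H x| ≤ L * ⨆ j : ℤ, ‖y j - x j‖ :=
        hL y (mem_l0_of_support hfin) x hx
    _ ≤ (|L| + 1) * (ε / (|L| + 1)) :=
        mul_le_mul ((le_abs_self L).trans (by linarith)) hs hs0 (by positivity)
    _ = ε := by field_simp

end norms

/-! ### Anticlustering controls the part of a block away from an exceedance -/

section counting

/-- If more than `2k + 1` exceedances occur, each of them has another one at distance `> k`. -/
lemma card_le_of_spread (T : Finset ℤ) (k : ℕ) :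
    T.card ≤ (2 * k + 1) + (T.filter fun l => ∃ i ∈ T, (k : ℤ) < |i - l|).card := by
  by_cases h : ∃ l ∈ T, ∀ i ∈ T, |i - l| ≤ k
  · obtain ⟨l, _, hl⟩ := h
    refine le_trans ?_ (Nat.le_add_right _ _)
    have : T ⊆ Finset.Icc (l - k) (l + k) := fun i hi => by
      have := abs_le.1 (hl i hi)
      exact Finset.mem_Icc.2 ⟨by omega, by omega⟩
    refine (Finset.card_le_card this).trans ?_
    rw [Int.card_Icc]
    omega
  · push Not at h
    rw [Finset.filter_true_of_mem h]
    omega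

variable {E : Type*} [NormedAddCommGroup E] [NormedSpace ℝ E] [MeasurableSpace E] [BorelSpace E]
  [SecondCountableTopology E]
variable {P : ℕ → Measure (ℤ → E)} {Q : Measure (ℤ → E)} {α : ℝ} {p : ℕ → ℝ} {r : ℕ → ℕ}

/-- An event seen from an exceedance at time `l` has the probability of the event seen from an
exceedance at time `0`. -/
lemma BlockLimit.real_exceed_inter (h : BlockLimit P Q α p r) (n : ℕ) (l : ℤ) (s : ℝ)
    (B : Set (ℤ → E)) :
    (P n).real {x | s < ‖x l‖ ∧ shift l x ∈ B} = (P n).real {x | s < ‖x 0‖ ∧ x ∈ B} := by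
  rw [← h.real_shift n l {x | s < ‖x 0‖ ∧ x ∈ B}]
  congr 1
  ext x
  simp [shift_apply]

lemma BlockLimit.real_exceed (h : BlockLimit P Q α p r) (n : ℕ) (l : ℤ) (s : ℝ) :
    (P n).real {x | s < ‖x l‖} = (P n).real {x | s < ‖x 0‖} := by
  simpa using h.real_exceed_inter n l s Set.univ

lemma measurableSet_far (s : ℝ) (p : ℤ → Prop) :
    MeasurableSet {x : ℤ → E | ∃ i, p i ∧ s < ‖x i‖} := by
  have : {x : ℤ → E | ∃ i, p i ∧ s < ‖x i‖} = ⋃ i, ⋃ (_ : p i), {x | s < ‖x i‖} := by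
    ext x; simp
  rw [this]
  exact MeasurableSet.iUnion fun i => MeasurableSet.iUnion fun _ => measurableSet_exceed s i

/-- Weighting a functional by the number of exceedances in a block costs at most a constant
factor, up to a contribution of the blocks with exceedances far apart. -/
lemma BlockLimit.sum_exceed_le (h : BlockLimit P Q α p r) {s δ : ℝ} (hs : 0 < s) (hδ : 0 < δ) :
    ∀ᶠ k : ℕ in atTop, ∀ᶠ n in atTop, ∀ (f : (ℤ → E) → ℝ) (C : ℝ), Measurable f →
      (∀ x, 0 ≤ f x) → (∀ x, f x ≤ C) →
      ∑ l ∈ Finset.Icc (1 : ℤ) (r n), ∫ x in {x | s < ‖x l‖}, f x ∂(P n) ≤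
        (2 * k + 1) * ∫ x, f x ∂(P n) + C * (δ * (r n * p n)) := by
  classical
  filter_upwards [h.anticluster s s δ hs hs hδ] with k hk
  filter_upwards [hk] with n hn f C hf hf0 hfC
  have := h.prob n
  have hC : 0 ≤ C := (hf0 0).trans (hfC 0)
  have hfi : Integrable f (P n) := h.integrable_of_bound hf (C := C) fun x => by
    rw [abs_of_nonneg (hf0 x)]; exact hfC x
  set I := Finset.Icc (1 : ℤ) (r n) with hI
  set F : ℤ → Set (ℤ → E) := fun l => {x | s < ‖x l‖ ∧ ∃ i, (i ∈ I ∧ (k : ℤ) < |i - l|) ∧ s < ‖x i‖}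
    with hF
  have hFm : ∀ l, MeasurableSet (F l) := fun l =>
    (measurableSet_exceed s l).inter (measurableSet_far s _)
  have hpt : ∀ x, ∑ l ∈ I, {x | s < ‖x l‖}.indicator f x ≤
      (2 * k + 1) * f x + C * ∑ l ∈ I, (F l).indicator 1 x := by
    intro x
    set T := I.filter fun l => s < ‖x l‖ with hT
    have h1 : ∑ l ∈ I, {x | s < ‖x l‖}.indicator f x = T.card * f x := by
      rw [← nsmul_eq_mul, ← Finset.sum_const, hT, Finset.sum_filter]
      exact Finset.sum_congr rfl fun l _ => rfl
    have h2 : ∑ l ∈ I, (F l).indicator (1 : (ℤ → E) → ℝ) x =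
        (T.filter fun l => ∃ i ∈ T, (k : ℤ) < |i - l|).card := by
      rw [hT, Finset.filter_filter, Finset.card_filter, Nat.cast_sum]
      refine Finset.sum_congr rfl fun l _ => ?_
      rw [Set.indicator_apply]
      push_cast
      refine if_congr (and_congr Iff.rfl ⟨?_, ?_⟩) rfl rfl
      · rintro ⟨i, ⟨hi, hd⟩, hx⟩
        exact ⟨i, Finset.mem_filter.2 ⟨hi, hx⟩, hd⟩
      · rintro ⟨i, hi, hd⟩
        rw [Finset.mem_filter] at hi
        exact ⟨i, ⟨hi.1, hd⟩, hi.2⟩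
    rw [h1, h2]
    have h3 : (T.card : ℝ) ≤ (2 * k + 1) +
        ((T.filter fun l => ∃ i ∈ T, (k : ℤ) < |i - l|).card : ℝ) := by
      exact_mod_cast card_le_of_spread T k
    refine (mul_le_mul_of_nonneg_right h3 (hf0 x)).trans ?_
    rw [add_mul, mul_comm C]
    have := mul_le_mul_of_nonneg_left (hfC x) (Nat.cast_nonneg (α := ℝ)
      (T.filter fun l => ∃ i ∈ T, (k : ℤ) < |i - l|).card)
    linarith
  have hFi : ∀ l, Integrable (fun x => (F l).indicator (1 : (ℤ → E) → ℝ) x) (P n) := fun l =>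
    (integrable_const (1 : ℝ)).indicator (hFm l)
  have hLHS : ∑ l ∈ I, ∫ x in {x | s < ‖x l‖}, f x ∂(P n) =
      ∫ x, ∑ l ∈ I, {x | s < ‖x l‖}.indicator f x ∂(P n) := by
    rw [integral_finsetSum _ fun l _ => hfi.indicator (measurableSet_exceed s l)]
    exact Finset.sum_congr rfl fun l _ => (integral_indicator (measurableSet_exceed s l)).symm
  have hsumi : Integrable (fun x => ∑ l ∈ I, (F l).indicator (1 : (ℤ → E) → ℝ) x) (P n) :=
    integrable_finsetSum _ fun l _ => hFi l
  rw [hLHS]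
  refine (integral_mono (integrable_finsetSum _ fun l _ =>
    hfi.indicator (measurableSet_exceed s l))
    ((hfi.const_mul _).add (hsumi.const_mul C)) hpt).trans ?_
  have e1 := integral_add (hfi.const_mul (2 * k + 1 : ℝ)) (hsumi.const_mul C)
  simp only [Pi.add_apply]
  rw [e1, integral_const_mul, integral_const_mul, integral_finsetSum _ fun l _ => hFi l]
  refine (add_le_add_iff_left _).2 (mul_le_mul_of_nonneg_left ?_ hC)
  have hb : ∀ l ∈ I, ∫ x, (F l).indicator (1 : (ℤ → E) → ℝ) x ∂(P n) ≤ δ * p n := by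
    intro l hl
    rw [integral_indicator_one (hFm l)]
    refine le_trans ?_ hn
    refine le_trans ?_ (h.real_exceed_inter n l s
      {x | ∃ i : ℤ, (k : ℤ) ≤ |i| ∧ |i| ≤ r n ∧ s < ‖x i‖}).le
    refine measureReal_mono fun x hx => ⟨hx.1, ?_⟩
    obtain ⟨_, i, ⟨hi, hd⟩, hx⟩ := hx
    rw [hI, Finset.mem_Icc] at hi hl
    refine ⟨i - l, hd.le, abs_le.2 ⟨by omega, by omega⟩, by simpa [shift_apply] using hx⟩
  refine (Finset.sum_le_sum hb).trans (le_of_eq ?_)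
  rw [Finset.sum_const, hI, Int.card_Icc, nsmul_eq_mul]
  simp
  ring

/-- In the uniform norm, the tail outside of a window is large only if there is a second exceedance,
which anticlustering excludes. -/
lemma BlockLimit.tailSmall_supNorm (h : BlockLimit P Q α p r) : TailSmall P p r supNorm := by
  intro s η δ hs hη hδ
  filter_upwards [h.anticluster s η δ hs hη hδ] with m hm
  filter_upwards [hm] with n hn
  have := h.prob n
  refine (Finset.sum_le_sum (g := fun _ => δ * p n) fun j hj => le_trans ?_ hn).trans
    (le_of_eq ?_)
  · rw [Finset.mem_Icc] at hj
    refine measureReal_mono fun x hx => ⟨hx.1, ?_⟩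
    obtain ⟨i, hi⟩ := lt_iSup_iff.1 hx.2
    rw [← ofReal_norm, ENNReal.ofReal_lt_ofReal_iff_of_nonneg hη.le] at hi
    simp only [trunc, Pi.sub_apply, window] at hi
    split_ifs at hi with h1 h2
    · simp at hi; linarith
    · rw [sub_zero] at hi
      refine ⟨i, ?_, abs_le.2 ⟨by omega, by omega⟩, hi⟩
      rw [← abs_le] at h2
      omega
    · simp at hi; linarith
  · rw [Finset.sum_const, Int.card_Icc, nsmul_eq_mul]
    simp
    ring

lemma measurable_smallSum (ε : ℝ) (I : Finset ℤ) :
    Measurable fun x : ℤ → E => ∑ i ∈ I, if ‖x i‖ ≤ ε then ‖x i‖ else 0 := by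
  refine Finset.measurable_sum _ fun i _ => ?_
  exact Measurable.ite (measurableSet_le (measurable_norm_apply i) measurable_const)
    (measurable_norm_apply i) measurable_const

/-- In the `ℓ₁`-norm, the tail outside of a window is large only if there is a distant exceedance of
a small level `ε` or if the sum of the values below `ε` is large. The second event, summed over the
exceedances in the block, is handled by `sum_exceed_le`. -/
lemma BlockLimit.tailSmall_sumNorm (h : BlockLimit P Q α p r) (hsj : SmallJumps P p r) :
    TailSmall P p r sumNorm := by
  intro s η δ hs hη hδ
  have hδ3 : 0 < δ / 3 := by positivity
  obtain ⟨k, hk⟩ := (h.sum_exceed_le hs hδ3).exists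
  have hδk : 0 < δ / (3 * (2 * k + 1)) := by positivity
  obtain ⟨ε, hεn, hε0⟩ := ((hsj η _ hη hδk).and self_mem_nhdsWithin).exists
  have hε : 0 < ε := hε0
  filter_upwards [h.anticluster s ε (δ / 3) hs hε hδ3] with m hm
  filter_upwards [hm, hk, hεn] with n hn hkn hεn
  have := h.prob n
  set sm : E → ℝ := fun z => if ‖z‖ ≤ ε then ‖z‖ else 0 with hsm
  have hsm0 : ∀ z, 0 ≤ sm z := fun z => by simp only [hsm]; split_ifs <;> simp
  set A : Set (ℤ → E) := {x | η < ∑ i ∈ Finset.Icc (1 : ℤ) (r n), sm (x i)} with hA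
  have hAm : MeasurableSet A := measurableSet_lt measurable_const (measurable_smallSum ε _)
  have hterm : ∀ j ∈ Finset.Icc (1 : ℤ) (r n), (P n).real {x | s < ‖x 0‖ ∧
      ENNReal.ofReal η < sumNorm (trunc (1 - j) (r n - j) (x - window m x))} ≤
      δ / 3 * p n + ∫ x in {x | s < ‖x j‖}, A.indicator 1 x ∂(P n) := by
    intro j hj
    rw [Finset.mem_Icc] at hj
    -- the event of a large sum of small jumps, seen from the exceedance at time `j`
    set S2 : Set (ℤ → E) := {x | s < ‖x 0‖ ∧
      x ∈ {x | η < ∑ i ∈ Finset.Icc (1 - j) (r n - j), sm (x i)}} with hS2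
    have hsub : {x : ℤ → E | s < ‖x 0‖ ∧
        ENNReal.ofReal η < sumNorm (trunc (1 - j) (r n - j) (x - window m x))} ⊆
        {x | s < ‖x 0‖ ∧ ∃ i : ℤ, (m : ℤ) ≤ |i| ∧ |i| ≤ r n ∧ ε < ‖x i‖} ∪ S2 := by
      rintro x ⟨hx0, hx⟩
      by_contra hneg
      rw [Set.mem_union, not_or] at hneg
      obtain ⟨hn1, hn2⟩ := hneg
      have hle : ∀ i ∈ Finset.Icc (1 - j) (r n - j), ‖(x - window m x) i‖ ≤ sm (x i) := by
        intro i hi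
        rw [Finset.mem_Icc] at hi
        by_cases hw : -(m : ℤ) ≤ i ∧ i ≤ m
        · rw [Pi.sub_apply, window, trunc_apply, if_pos hw, sub_self, norm_zero]
          exact hsm0 _
        · rw [Pi.sub_apply, window, trunc_apply, if_neg hw, sub_zero]
          have : ‖x i‖ ≤ ε := by
            by_contra! hlt
            refine hn1 ⟨hx0, i, ?_, abs_le.2 ⟨by omega, by omega⟩, hlt⟩
            rw [← abs_le] at hw
            omega
          simp only [hsm, if_pos this, le_refl]
      have h2 : η < ∑ i ∈ Finset.Icc (1 - j) (r n - j), sm (x i) := by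
        have h3 := hx.trans_le ((seqNorm_sumNorm.trunc_le_sum _ _ _).trans
          (ENNReal.ofReal_le_ofReal (Finset.sum_le_sum hle)))
        exact (ENNReal.ofReal_lt_ofReal_iff_of_nonneg hη.le).1 h3
      exact hn2 ⟨hx0, h2⟩
    refine (measureReal_mono hsub).trans ((measureReal_union_le _ _).trans (add_le_add hn ?_))
    rw [hS2, ← h.real_exceed_inter n j s, integral_indicator_one hAm,
      measureReal_restrict_apply hAm, Set.inter_comm]
    refine le_of_eq (congrArg _ ?_)
    ext x
    refine and_congr Iff.rfl ?_
    have : ∑ i ∈ Finset.Icc (1 - j) (r n - j), sm (shift j x i) =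
        ∑ i ∈ Finset.Icc (1 : ℤ) (r n), sm (x i) := by
      refine Finset.sum_bij' (fun i _ => i + j) (fun i _ => i - j) ?_ ?_ ?_ ?_ ?_
      · intro i hi; rw [Finset.mem_Icc] at hi ⊢; omega
      · intro i hi; rw [Finset.mem_Icc] at hi ⊢; omega
      · intro i _; ring
      · intro i _; ring
      · intro i _; rfl
    simp only [Set.mem_ofPred_eq, this, hA]
  refine (Finset.sum_le_sum hterm).trans ?_
  rw [Finset.sum_add_distrib, Finset.sum_const, Int.card_Icc, nsmul_eq_mul]
  have h1 := hkn (A.indicator 1) 1 (measurable_const.indicator hAm)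
    (fun x => Set.indicator_nonneg (fun _ _ => zero_le_one) x)
    (fun x => Set.indicator_le_self' (fun _ _ => zero_le_one) x)
  rw [integral_indicator_one hAm] at h1
  have h2 : (2 * k + 1) * (P n).real A ≤ (2 * k + 1) * (δ / (3 * (2 * k + 1)) * (r n * p n)) :=
    mul_le_mul_of_nonneg_left hεn (by positivity)
  have h3 : (2 * k + 1) * (δ / (3 * (2 * k + 1)) * (r n * p n)) = δ / 3 * (r n * p n) := by
    field_simp
  have h4 : (((r n : ℤ) + 1 - 1).toNat : ℝ) = r n := by simp
  rw [h4]
  linarith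

end counting

/-! ### Partition of a functional according to its exceedances -/

/-- A continuous substitute for the indicator of `{t > s}`, equal to `1` for `t ≥ 2s`. -/
noncomputable def bump (s t : ℝ) : ℝ := min 1 (max 0 (t / s - 1))

/-- The smoothed number of exceedances of the level `s`. -/
noncomputable def smoothCount {E : Type*} [NormedAddCommGroup E] (s : ℝ) (x : ℤ → E) : ℝ :=
  ∑' j, bump s ‖x j‖

/-- The factor `1 / max(W, 1)`, where `W` is the smoothed number of exceedances (and `0` if
`W = ∞`). It turns the weights `bump s ‖x_j‖` into a partition of unity on the sequences with a
coordinate of norm at least `2s`. -/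
noncomputable def damp {E : Type*} [NormedAddCommGroup E] (s : ℝ) (x : ℤ → E) : ℝ :=
  (max 1 (smoothCount s x))⁻¹

section bump

lemma bump_nonneg (s t : ℝ) : 0 ≤ bump s t := by unfold bump; positivity

lemma bump_le_one (s t : ℝ) : bump s t ≤ 1 := min_le_left _ _

lemma continuous_bump (s : ℝ) : Continuous (bump s) := by unfold bump; fun_prop

lemma bump_eq_zero {s t : ℝ} (hs : 0 < s) (h : t ≤ s) : bump s t = 0 := by
  have : t / s - 1 ≤ 0 := by rw [sub_nonpos, div_le_one hs]; exact h
  simp [bump, max_eq_left this]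

lemma bump_eq_one {s t : ℝ} (hs : 0 < s) (h : 2 * s ≤ t) : bump s t = 1 := by
  have : 1 ≤ t / s - 1 := by rw [le_sub_iff_add_le, le_div_iff₀ hs]; linarith
  exact min_eq_left (this.trans (le_max_right _ _))

lemma abs_bump_sub_le {s : ℝ} (hs : 0 < s) (t t' : ℝ) : |bump s t - bump s t'| ≤ |t - t'| / s := by
  have h1 := abs_min_sub_min_le_max 1 (max 0 (t / s - 1)) 1 (max 0 (t' / s - 1))
  have h2 := abs_max_sub_max_le_max 0 (t / s - 1) 0 (t' / s - 1)
  simp only [sub_self, abs_zero] at h1 h2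
  have h3 : |t / s - 1 - (t' / s - 1)| = |t - t'| / s := by
    rw [sub_sub_sub_cancel_right, ← sub_div, abs_div, abs_of_pos hs]
  rw [h3] at h2
  have h4 : 0 ≤ |t - t'| / s := by positivity
  rw [max_eq_right h4] at h2
  exact h1.trans (max_le h4 h2)

end bump

section damp

variable {E : Type*} [NormedAddCommGroup E]

lemma smoothCount_nonneg (s : ℝ) (x : ℤ → E) : 0 ≤ smoothCount s x :=
  tsum_nonneg fun _ => bump_nonneg _ _

lemma damp_nonneg (s : ℝ) (x : ℤ → E) : 0 ≤ damp s x := by unfold damp; positivity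

lemma damp_le_one (s : ℝ) (x : ℤ → E) : damp s x ≤ 1 := inv_le_one_of_one_le₀ (le_max_left _ _)

lemma abs_damp_le_one (s : ℝ) (x : ℤ → E) : |damp s x| ≤ 1 := by
  rw [abs_of_nonneg (damp_nonneg s x)]; exact damp_le_one s x

lemma smoothCount_shift (s : ℝ) (k : ℤ) (x : ℤ → E) :
    smoothCount s (shift k x) = smoothCount s x :=
  (Equiv.addRight k).tsum_eq fun j => bump s ‖x j‖

lemma damp_shift (s : ℝ) (k : ℤ) (x : ℤ → E) : damp s (shift k x) = damp s x := by
  rw [damp, smoothCount_shift, damp]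

lemma measurable_smoothCount [MeasurableSpace E] [BorelSpace E] (s : ℝ) :
    Measurable (smoothCount (E := E) s) :=
  Measurable.tsum fun j => (continuous_bump s).measurable.comp (measurable_norm_apply j)

lemma measurable_damp [MeasurableSpace E] [BorelSpace E] (s : ℝ) : Measurable (damp (E := E) s) :=
  (measurable_const.max (measurable_smoothCount s)).inv

lemma smoothCount_mul_damp_le (s : ℝ) (x : ℤ → E) : smoothCount s x * damp s x ≤ 1 := by
  rw [damp, ← div_eq_mul_inv, div_le_one (by positivity)]
  exact le_max_right _ _

lemma smoothCount_mul_damp_nonneg (s : ℝ) (x : ℤ → E) : 0 ≤ smoothCount s x * damp s x :=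
  mul_nonneg (smoothCount_nonneg s x) (damp_nonneg s x)

lemma smoothCount_eq_sum {s : ℝ} (hs : 0 < s) (x : ℤ → E) (J : Finset ℤ)
    (hJ : ∀ j, j ∉ J → ‖x j‖ ≤ s) : smoothCount s x = ∑ j ∈ J, bump s ‖x j‖ :=
  tsum_eq_sum fun j hj => bump_eq_zero hs (hJ j hj)

lemma smoothCount_trunc {s : ℝ} (hs : 0 < s) (a b : ℤ) (x : ℤ → E) :
    smoothCount s (trunc a b x) = ∑ j ∈ Finset.Icc a b, bump s ‖x j‖ := by
  rw [smoothCount_eq_sum hs _ (Finset.Icc a b)]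
  · refine Finset.sum_congr rfl fun j hj => ?_
    rw [trunc_apply, if_pos (Finset.mem_Icc.1 hj)]
  · intro j hj
    rw [trunc_apply, if_neg (fun h => hj (Finset.mem_Icc.2 h)), norm_zero]
    exact hs.le

/-- The weights `bump s ‖x_j‖ * damp s x` sum to `1` on the paths with a coordinate of norm at least
`2s`. -/
lemma smoothCount_mul_damp_eq_one {s : ℝ} (hs : 0 < s) {x : ℤ → E} (hx : x ∈ l0 E) {j : ℤ}
    (hj : 2 * s ≤ ‖x j‖) : smoothCount s x * damp s x = 1 := by
  have h1 : 1 ≤ smoothCount s x := by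
    rw [smoothCount_eq_sum hs x (finite_le_norm_of_mem_l0 hx hs).toFinset]
    · rw [← bump_eq_one hs hj]
      refine Finset.single_le_sum (f := fun j => bump s ‖x j‖) (fun _ _ => bump_nonneg _ _) ?_
      simp only [Set.Finite.mem_toFinset, Set.mem_ofPred_eq]
      linarith
    · intro i hi
      simp only [Set.Finite.mem_toFinset, Set.mem_ofPred_eq, not_le] at hi
      exact hi.le
  rw [damp, max_eq_right h1, mul_inv_cancel₀ (by linarith)]

variable [MeasurableSpace E] {N : (ℤ → E) → ℝ≥0∞}

lemma norm_le_of_seqNorm (hN : SeqNorm N) {y x : ℤ → E} {δ : ℝ} (hδ : 0 ≤ δ)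
    (h : N (y - x) ≤ ENNReal.ofReal δ) (j : ℤ) : ‖y j - x j‖ ≤ δ := by
  have := (hN.enorm_le (y - x) j).trans h
  rwa [← ofReal_norm, ENNReal.ofReal_le_ofReal_iff hδ] at this

/-- Near a path tending to zero, the smoothed count only involves the finitely many coordinates of
norm at least `s / 2`. -/
lemma finCont_damp (hN : SeqNorm N) {s : ℝ} (hs : 0 < s) {x : ℤ → E} (hx : x ∈ l0 E) :
    FinCont N (damp s) x := by
  intro ε hε
  set J := (finite_le_norm_of_mem_l0 hx (half_pos hs)).toFinset with hJ
  refine ⟨min (s / 2) (ε * s / (J.card + 1)), by positivity, fun y _ hle => ?_⟩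
  have hpt := norm_le_of_seqNorm hN (by positivity) hle
  have hout : ∀ j, j ∉ J → ‖x j‖ ≤ s / 2 := by
    intro j hj
    simp only [hJ, Set.Finite.mem_toFinset, Set.mem_ofPred_eq, not_le] at hj
    exact hj.le
  have hx' := smoothCount_eq_sum hs x J fun j hj => (hout j hj).trans (by linarith)
  have hy' := smoothCount_eq_sum hs y J fun j hj => by
    have h1 := (hpt j).trans (min_le_left _ _)
    have h2 := hout j hj
    have h3 := norm_le_norm_add_norm_sub' (y j) (x j)
    linarith
  have hW : |smoothCount s y - smoothCount s x| ≤ ε := by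
    rw [hx', hy', ← Finset.sum_sub_distrib]
    refine (Finset.abs_sum_le_sum_abs _ _).trans ?_
    refine (Finset.sum_le_sum (g := fun _ => ε / (J.card + 1)) fun j _ => ?_).trans ?_
    · refine (abs_bump_sub_le hs _ _).trans ?_
      rw [div_le_iff₀ hs]
      refine (abs_norm_sub_norm_le _ _).trans ((hpt j).trans ((min_le_right _ _).trans
        (le_of_eq ?_)))
      ring
    · rw [Finset.sum_const, nsmul_eq_mul, mul_div_assoc', div_le_iff₀ (by positivity)]
      nlinarith
  have h1 : 1 ≤ max 1 (smoothCount s y) := le_max_left _ _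
  have h2 : 1 ≤ max 1 (smoothCount s x) := le_max_left _ _
  have h3 : |max 1 (smoothCount s x) - max 1 (smoothCount s y)| ≤ ε := by
    have := abs_max_sub_max_le_max 1 (smoothCount s x) 1 (smoothCount s y)
    rw [sub_self, abs_zero, abs_sub_comm (smoothCount s x)] at this
    exact this.trans (max_le hε.le hW)
  rw [damp, damp, inv_sub_inv (by positivity) (by positivity), abs_div,
    abs_of_pos (show 0 < max 1 (smoothCount s y) * max 1 (smoothCount s x) by positivity)]
  refine div_le_of_le_mul₀ (by positivity) hε.le (h3.trans ?_)
  exact le_mul_of_one_le_right hε.le (one_le_mul_of_one_le_of_one_le h1 h2)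

lemma finCont_bump (hN : SeqNorm N) {s : ℝ} (hs : 0 < s) (x : ℤ → E) :
    FinCont N (fun x => bump s ‖x 0‖) x := by
  intro ε hε
  refine ⟨ε * s, by positivity, fun y _ hle => ?_⟩
  refine (abs_bump_sub_le hs _ _).trans ?_
  rw [div_le_iff₀ hs]
  exact (abs_norm_sub_norm_le _ _).trans (norm_le_of_seqNorm hN (by positivity) hle 0)

variable {H H' : (ℤ → E) → ℝ} {C C' : ℝ} {x : ℤ → E}

lemma FinCont.add (h : FinCont N H x) (h' : FinCont N H' x) :
    FinCont N (fun x => H x + H' x) x := by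
  intro ε hε
  obtain ⟨δ, hδ, hy⟩ := h (ε / 2) (half_pos hε)
  obtain ⟨δ', hδ', hy'⟩ := h' (ε / 2) (half_pos hε)
  refine ⟨min δ δ', lt_min hδ hδ', fun y hf hle => ?_⟩
  have h1 := hy y hf (hle.trans (ENNReal.ofReal_le_ofReal (min_le_left _ _)))
  have h2 := hy' y hf (hle.trans (ENNReal.ofReal_le_ofReal (min_le_right _ _)))
  rw [add_sub_add_comm]
  exact (abs_add_le _ _).trans (by linarith)

lemma FinCont.mul (hC : ∀ x, |H x| ≤ C) (hC' : ∀ x, |H' x| ≤ C') (h : FinCont N H x)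
    (h' : FinCont N H' x) : FinCont N (fun x => H x * H' x) x := by
  intro ε hε
  have hC0 : 0 ≤ C := (abs_nonneg _).trans (hC x)
  have hC0' : 0 ≤ C' := (abs_nonneg _).trans (hC' x)
  obtain ⟨δ, hδ, hy⟩ := h (ε / (2 * (C' + 1))) (by positivity)
  obtain ⟨δ', hδ', hy'⟩ := h' (ε / (2 * (C + 1))) (by positivity)
  refine ⟨min δ δ', lt_min hδ hδ', fun y hf hle => ?_⟩
  have h1 := hy y hf (hle.trans (ENNReal.ofReal_le_ofReal (min_le_left _ _)))
  have h2 := hy' y hf (hle.trans (ENNReal.ofReal_le_ofReal (min_le_right _ _)))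
  have e : H y * H' y - H x * H' x = (H y - H x) * H' y + H x * (H' y - H' x) := by ring
  rw [e]
  refine (abs_add_le _ _).trans ?_
  rw [abs_mul, abs_mul]
  have h3 : |H y - H x| * |H' y| ≤ ε / (2 * (C' + 1)) * (C' + 1) :=
    mul_le_mul h1 ((hC' y).trans (by linarith)) (abs_nonneg _) (by positivity)
  have h4 : |H x| * |H' y - H' x| ≤ (C + 1) * (ε / (2 * (C + 1))) :=
    mul_le_mul ((hC x).trans (by linarith)) h2 (abs_nonneg _) (by positivity)
  have h5 : ε / (2 * (C' + 1)) * (C' + 1) = ε / 2 := by field_simp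
  have h6 : (C + 1) * (ε / (2 * (C + 1))) = ε / 2 := by field_simp
  linarith

lemma FinCont.abs (h : FinCont N H x) : FinCont N (fun x => |H x|) x := by
  intro ε hε
  obtain ⟨δ, hδ, hy⟩ := h ε hε
  exact ⟨δ, hδ, fun y hf hle => (abs_abs_sub_abs_le _ _).trans (hy y hf hle)⟩

lemma finCont_const (c : ℝ) : FinCont N (fun _ => c) x :=
  fun ε hε => ⟨1, one_pos, fun _ _ _ => by simpa using hε.le⟩

/-- The defect of the decomposition of `H` into contributions of the single exceedances lives on
the blocks without large values. -/
lemma abs_sub_sum_bump_le {s : ℝ} (hs : 0 < s) (H : (ℤ → E) → ℝ) (a b : ℤ) (x : ℤ → E) :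
    |H (trunc a b x) - ∑ l ∈ Finset.Icc a b,
      bump s ‖x l‖ * (damp s (trunc a b x) * H (trunc a b x))| ≤
      {x | ∀ j ∈ Finset.Icc a b, ‖x j‖ ≤ 2 * s}.indicator (fun x => |H (trunc a b x)|) x := by
  rw [← Finset.sum_mul, ← smoothCount_trunc hs, ← mul_assoc, ← one_sub_mul, abs_mul]
  have h1 := smoothCount_mul_damp_le s (trunc a b x)
  have h0 := smoothCount_mul_damp_nonneg s (trunc a b x)
  by_cases hx : ∀ j ∈ Finset.Icc a b, ‖x j‖ ≤ 2 * s
  · rw [Set.indicator_of_mem (by exact hx), abs_of_nonneg (by linarith)]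
    exact mul_le_of_le_one_left (abs_nonneg _) (by linarith)
  · rw [Set.indicator_of_notMem (by exact hx)]
    push Not at hx
    obtain ⟨j, hj, hlt⟩ := hx
    have hmem : trunc a b x ∈ l0 E :=
      mem_l0_of_support (trunc_support_finite a b x)
    rw [smoothCount_mul_damp_eq_one hs hmem (j := j), sub_self, abs_zero, zero_mul]
    rw [trunc_apply, if_pos (Finset.mem_Icc.1 hj)]
    exact hlt.le

end damp

/-! ### Cluster indices -/

/-- The properties of the sequence spaces `ℓ₀` and `ℓ₁` on which functionals are shift-invariant:
they contain the finitely supported sequences and carry the multiples of the tail process. -/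
structure SeqSpace {E : Type*} [NormedAddCommGroup E] [NormedSpace ℝ E] [MeasurableSpace E]
    (Q : Measure (ℤ → E)) (S : Set (ℤ → E)) : Prop where
  measurable : MeasurableSet S
  mem_of_support : ∀ x, (Function.support x).Finite → x ∈ S
  subset : S ⊆ l0 E
  ae_mem : ∀ᵐ y ∂Q, ∀ c : ℝ, 0 < c → c • y ∈ S

/-- The functionals to which the covariance computation applies: bounded, almost surely continuous
at the multiples of the tail process, shift-invariant, and asymptotically negligible on the blocks
without large values. -/
structure Admissible {E : Type*} [NormedAddCommGroup E] [NormedSpace ℝ E] [MeasurableSpace E]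
    (P : ℕ → Measure (ℤ → E)) (Q : Measure (ℤ → E)) (p : ℕ → ℝ) (r : ℕ → ℕ)
    (N : (ℤ → E) → ℝ≥0∞) (S : Set (ℤ → E)) (H : (ℤ → E) → ℝ) : Prop where
  measurable : Measurable H
  bounded : ∃ C, ∀ x, |H x| ≤ C
  finCont : ∀ s : ℝ, 0 < s → ∀ᵐ y ∂Q, FinCont N H (s • y)
  shift_inv : ∀ x ∈ S, ∀ k, H (shift k x) = H x
  small : ∀ δ : ℝ, 0 < δ → ∀ᶠ s in 𝓝[>] (0 : ℝ), ∀ᶠ n in atTop,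
    ∫ x in {x | ∀ j ∈ Finset.Icc (1 : ℤ) (r n), ‖x j‖ ≤ 2 * s}, |H (trunc 1 (r n) x)| ∂(P n) ≤
      δ * (r n * p n)

/-- The tail measure restricted to the paths anchored at `0`. This is the cluster measure, by
`BlockLimit.clusterMeasure_eq`. -/
noncomputable def anchored {E : Type*} [NormedAddCommGroup E] [NormedSpace ℝ E]
    [MeasurableSpace E] (Q : Measure (ℤ → E)) (α : ℝ) : Measure (ℤ → E) :=
  (tailMeasure Q α).restrict {x | InfargmaxEqZero x}

section cluster

variable {E : Type*} [NormedAddCommGroup E] [NormedSpace ℝ E] [MeasurableSpace E] [BorelSpace E]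
  [SecondCountableTopology E]
variable {P : ℕ → Measure (ℤ → E)} {Q : Measure (ℤ → E)} {α : ℝ} {p : ℕ → ℝ} {r : ℕ → ℕ}
variable {N : (ℤ → E) → ℝ≥0∞} {S : Set (ℤ → E)}

lemma BlockLimit.ae_mem (h : BlockLimit P Q α p r) (hS : SeqSpace Q S) :
    ∀ᵐ x ∂(tailMeasure Q α), x ∈ S := h.ae_tailMeasure hS.ae_mem hS.measurable

lemma SeqSpace.ae_mem_l0 (hS : SeqSpace Q S) : ∀ᵐ y ∂Q, y ∈ l0 E :=
  hS.ae_mem.mono fun y hy => hS.subset (by simpa using hy 1 one_pos)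

/-- The integral of a shift-invariant functional, weighted by the exceedances, with respect to the
cluster measure. -/
lemma BlockLimit.lintegral_anchored (h : BlockLimit P Q α p r) (hS : SeqSpace Q S) {s : ℝ}
    (hs : 0 < s) {w : E → ℝ≥0∞} (hw : Measurable w) (hw0 : ∀ z, ‖z‖ ≤ s → w z = 0)
    {q : (ℤ → E) → ℝ≥0∞} (hq : Measurable q) (hinv : ∀ x ∈ S, ∀ k, q (shift k x) = q x) :
    ∫⁻ x, (∑' j, w (x j)) * q x ∂(anchored Q α) =
      ENNReal.ofReal (s ^ (-α)) * ∫⁻ y, w (s • y 0) * q (s • y) ∂Q := by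
  have hg : Measurable fun x : ℤ → E => w (x 0) * q x :=
    (hw.comp (measurable_pi_apply 0)).mul hq
  have h1 := h.massTransport hS.ae_mem_l0 hg fun x hx => by
    rw [hx, hw0 0 (by simpa using hs.le), zero_mul]
  have h2 := h.lintegral_tailMeasure hs hg fun x hx => by rw [hw0 _ hx, zero_mul]
  rw [h2] at h1
  simp only [Pi.smul_apply] at h1
  rw [h1, anchored]
  refine lintegral_congr_ae ?_
  filter_upwards [ae_restrict_of_ae (h.ae_mem hS)] with x hx
  rw [← ENNReal.tsum_mul_right]
  refine tsum_congr fun j => ?_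
  rw [hinv x hx, shift_apply, zero_add]

lemma ofReal_tsum_toReal {w : E → ℝ} (hw0 : ∀ z, 0 ≤ w z) (x : ℤ → E) :
    (∑' j, ENNReal.ofReal (w (x j))).toReal = ∑' j, w (x j) := by
  rw [ENNReal.tsum_toReal_eq fun j => ENNReal.ofReal_ne_top]
  exact tsum_congr fun j => ENNReal.toReal_ofReal (hw0 _)

/-- The real-valued form of `lintegral_anchored`. -/
lemma BlockLimit.integral_anchored (h : BlockLimit P Q α p r) (hS : SeqSpace Q S) {s : ℝ}
    (hs : 0 < s) {w : E → ℝ} (hw : Measurable w) (hw0 : ∀ z, 0 ≤ w z) (hw1 : ∀ z, w z ≤ 1)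
    (hws : ∀ z, ‖z‖ ≤ s → w z = 0) {G : (ℤ → E) → ℝ} (hG : Measurable G) {C : ℝ}
    (hC : ∀ x, |G x| ≤ C) (hinv : ∀ x ∈ S, ∀ k, G (shift k x) = G x) :
    Integrable (fun x => (∑' j, w (x j)) * G x) (anchored Q α) ∧
      ∫ x, (∑' j, w (x j)) * G x ∂(anchored Q α) =
        s ^ (-α) * ∫ y, w (s • y 0) * G (s • y) ∂Q := by
  have := h.probQ
  have hsα : 0 ≤ s ^ (-α) := Real.rpow_nonneg hs.le _
  have hwm : Measurable fun z => ENNReal.ofReal (w z) := hw.ennreal_ofReal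
  have hw0' : ∀ z, ‖z‖ ≤ s → ENNReal.ofReal (w z) = 0 := fun z hz => by rw [hws z hz]; simp
  have hC0 : 0 ≤ C := (abs_nonneg _).trans (hC 0)
  set W : (ℤ → E) → ℝ≥0∞ := fun x => ∑' j, ENNReal.ofReal (w (x j)) with hW
  have hWm : Measurable W := Measurable.tsum fun j => hwm.comp (measurable_pi_apply j)
  have hWr : ∀ x, (W x).toReal = ∑' j, w (x j) := ofReal_tsum_toReal hw0
  have hW1 : ∫⁻ x, W x ∂(anchored Q α) ≠ ∞ := by
    have e := h.lintegral_anchored hS hs hwm hw0' (q := 1) measurable_const (fun _ _ _ => rfl)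
    simp only [Pi.one_apply, mul_one] at e
    rw [hW, e]
    refine ENNReal.mul_ne_top ENNReal.ofReal_ne_top ?_
    refine ne_top_of_le_ne_top ENNReal.one_ne_top ((lintegral_mono (g := fun _ => 1)
      fun y => ?_).trans (by simp))
    simpa using ENNReal.ofReal_le_ofReal (hw1 (s • y 0))
  have hWfin : ∀ᵐ x ∂(anchored Q α), W x < ∞ := ae_lt_top hWm hW1
  have hmeas : Measurable fun x => (∑' j, w (x j)) * G x := by
    simp_rw [← hWr]; exact hWm.ennreal_toReal.mul hG
  have hint : Integrable (fun x => (∑' j, w (x j)) * G x) (anchored Q α) := by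
    refine ⟨hmeas.aestronglyMeasurable, ?_⟩
    rw [hasFiniteIntegral_iff_enorm]
    refine lt_of_le_of_lt (lintegral_mono (g := fun x => W x * ENNReal.ofReal C) fun x => ?_) ?_
    · rw [enorm_mul]
      refine mul_le_mul' ?_ ?_
      · rw [← hWr, Real.enorm_of_nonneg ENNReal.toReal_nonneg]
        exact ENNReal.ofReal_toReal_le
      · rw [Real.enorm_eq_ofReal_abs]
        exact ENNReal.ofReal_le_ofReal (hC x)
    · rw [lintegral_mul_const _ hWm]
      exact ENNReal.mul_lt_top hW1.lt_top ENNReal.ofReal_lt_top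
  refine ⟨hint, ?_⟩
  have hpos : ∀ G' : (ℤ → E) → ℝ, Measurable G' → (∀ x ∈ S, ∀ k, G' (shift k x) = G' x) →
      ∫⁻ x, ENNReal.ofReal ((∑' j, w (x j)) * G' x) ∂(anchored Q α) =
      ENNReal.ofReal (s ^ (-α)) * ∫⁻ y, ENNReal.ofReal (w (s • y 0) * G' (s • y)) ∂Q := by
    intro G' hG' hinv'
    have e := h.lintegral_anchored hS hs hwm hw0' (q := fun x => ENNReal.ofReal (G' x))
      hG'.ennreal_ofReal fun x hx k => by rw [hinv' x hx k]
    simp_rw [← ENNReal.ofReal_mul (hw0 _)] at e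
    rw [← e]
    refine lintegral_congr_ae ?_
    filter_upwards [hWfin] with x hx
    rw [← hWr, ENNReal.ofReal_mul ENNReal.toReal_nonneg, ENNReal.ofReal_toReal hx.ne]
  have hQm : Measurable fun y : ℤ → E => w (s • y 0) * G (s • y) :=
    (hw.comp ((measurable_pi_apply 0).const_smul s)).mul (hG.comp (measurable_smul_path s))
  have hQi : Integrable (fun y : ℤ → E => w (s • y 0) * G (s • y)) Q := by
    refine Integrable.of_bound hQm.aestronglyMeasurable C (Eventually.of_forall fun y => ?_)
    rw [Real.norm_eq_abs, abs_mul, abs_of_nonneg (hw0 _)]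
    exact (mul_le_of_le_one_left (abs_nonneg _) (hw1 _)).trans (hC _)
  rw [integral_eq_lintegral_pos_part_sub_lintegral_neg_part hint,
    integral_eq_lintegral_pos_part_sub_lintegral_neg_part hQi]
  have p1 := hpos G hG hinv
  have p2 := hpos (fun x => -G x) hG.neg fun x hx k => by rw [hinv x hx k]
  simp only [mul_neg] at p2
  rw [p1, p2, ENNReal.toReal_mul, ENNReal.toReal_mul, ENNReal.toReal_ofReal hsα]
  ring

variable {H H' : (ℤ → E) → ℝ}

lemma card_Icc_int (n : ℕ) : ((Finset.Icc (1 : ℤ) n).card : ℝ) = n := by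
  rw [Int.card_Icc]; simp

/-- Sums over the positions of an exceedance in the block converge to the tail process. The
positions within `m` of the ends of the block contribute `O(p n)`, which is negligible with respect
to `r n * p n`. -/
lemma BlockLimit.eventually_sum_center (h : BlockLimit P Q α p r) (hN : SeqNorm N)
    (hT : TailSmall P p r N) {s : ℝ} (hs : 0 < s) (hm : Measurable H) {C : ℝ}
    (hC : ∀ x, |H x| ≤ C) (hH : ∀ᵐ y ∂Q, FinCont N H (s • y)) {δ : ℝ} (hδ : 0 < δ) :
    ∀ᶠ n in atTop, |∑ j ∈ Finset.Icc (1 : ℤ) (r n),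
        ∫ x in {x | s < ‖x 0‖}, H (trunc (1 - j) (r n - j) x) ∂(P n) -
      (s ^ (-α) * ∫ y, H (s • y) ∂Q) * (r n * p n)| ≤ δ * (r n * p n) := by
  set I := s ^ (-α) * ∫ y, H (s • y) ∂Q with hI
  have hδ4 : 0 < δ / 4 := by positivity
  have hC0 : 0 ≤ C := (abs_nonneg _).trans (hC 0)
  obtain ⟨m, hm1, hm2⟩ := ((h.eventually_localize hN hT hs hm hC hH hδ4).and
    (h.eventually_window hN hT hs hm hC hH hδ4)).exists
  set K := (2 * m : ℝ) * (C * (s ^ (-α) + 1) + |I|) with hK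
  have hr : ∀ᶠ n in atTop, K ≤ δ / 2 * r n := by
    have : Tendsto (fun n => δ / 2 * (r n : ℝ)) atTop atTop :=
      (tendsto_natCast_atTop_atTop.comp h.r_top).const_mul_atTop (by positivity)
    exact this.eventually_ge_atTop K
  filter_upwards [hm1, hm2, h.tail_le hs, h.p_pos, hr, h.r_top.eventually_ge_atTop (2 * m)]
    with n h1 h2 h3 hp hr hrm
  have := h.prob n
  set A : Set (ℤ → E) := {x | s < ‖x 0‖} with hA
  set f : ℤ → ℝ := fun j => ∫ x in A, H (trunc (1 - j) (r n - j) x) ∂(P n) with hf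
  set g : ℝ := ∫ x in A, H (window m x) ∂(P n) with hg
  have hint : ∀ a b : ℤ, IntegrableOn (fun x => H (trunc a b x)) A (P n) := fun a b =>
    (h.integrable_of_bound (hm.comp (measurable_trunc a b)) fun x => hC _).integrableOn
  have hfb : ∀ j, |f j| ≤ C * (s ^ (-α) + 1) * p n := fun j => by
    have := norm_setIntegral_le_of_norm_le_const (μ := P n) (s := A) (C := C)
      (f := fun x => H (trunc (1 - j) (r n - j) x)) (measure_lt_top _ _) fun x _ => hC _
    rw [Real.norm_eq_abs] at this
    rw [mul_assoc]
    exact this.trans (mul_le_mul_of_nonneg_left h3 hC0)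
  set J := Finset.Icc (1 + m : ℤ) (r n - m) with hJ
  have hJsub : J ⊆ Finset.Icc (1 : ℤ) (r n) := Finset.Icc_subset_Icc (by omega) (by omega)
  have hJcard : (J.card : ℝ) = r n - 2 * m := by
    rw [hJ, Int.card_Icc]
    have : (((r n : ℤ) - m + 1 - (1 + m)).toNat : ℤ) = r n - 2 * m := by omega
    exact_mod_cast this
  have hsd : ((Finset.Icc (1 : ℤ) (r n) \ J).card : ℝ) = 2 * m := by
    rw [Finset.card_sdiff_of_subset hJsub, Nat.cast_sub (Finset.card_le_card hJsub), card_Icc_int,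
      hJcard]
    ring
  rw [← Finset.sum_sdiff hJsub]
  have e1 : |∑ j ∈ Finset.Icc (1 : ℤ) (r n) \ J, f j| ≤ 2 * m * (C * (s ^ (-α) + 1) * p n) := by
    refine (Finset.abs_sum_le_sum_abs _ _).trans ((Finset.sum_le_sum fun j _ => hfb j).trans ?_)
    rw [Finset.sum_const, nsmul_eq_mul, hsd]
  have e2 : |∑ j ∈ J, f j - J.card * g| ≤ δ / 4 * (r n * p n) := by
    rw [← nsmul_eq_mul, ← Finset.sum_const, ← Finset.sum_sub_distrib]
    refine (Finset.abs_sum_le_sum_abs _ _).trans (le_trans (Finset.sum_le_sum fun j _ => ?_) h1)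
    rw [hf, hg, ← integral_sub (hint _ _) (hint _ _)]
    exact abs_integral_le_integral_abs
  have e3 : |J.card * g - J.card * (I * p n)| ≤ r n * (δ / 4 * p n) := by
    rw [← mul_sub, abs_mul, abs_of_nonneg (Nat.cast_nonneg _)]
    refine mul_le_mul ?_ h2 (abs_nonneg _) (Nat.cast_nonneg _)
    rw [hJcard]
    have : (0 : ℝ) ≤ m := m.cast_nonneg
    linarith
  have e4 : |J.card * (I * p n) - I * (r n * p n)| ≤ 2 * m * (|I| * p n) := by
    rw [hJcard, show ((r n : ℝ) - 2 * m) * (I * p n) - I * (r n * p n) = -(2 * m * (I * p n)) by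
      ring, abs_neg, abs_mul (2 * (m : ℝ)), abs_mul I, abs_of_pos hp,
      abs_of_nonneg (show (0 : ℝ) ≤ 2 * m by positivity)]
  have e5 : K * p n ≤ δ / 2 * r n * p n := mul_le_mul_of_nonneg_right hr hp.le
  have e6 : K * p n = 2 * m * (C * (s ^ (-α) + 1) * p n) + 2 * m * (|I| * p n) := by
    rw [hK]; ring
  have tri : |∑ j ∈ Finset.Icc (1 : ℤ) (r n) \ J, f j + ∑ j ∈ J, f j - I * (r n * p n)| ≤
      |∑ j ∈ Finset.Icc (1 : ℤ) (r n) \ J, f j| + |∑ j ∈ J, f j - J.card * g| +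
      |J.card * g - J.card * (I * p n)| + |J.card * (I * p n) - I * (r n * p n)| := by
    have : ∑ j ∈ Finset.Icc (1 : ℤ) (r n) \ J, f j + ∑ j ∈ J, f j - I * (r n * p n) =
      ∑ j ∈ Finset.Icc (1 : ℤ) (r n) \ J, f j + (∑ j ∈ J, f j - J.card * g) +
      (J.card * g - J.card * (I * p n)) + (J.card * (I * p n) - I * (r n * p n)) := by ring
    rw [this]
    exact (abs_add_le _ _).trans (add_le_add_left ((abs_add_le _ _).trans
      (add_le_add_left (abs_add_le _ _) _)) _)
  linarith

/-- The expected contribution of a single block is of order `r_n p_n`. -/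
lemma Admissible.integral_abs_le (h : BlockLimit P Q α p r) (hH : Admissible P Q p r N S H) :
    ∃ K : ℝ, 0 < K ∧ ∀ᶠ n in atTop, ∫ x, |H (trunc 1 (r n) x)| ∂(P n) ≤ K * (r n * p n) := by
  obtain ⟨C, hC⟩ := hH.bounded
  have hC0 : 0 ≤ C := (abs_nonneg _).trans (hC 0)
  obtain ⟨s, hsm, hs⟩ := ((hH.small 1 one_pos).and self_mem_nhdsWithin).exists
  have hs0 : 0 < 2 * s := mul_pos two_pos hs
  refine ⟨1 + C * ((2 * s) ^ (-α) + 1), by positivity, ?_⟩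
  filter_upwards [hsm, h.tail_le hs0, h.p_pos] with n h1 h2 hp
  have := h.prob n
  set B : Set (ℤ → E) := {x | ∀ j ∈ Finset.Icc (1 : ℤ) (r n), ‖x j‖ ≤ 2 * s} with hB
  have hBm : MeasurableSet B := by
    have : B = ⋂ j ∈ Finset.Icc (1 : ℤ) (r n), {x : ℤ → E | ‖x j‖ ≤ 2 * s} := by
      ext x; simp [hB]
    rw [this]
    exact Finset.measurableSet_biInter _ fun j _ =>
      measurableSet_le (measurable_norm_apply j) measurable_const
  have hint : Integrable (fun x => |H (trunc 1 (r n) x)|) (P n) :=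
    h.integrable_of_bound ((hH.measurable.comp (measurable_trunc _ _)).abs) (C := C) fun x => by
      rw [abs_abs]; exact hC _
  rw [← integral_add_compl hBm hint, add_mul, one_mul]
  refine add_le_add (by simpa using h1) ?_
  have h3 : (P n).real Bᶜ ≤ r n * (((2 * s) ^ (-α) + 1) * p n) := by
    have hsub : Bᶜ ⊆ ⋃ j ∈ Finset.Icc (1 : ℤ) (r n), {x : ℤ → E | 2 * s < ‖x j‖} := by
      intro x hx
      simp only [hB, Set.mem_compl_iff, Set.mem_ofPred_eq] at hx
      push Not at hx
      obtain ⟨j, hj, hlt⟩ := hx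
      exact Set.mem_biUnion hj hlt
    refine (measureReal_mono hsub (measure_ne_top _ _)).trans
      ((measureReal_biUnion_finset_le _ _).trans ?_)
    refine (Finset.sum_le_sum (g := fun _ => ((2 * s) ^ (-α) + 1) * p n) fun j _ => ?_).trans ?_
    · rw [h.real_exceed]; exact h2
    · rw [Finset.sum_const, nsmul_eq_mul, card_Icc_int]
  have h4 := norm_setIntegral_le_of_norm_le_const (μ := P n) (s := Bᶜ) (C := C)
    (f := fun x => |H (trunc 1 (r n) x)|) (measure_lt_top _ _) fun x _ => by
      rw [Real.norm_eq_abs, abs_abs]; exact hC _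
  rw [Real.norm_eq_abs] at h4
  refine (le_abs_self _).trans (h4.trans ?_)
  calc C * (P n).real Bᶜ ≤ C * (r n * (((2 * s) ^ (-α) + 1) * p n)) :=
        mul_le_mul_of_nonneg_left h3 hC0
    _ = _ := by ring

/-- The contribution of a single exceedance inherits the almost sure continuity of the functional.
-/
lemma Admissible.finCont_single (hN : SeqNorm N) (hS : SeqSpace Q S)
    {C : ℝ} (hC : ∀ x, |H x| ≤ C) {s : ℝ} (hs : 0 < s)
    (hfc : ∀ᵐ y ∂Q, FinCont N H (s • y)) :
    ∀ᵐ y ∂Q, FinCont N (fun x => bump s ‖x 0‖ * (damp s x * H x)) (s • y) := by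
  filter_upwards [hfc, hS.ae_mem] with y hy hyS
  refine FinCont.mul (C := 1) (C' := 1 * C) (fun x => ?_) (fun x => ?_) (finCont_bump hN hs _)
    (FinCont.mul (abs_damp_le_one s) hC (finCont_damp hN hs (hS.subset (hyS s hs))) hy)
  · rw [abs_of_nonneg (bump_nonneg _ _)]; exact bump_le_one _ _
  · rw [abs_mul]
    exact mul_le_mul (abs_damp_le_one s x) (hC x) (abs_nonneg _) zero_le_one

lemma abs_single_le {C : ℝ} (hC : ∀ x, |H x| ≤ C) (s t : ℝ) (x : ℤ → E) :
    |bump s t * (damp s x * H x)| ≤ C := by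
  rw [abs_mul, abs_mul, abs_of_nonneg (bump_nonneg _ _), ← mul_assoc]
  refine (mul_le_of_le_one_left (abs_nonneg _) ?_).trans (hC x)
  exact mul_le_one₀ (bump_le_one _ _) (abs_nonneg _) (abs_damp_le_one s x)

lemma measurable_single (hm : Measurable H) (s : ℝ) :
    Measurable fun x : ℤ → E => bump s ‖x 0‖ * (damp s x * H x) :=
  ((continuous_bump s).measurable.comp (measurable_norm_apply 0)).mul
    ((measurable_damp s).mul hm)

/-- The contribution of the exceedances of level `s` to a cluster index. -/
lemma BlockLimit.integral_anchored_bump (h : BlockLimit P Q α p r) (hS : SeqSpace Q S)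
    (hm : Measurable H) {C : ℝ} (hC : ∀ x, |H x| ≤ C)
    (hinv : ∀ x ∈ S, ∀ k, H (shift k x) = H x) {s : ℝ} (hs : 0 < s) :
    Integrable (fun x => smoothCount s x * (damp s x * H x)) (anchored Q α) ∧
    ∫ x, smoothCount s x * (damp s x * H x) ∂(anchored Q α) =
      s ^ (-α) * ∫ y, bump s ‖(s • y) 0‖ * (damp s (s • y) * H (s • y)) ∂Q :=
  h.integral_anchored hS hs (w := fun z => bump s ‖z‖)
    ((continuous_bump s).measurable.comp measurable_norm) (fun _ => bump_nonneg _ _)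
    (fun _ => bump_le_one _ _) (fun _ hz => bump_eq_zero hs hz)
    ((measurable_damp s).mul hm) (C := C) (fun x => by
      rw [abs_mul]
      exact (mul_le_of_le_one_left (abs_nonneg _) (abs_damp_le_one s x)).trans (hC x))
    (fun x hx k => by rw [damp_shift, hinv x hx k])

/-- Moving the exceedance at time `j` of a block to the origin. -/
lemma BlockLimit.integral_center (h : BlockLimit P Q α p r) (n : ℕ) (s : ℝ) (hs : 0 < s)
    {G : (ℤ → E) → ℝ} (hG : ∀ x, (Function.support x).Finite → ∀ k, G (shift k x) = G x)
    {j : ℤ} (hj : j ∈ Finset.Icc (1 : ℤ) (r n)) :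
    ∫ x in {x | s < ‖x 0‖}, bump s ‖trunc (1 - j) (r n - j) x 0‖ * G (trunc (1 - j) (r n - j) x)
      ∂(P n) = ∫ x, bump s ‖x j‖ * G (trunc 1 (r n) x) ∂(P n) := by
  rw [Finset.mem_Icc] at hj
  rw [setIntegral_eq_integral_of_forall_compl_eq_zero, ← h.integral_shift n j]
  · refine integral_congr_ae (Eventually.of_forall fun x => ?_)
    have e : trunc (1 - j) (r n - j) (shift j x) = shift j (trunc 1 (r n) x) := by
      rw [shift_trunc]
    simp only
    rw [e, hG _ (trunc_support_finite _ _ _), shift_apply, zero_add, trunc_apply, if_pos hj]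
  · intro x hx
    have : ‖trunc (1 - j) (r n - j) x 0‖ ≤ s := (norm_trunc_le _ _ _ _).trans (not_lt.1 hx)
    rw [bump_eq_zero hs this, zero_mul]

/-- Admissible functionals are integrable with respect to the cluster measure: the part of `|H|` due
to exceedances of the level `s` is a limit of normalised moments of blocks, hence bounded uniformly
in `s`, and Fatou's lemma applies as `s → 0`. -/
lemma Admissible.integrable (hN : SeqNorm N) (hT : TailSmall P p r N) (hS : SeqSpace Q S)
    (h : BlockLimit P Q α p r) (hH : Admissible P Q p r N S H) :
    Integrable H (anchored Q α) := by
  have := h.probQ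
  obtain ⟨C, hC⟩ := hH.bounded
  have hCa : ∀ x, |(fun x => |H x|) x| ≤ C := fun x => by rw [abs_abs]; exact hC x
  obtain ⟨K, hK, hKn⟩ := hH.integral_abs_le h
  have hinv : ∀ x ∈ S, ∀ k, |H (shift k x)| = |H x| := fun x hx k => by
    rw [hH.shift_inv x hx k]
  have hbound : ∀ s : ℝ, 0 < s →
      ∫ x, smoothCount s x * (damp s x * |H x|) ∂(anchored Q α) ≤ K := by
    intro s hs
    rw [(h.integral_anchored_bump hS hH.measurable.abs hCa hinv hs).2]
    refine le_of_forall_pos_le_add fun δ hδ => ?_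
    have hc := h.eventually_sum_center hN hT hs (measurable_single hH.measurable.abs s)
      (fun x => abs_single_le hCa s ‖x 0‖ x) (Admissible.finCont_single hN hS hCa hs
        ((hH.finCont s hs).mono fun y hy => hy.abs)) hδ
    obtain ⟨n, h1, h2, hp, hr⟩ := (hc.and (hKn.and (h.p_pos.and
      (h.r_top.eventually_gt_atTop 0)))).exists
    have := h.prob n
    have hrp : 0 < r n * p n := mul_pos (by exact_mod_cast hr) hp
    have hsum : ∑ j ∈ Finset.Icc (1 : ℤ) (r n), ∫ x in {x | s < ‖x 0‖},
        bump s ‖trunc (1 - j) (r n - j) x 0‖ *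
          (damp s (trunc (1 - j) (r n - j) x) * |H (trunc (1 - j) (r n - j) x)|) ∂(P n) ≤
        K * (r n * p n) := by
      refine le_trans ?_ h2
      rw [Finset.sum_congr rfl fun j hj => h.integral_center n s hs
        (G := fun x => damp s x * |H x|) (fun x hx k => by
          rw [damp_shift, hinv x (hS.mem_of_support x hx)]) hj,
        ← integral_finsetSum]
      · refine integral_mono (integrable_finsetSum _ fun j _ => ?_) ?_ fun x => ?_
        · refine h.integrable_of_bound (C := C) ?_ fun x => ?_
          · exact ((continuous_bump s).measurable.comp (measurable_norm_apply j)).mul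
              (((measurable_damp s).mul hH.measurable.abs).comp (measurable_trunc _ _))
          · exact abs_single_le hCa s ‖x j‖ (trunc 1 (r n) x)
        · exact h.integrable_of_bound ((hH.measurable.comp (measurable_trunc _ _)).abs) (C := C)
            fun x => by rw [abs_abs]; exact hC _
        · simp only
          rw [← Finset.sum_mul, ← smoothCount_trunc hs, ← mul_assoc]
          exact mul_le_of_le_one_left (abs_nonneg _) (smoothCount_mul_damp_le _ _)
      · intro j _
        refine h.integrable_of_bound (C := C) ?_ fun x => ?_
        · exact ((continuous_bump s).measurable.comp (measurable_norm_apply j)).mul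
            (((measurable_damp s).mul hH.measurable.abs).comp (measurable_trunc _ _))
        · exact abs_single_le hCa s ‖x j‖ (trunc 1 (r n) x)
    have h3 := (abs_le.1 h1).1
    have h4 : (s ^ (-α) * ∫ y, bump s ‖(s • y) 0‖ * (damp s (s • y) * |H (s • y)|) ∂Q) *
        (r n * p n) ≤ (K + δ) * (r n * p n) := by linarith
    exact le_of_mul_le_mul_right h4 hrp
  refine ⟨hH.measurable.aestronglyMeasurable, ?_⟩
  rw [hasFiniteIntegral_iff_enorm]
  set sq : ℕ → ℝ := fun k => 1 / ((k : ℝ) + 1) with hsq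
  have hsq0 : ∀ k, 0 < sq k := fun k => by simp only [hsq]; positivity
  set F : ℕ → (ℤ → E) → ℝ≥0∞ := fun k x =>
    ENNReal.ofReal (smoothCount (sq k) x * (damp (sq k) x * |H x|)) with hF
  have hFm : ∀ k, Measurable (F k) := fun k =>
    ((measurable_smoothCount _).mul ((measurable_damp _).mul hH.measurable.abs)).ennreal_ofReal
  have hlim : ∀ᵐ x ∂(anchored Q α), ‖H x‖ₑ ≤ liminf (fun k => F k x) atTop := by
    filter_upwards [ae_restrict_of_ae (h.ae_mem hS), ae_restrict_of_ae h.ae_ne_zero] with x hx hx0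
    refine le_of_eq (Tendsto.liminf_eq ?_).symm
    refine tendsto_const_nhds.congr' ?_
    obtain ⟨k0, hk0⟩ := exists_nat_one_div_lt (half_pos (norm_pos_iff.2 hx0))
    filter_upwards [eventually_ge_atTop k0] with k hk
    have : sq k ≤ 1 / ((k0 : ℝ) + 1) :=
      one_div_le_one_div_of_le (by positivity) (by exact_mod_cast Nat.succ_le_succ hk)
    rw [hF]
    simp only
    rw [← mul_assoc, smoothCount_mul_damp_eq_one (hsq0 k) (hS.subset hx) (j := 0) (by linarith),
      one_mul, Real.enorm_eq_ofReal_abs]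
  refine lt_of_le_of_lt ((lintegral_mono_ae hlim).trans (lintegral_liminf_le hFm)) ?_
  refine lt_of_le_of_lt (liminf_le_of_frequently_le' (x := ENNReal.ofReal K)
    (Frequently.of_forall fun k => ?_)) ENNReal.ofReal_lt_top
  have hi := h.integral_anchored_bump hS hH.measurable.abs hCa hinv (hsq0 k)
  rw [hF]
  simp only
  rw [← ofReal_integral_eq_lintegral_ofReal hi.1]
  · exact ENNReal.ofReal_le_ofReal (hbound _ (hsq0 k))
  · exact Eventually.of_forall fun x => mul_nonneg (smoothCount_nonneg _ _)
      (mul_nonneg (damp_nonneg _ _) (abs_nonneg _))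

/-- The exceedances of small levels exhaust a cluster index. -/
lemma BlockLimit.eventually_bump_close (h : BlockLimit P Q α p r) (hS : SeqSpace Q S)
    (hm : Measurable H) (hi : Integrable H (anchored Q α)) {C : ℝ} (hC : ∀ x, |H x| ≤ C)
    (hinv : ∀ x ∈ S, ∀ k, H (shift k x) = H x) {δ : ℝ} (hδ : 0 < δ) :
    ∀ᶠ s in 𝓝[>] (0 : ℝ),
      |s ^ (-α) * ∫ y, bump s ‖(s • y) 0‖ * (damp s (s • y) * H (s • y)) ∂Q -
        ∫ x, H x ∂(anchored Q α)| ≤ δ := by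
  have T : Tendsto (fun s : ℝ => ∫ x, smoothCount s x * (damp s x * H x) ∂(anchored Q α))
      (𝓝[>] (0 : ℝ)) (𝓝 (∫ x, H x ∂(anchored Q α))) := by
    refine tendsto_integral_filter_of_dominated_convergence (fun x => |H x|)
      (Eventually.of_forall fun s => ((measurable_smoothCount _).mul
        ((measurable_damp _).mul hm)).aestronglyMeasurable)
      (Eventually.of_forall fun s => Eventually.of_forall fun x => ?_) hi.abs ?_
    · rw [← mul_assoc, Real.norm_eq_abs, abs_mul, abs_of_nonneg (smoothCount_mul_damp_nonneg _ _)]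
      exact mul_le_of_le_one_left (abs_nonneg _) (smoothCount_mul_damp_le _ _)
    · filter_upwards [ae_restrict_of_ae (h.ae_mem hS), ae_restrict_of_ae h.ae_ne_zero]
        with x hx hx0
      refine tendsto_const_nhds.congr' ?_
      have : ∀ᶠ s in 𝓝[>] (0 : ℝ), s < ‖x 0‖ / 2 :=
        nhdsWithin_le_nhds (eventually_lt_nhds (half_pos (norm_pos_iff.2 hx0)))
      filter_upwards [this, self_mem_nhdsWithin] with s hs hs0
      rw [← mul_assoc, smoothCount_mul_damp_eq_one hs0 (hS.subset hx) (j := 0) (by linarith),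
        one_mul]
  have := (Metric.tendsto_nhds.1 T) δ hδ
  filter_upwards [this, self_mem_nhdsWithin] with s hs hs0
  rw [← (h.integral_anchored_bump hS hm hC hinv hs0).2]
  exact hs.le

end cluster

/-! ### Overlapping blocks -/

/-- Weak dependence on path space: the covariance of bounded functions of the past and of the
future, separated by a gap `k`, is controlled by a rate `b k` whose sum beyond `ℓ n` is negligible
with respect to `r n * p n`. -/
structure WeakDep {E : Type*} [NormedAddCommGroup E] [MeasurableSpace E]
    (P : ℕ → Measure (ℤ → E)) (p : ℕ → ℝ) (r ℓ : ℕ → ℕ) (b : ℕ → ℝ) : Prop where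
  nonneg : ∀ k, 0 ≤ b k
  antitone : Antitone b
  cov_le : ∀ n (k : ℕ) (a c d : ℤ) (f g : (ℤ → E) → ℝ) (C C' : ℝ), Measurable f → Measurable g →
    (∀ x, |f x| ≤ C) → (∀ x, |g x| ≤ C') →
    |∫ x, f (trunc a c x) * g (trunc (c + k) d x) ∂(P n) -
      (∫ x, f (trunc a c x) ∂(P n)) * ∫ x, g (trunc (c + k) d x) ∂(P n)| ≤ 4 * C * C' * b k
  sum_le : ∀ δ : ℝ, 0 < δ → ∀ᶠ n in atTop, ∀ M : ℕ,
    ∑ k ∈ Finset.range M, b (ℓ n + k) ≤ δ * (r n * p n)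
  gap_le : ∀ δ : ℝ, 0 < δ → ∀ᶠ n in atTop, (ℓ n : ℝ) ≤ δ * r n

section overlap

variable {E : Type*} [NormedAddCommGroup E] [NormedSpace ℝ E] [MeasurableSpace E] [BorelSpace E]
  [SecondCountableTopology E]
variable {P : ℕ → Measure (ℤ → E)} {Q : Measure (ℤ → E)} {α : ℝ} {p : ℕ → ℝ} {r ℓ : ℕ → ℕ}
  {b : ℕ → ℝ}
variable {N : (ℤ → E) → ℝ≥0∞} {S : Set (ℤ → E)} {H H' : (ℤ → E) → ℝ}

/-- Since the rate is nonincreasing, its value at the block length is `o(p_n)`. -/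
lemma WeakDep.rate_le (hD : WeakDep P p r ℓ b) (h : BlockLimit P Q α p r) {δ : ℝ} (hδ : 0 < δ) :
    ∀ᶠ n in atTop, b (r n) ≤ δ * p n := by
  filter_upwards [hD.sum_le (δ / 2) (half_pos hδ), hD.gap_le (1 / 2) (by norm_num),
    h.r_top.eventually_gt_atTop 0] with n h1 h2 hr
  have hr0 : (0 : ℝ) < r n := by exact_mod_cast hr
  have hle : ℓ n ≤ r n := by
    have : (ℓ n : ℝ) ≤ r n := by linarith
    exact_mod_cast this
  have h3 := h1 (r n - ℓ n)
  have h4 : ((r n - ℓ n : ℕ) : ℝ) * b (r n) ≤ ∑ k ∈ Finset.range (r n - ℓ n), b (ℓ n + k) := by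
    have := Finset.card_nsmul_le_sum (Finset.range (r n - ℓ n)) (fun k => b (ℓ n + k)) (b (r n))
      fun k hk => hD.antitone (by have := Finset.mem_range.1 hk; omega)
    rwa [Finset.card_range, nsmul_eq_mul] at this
  rw [Nat.cast_sub hle] at h4
  have h5 : (r n : ℝ) / 2 * b (r n) ≤ (r n - ℓ n : ℝ) * b (r n) :=
    mul_le_mul_of_nonneg_right (by linarith) (hD.nonneg _)
  have h6 : (r n : ℝ) / 2 * b (r n) ≤ (r n : ℝ) / 2 * (δ * p n) := by linarith
  exact le_of_mul_le_mul_left h6 (by positivity)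

lemma measurableSet_quiet (I : Finset ℤ) (s : ℝ) :
    MeasurableSet {x : ℤ → E | ∀ j ∈ I, ‖x j‖ ≤ s} := by
  have : {x : ℤ → E | ∀ j ∈ I, ‖x j‖ ≤ s} = ⋂ j ∈ I, {x : ℤ → E | ‖x j‖ ≤ s} := by
    ext x; simp
  rw [this]
  exact Finset.measurableSet_biInter _ fun j _ =>
    measurableSet_le (measurable_norm_apply j) measurable_const

lemma SeqSpace.apply_trunc_shift (hS : SeqSpace Q S) (hinv : ∀ x ∈ S, ∀ k, H (shift k x) = H x)
    (a c k : ℤ) (x : ℤ → E) : H (trunc a c (shift k x)) = H (trunc (a + k) (c + k) x) := by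
  rw [← hinv (trunc (a + k) (c + k) x) (hS.mem_of_support _ (trunc_support_finite _ _ _)) k,
    shift_trunc, add_sub_cancel_right, add_sub_cancel_right]

lemma Admissible.integral_quiet_shift (hS : SeqSpace Q S) (h : BlockLimit P Q α p r)
    (hH : Admissible P Q p r N S H) (n : ℕ) (k : ℤ) (s : ℝ) :
    ∫ x in {x | ∀ j ∈ Finset.Icc (1 + k) (r n + k), ‖x j‖ ≤ s},
      |H (trunc (1 + k) (r n + k) x)| ∂(P n) =
    ∫ x in {x | ∀ j ∈ Finset.Icc (1 : ℤ) (r n), ‖x j‖ ≤ s}, |H (trunc 1 (r n) x)| ∂(P n) := by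
  rw [← h.setIntegral_shift n k _ fun x => |H (trunc 1 (r n) x)|]
  simp_rw [hS.apply_trunc_shift hH.shift_inv]
  congr 2
  ext x
  simp only [Set.mem_preimage, Set.mem_ofPred_eq, shift_apply, Finset.mem_Icc]
  constructor
  · intro hx j hj; exact hx (j + k) ⟨by omega, by omega⟩
  · intro hx j hj
    have := hx (j - k) ⟨by omega, by omega⟩
    simpa using this

lemma Admissible.integral_shift (hS : SeqSpace Q S) (h : BlockLimit P Q α p r)
    (hH : Admissible P Q p r N S H) (n : ℕ) (k : ℤ) :
    ∫ x, H (trunc (1 + k) (r n + k) x) ∂(P n) = ∫ x, H (trunc 1 (r n) x) ∂(P n) := by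
  rw [← h.integral_shift n k fun x => H (trunc 1 (r n) x)]
  simp_rw [hS.apply_trunc_shift hH.shift_inv]

/-- An exceedance at a time `l`, at distance at least `m` before a block of length `r n`, makes an
exceedance in that block unlikely: at distances up to `r n` by anticlustering, at larger distances
by weak dependence. -/
lemma WeakDep.exceed_block_le (hD : WeakDep P p r ℓ b) (h : BlockLimit P Q α p r) {s η δ : ℝ}
    (hs : 0 < s) (hη : 0 < η) (hδ : 0 < δ) :
    ∀ᶠ m : ℕ in atTop, ∀ᶠ n in atTop, ∀ k l : ℤ, l + m ≤ k →
      (P n).real {x | s < ‖x l‖ ∧ ∃ i, i ∈ Finset.Icc (1 + k) (r n + k) ∧ η < ‖x i‖} ≤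
        δ * p n := by
  have hδ3 : 0 < δ / 3 := by positivity
  have hK : 0 < (s ^ (-α) + 1) * (η ^ (-α) + 1) := by positivity
  filter_upwards [h.anticluster s η (δ / 3) hs hη hδ3] with m hm
  have hrp : ∀ᶠ n in atTop, r n * p n ≤ δ / 3 / ((s ^ (-α) + 1) * (η ^ (-α) + 1)) :=
    (h.rp_zero.eventually_le_const (by positivity))
  filter_upwards [hm, h.tail_le hs, h.tail_le hη, hD.rate_le h (δ := δ / 12) (by positivity),
    h.p_pos, hrp] with n h1 h2 h3 h4 hp h5 k l hl
  have := h.prob n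
  set B : Set (ℤ → E) :=
    {x | ∃ i, i ∈ Finset.Icc (max (1 + k) (l + r n)) (r n + k) ∧ η < ‖x i‖} with hB
  set A : Set (ℤ → E) := {x | s < ‖x l‖} with hA
  have hsub : {x : ℤ → E | s < ‖x l‖ ∧ ∃ i, i ∈ Finset.Icc (1 + k) (r n + k) ∧ η < ‖x i‖} ⊆
      {x | s < ‖x l‖ ∧ shift l x ∈ {x | ∃ i : ℤ, (m : ℤ) ≤ |i| ∧ |i| ≤ r n ∧ η < ‖x i‖}} ∪
        A ∩ B := by
    rintro x ⟨hx, i, hi, hxi⟩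
    rw [Finset.mem_Icc] at hi
    -- up to distance `r n` anticlustering applies, beyond it the gap is at least `r n`
    by_cases hil : i ≤ l + r n
    · refine Or.inl ⟨hx, i - l, le_abs.2 (Or.inl (by omega)), abs_le.2 ⟨by omega, by omega⟩, ?_⟩
      simpa [shift_apply] using hxi
    · exact Or.inr ⟨hx, i, Finset.mem_Icc.2 ⟨max_le hi.1 (by omega), hi.2⟩, hxi⟩
  have hAm : MeasurableSet A := measurableSet_exceed s l
  have hBm : MeasurableSet B := measurableSet_far _ _
  refine (measureReal_mono hsub (measure_ne_top _ _)).trans ((measureReal_union_le _ _).trans ?_)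
  rw [h.real_exceed_inter]
  have hAB : (P n).real (A ∩ B) ≤ (P n).real A * (P n).real B + 4 * 1 * 1 * b (r n) := by
    have h6 := hD.cov_le n (r n) l l (r n + k) (A.indicator 1) (B.indicator 1) 1 1
      (measurable_const.indicator hAm) (measurable_const.indicator hBm)
      (fun x => by by_cases hx : x ∈ A <;> simp [hx])
      (fun x => by by_cases hx : x ∈ B <;> simp [hx])
    have e1 : ∀ x : ℤ → E, A.indicator (1 : (ℤ → E) → ℝ) (trunc l l x) = A.indicator 1 x := by
      intro x
      have : trunc l l x ∈ A ↔ x ∈ A := by simp [hA, trunc_apply]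
      simp only [Set.indicator_apply, this, Pi.one_apply]
    have e2 : ∀ x : ℤ → E, B.indicator (1 : (ℤ → E) → ℝ) (trunc (l + r n) (r n + k) x) =
        B.indicator 1 x := by
      intro x
      have : trunc (l + r n) (r n + k) x ∈ B ↔ x ∈ B := by
        simp only [hB, Set.mem_ofPred_eq]
        refine exists_congr fun i => and_congr_right fun hi => ?_
        rw [Finset.mem_Icc, max_le_iff] at hi
        rw [trunc_apply, if_pos ⟨hi.1.2, hi.2⟩]
      simp only [Set.indicator_apply, this, Pi.one_apply]
    simp_rw [e1, e2] at h6
    have e3 : ∀ x : ℤ → E, A.indicator (1 : (ℤ → E) → ℝ) x * B.indicator 1 x =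
        (A ∩ B).indicator 1 x := fun x => by
      rw [Set.inter_indicator_one]; rfl
    simp_rw [e3] at h6
    rw [integral_indicator_one hAm, integral_indicator_one hBm,
      integral_indicator_one (hAm.inter hBm)] at h6
    linarith [(abs_le.1 h6).2]
  have hB1 : (P n).real B ≤ r n * ((η ^ (-α) + 1) * p n) := by
    have hsub : B ⊆ ⋃ i ∈ Finset.Icc (1 + k) (r n + k), {x : ℤ → E | η < ‖x i‖} := by
      rintro x ⟨i, hi, hx⟩
      rw [Finset.mem_Icc, max_le_iff] at hi
      exact Set.mem_biUnion (Finset.mem_coe.2 (Finset.mem_Icc.2 ⟨hi.1.1, hi.2⟩)) hx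
    refine (measureReal_mono hsub (measure_ne_top _ _)).trans
      ((measureReal_biUnion_finset_le _ _).trans ?_)
    simp_rw [h.real_exceed]
    rw [Finset.sum_const, Int.card_Icc, nsmul_eq_mul]
    have : ((r n + k + 1 - (1 + k) : ℤ).toNat : ℝ) = r n := by
      rw [show (r n + k + 1 - (1 + k) : ℤ) = r n by ring]; simp
    rw [this]
    exact mul_le_mul_of_nonneg_left h3 (Nat.cast_nonneg _)
  have h7 : (P n).real A * (P n).real B ≤ δ / 3 * p n := by
    rw [hA, h.real_exceed]
    refine (mul_le_mul h2 hB1 measureReal_nonneg (by positivity)).trans ?_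
    rw [le_div_iff₀ hK] at h5
    calc (s ^ (-α) + 1) * p n * (r n * ((η ^ (-α) + 1) * p n))
        = r n * p n * ((s ^ (-α) + 1) * (η ^ (-α) + 1)) * p n := by ring
      _ ≤ δ / 3 * p n := mul_le_mul_of_nonneg_right h5 hp.le
  have h8 : (P n).real {x | s < ‖x 0‖ ∧
      x ∈ {x : ℤ → E | ∃ i : ℤ, (m : ℤ) ≤ |i| ∧ |i| ≤ r n ∧ η < ‖x i‖}} ≤ δ / 3 * p n := h1
  linarith

/-- The exceedances of a first block which precede the second block by at least `m` do not
contribute to the joint moment of the two blocks: either the second block is free of large values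
and its functional is negligible, or it has an exceedance, which is unlikely. -/
lemma Admissible.sum_exceed_block_le (hS : SeqSpace Q S) (h : BlockLimit P Q α p r)
    (hD : WeakDep P p r ℓ b) (hH : Admissible P Q p r N S H) {s δ : ℝ} (hs : 0 < s) (hδ : 0 < δ) :
    ∀ᶠ m : ℕ in atTop, ∀ᶠ n in atTop, ∀ k : ℤ, k ≤ r n →
      ∑ l ∈ Finset.Icc 1 (k - m), ∫ x in {x | s < ‖x l‖}, |H (trunc (1 + k) (r n + k) x)| ∂(P n) ≤
        δ * (r n * p n) := by
  obtain ⟨C, hC⟩ := hH.bounded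
  have hC0 : 0 ≤ C := (abs_nonneg _).trans (hC 0)
  set e := δ / (2 * C + 1) with he
  have he0 : 0 < e := by positivity
  obtain ⟨K, hK⟩ := (h.sum_exceed_le hs he0).exists
  obtain ⟨s', hs', hs'0⟩ := ((hH.small (e / (2 * K + 1)) (by positivity)).and
    self_mem_nhdsWithin).exists
  have hs'1 : 0 < 2 * s' := mul_pos two_pos hs'0
  filter_upwards [hD.exceed_block_le h hs hs'1 he0] with m hm
  filter_upwards [hm, hK, hs', h.p_pos] with n h1 h2 h3 hp k hk
  have := h.prob n
  set I := Finset.Icc (1 + k) (r n + k) with hI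
  set B : Set (ℤ → E) := {x | ∀ j ∈ I, ‖x j‖ ≤ 2 * s'} with hB
  have hBm : MeasurableSet B := measurableSet_quiet _ _
  set f : (ℤ → E) → ℝ := fun x => |H (trunc (1 + k) (r n + k) x)| with hf
  have hfm : Measurable f := (hH.measurable.comp (measurable_trunc _ _)).abs
  have hfC : ∀ x, |f x| ≤ C := fun x => by rw [hf]; simp only [abs_abs]; exact hC _
  have hfi : ∀ A : Set (ℤ → E), IntegrableOn f A (P n) := fun A =>
    (h.integrable_of_bound hfm hfC).integrableOn
  have hsub : Finset.Icc 1 (k - m) ⊆ Finset.Icc (1 : ℤ) (r n) :=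
    Finset.Icc_subset_Icc_right (by omega)
  have hcard : ((Finset.Icc 1 (k - m)).card : ℝ) ≤ r n := by
    rw [← card_Icc_int (r n)]
    exact_mod_cast Finset.card_le_card hsub
  -- `B` is the event that the second block has no large value
  have hsplit : ∀ l ∈ Finset.Icc 1 (k - m), ∫ x in {x | s < ‖x l‖}, f x ∂(P n) ≤
      ∫ x in {x | s < ‖x l‖}, B.indicator f x ∂(P n) + C * (e * p n) := by
    intro l hl
    rw [Finset.mem_Icc] at hl
    rw [setIntegral_indicator hBm, ← integral_inter_add_sdiff hBm (hfi _)]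
    refine (add_le_add_iff_left _).2 ?_
    have h4 := norm_setIntegral_le_of_norm_le_const (μ := P n) (s := {x | s < ‖x l‖} \ B) (C := C)
      (f := f) (measure_lt_top _ _) fun x _ => hfC x
    refine (le_abs_self _).trans (h4.trans (mul_le_mul_of_nonneg_left ?_ hC0))
    refine le_trans (measureReal_mono ?_ (measure_ne_top _ _)) (h1 k l (by omega))
    rintro x ⟨hx, hxB⟩
    refine ⟨hx, ?_⟩
    simp only [hB, Set.mem_ofPred_eq] at hxB
    push Not at hxB
    exact hxB
  refine (Finset.sum_le_sum hsplit).trans ?_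
  rw [Finset.sum_add_distrib, Finset.sum_const, nsmul_eq_mul]
  have hg0 : ∀ x, 0 ≤ B.indicator f x := fun x => Set.indicator_nonneg (fun _ _ => abs_nonneg _) x
  have h5 := h2 (B.indicator f) C (hfm.indicator hBm) hg0 fun x => by
    by_cases hx : x ∈ B
    · rw [Set.indicator_of_mem hx]; exact (le_abs_self _).trans (hfC x)
    · rw [Set.indicator_of_notMem hx]; exact hC0
  have h6 : ∫ x, B.indicator f x ∂(P n) ≤ e / (2 * K + 1) * (r n * p n) := by
    rw [integral_indicator hBm]
    refine le_trans (le_of_eq ?_) h3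
    exact hH.integral_quiet_shift hS h n k (2 * s')
  have h7 := Finset.sum_le_sum_of_subset_of_nonneg hsub (f := fun l =>
    ∫ x in {x | s < ‖x l‖}, B.indicator f x ∂(P n)) fun l _ _ => integral_nonneg hg0
  have h8 : (2 * K + 1) * ∫ x, B.indicator f x ∂(P n) ≤
      (2 * K + 1) * (e / (2 * K + 1) * (r n * p n)) :=
    mul_le_mul_of_nonneg_left h6 (by positivity)
  have h9 : (2 * K + 1) * (e / (2 * K + 1) * (r n * p n)) = e * (r n * p n) := by field_simp
  have h10 : (Finset.Icc 1 (k - m)).card * (C * (e * p n)) ≤ r n * (C * (e * p n)) :=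
    mul_le_mul_of_nonneg_right hcard (by positivity)
  have h11 : δ * (r n * p n) = e * (r n * p n) + C * (e * (r n * p n)) + r n * (C * (e * p n)) := by
    rw [he]; field_simp; ring
  linarith

/-- The contribution of an exceedance at time `l` to the joint moment of two blocks, seen from
that exceedance. -/
lemma BlockLimit.integral_center_two (h : BlockLimit P Q α p r) (hS : SeqSpace Q S) (n : ℕ) {s : ℝ}
    (hs : 0 < s) (hG : ∀ x ∈ S, ∀ k, H (shift k x) = H x)
    (hG' : ∀ x ∈ S, ∀ k, H' (shift k x) = H' x) (k l : ℤ) :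
    ∫ x, bump s ‖x l‖ * (H (trunc 1 (r n) x) * H' (trunc (1 + k) (r n + k) x)) ∂(P n) =
    ∫ x in {x | s < ‖x 0‖}, bump s ‖x 0‖ * (H (trunc (1 - l) (r n - l) x) *
      H' (trunc (1 - (l - k)) (r n - (l - k)) x)) ∂(P n) := by
  rw [setIntegral_eq_integral_of_forall_compl_eq_zero, ← h.integral_shift n l fun x =>
    bump s ‖x 0‖ * (H (trunc (1 - l) (r n - l) x) * H' (trunc (1 - (l - k)) (r n - (l - k)) x))]
  · refine integral_congr_ae (Eventually.of_forall fun x => ?_)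
    simp only
    rw [hS.apply_trunc_shift hG, hS.apply_trunc_shift hG', shift_apply, zero_add]
    congr 4 <;> ring_nf
  · intro x hx
    rw [bump_eq_zero hs (not_lt.1 hx), zero_mul]

/-- The joint moment of two overlapping blocks is asymptotically proportional to the length of
the overlap. -/
lemma Admissible.overlap (hN : SeqNorm N) (hT : TailSmall P p r N) (hS : SeqSpace Q S)
    (h : BlockLimit P Q α p r) (hD : WeakDep P p r ℓ b) (hH : Admissible P Q p r N S H)
    (hH' : Admissible P Q p r N S H') {δ : ℝ} (hδ : 0 < δ) :
    ∀ᶠ n in atTop, ∀ k : ℤ, 0 ≤ k → k ≤ r n →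
      |∫ x, H (trunc 1 (r n) x) * H' (trunc (1 + k) (r n + k) x) ∂(P n) -
        (r n - k) * p n * ∫ x, H x * H' x ∂(anchored Q α)| ≤ δ * (r n * p n) := by
  have := h.probQ
  obtain ⟨C, hC⟩ := hH.bounded
  obtain ⟨C', hC'⟩ := hH'.bounded
  have hC0 : 0 ≤ C := (abs_nonneg _).trans (hC 0)
  have hC'0 : 0 ≤ C' := (abs_nonneg _).trans (hC' 0)
  set v := ∫ x, H x * H' x ∂(anchored Q α) with hv
  set e := δ / (2 * C + 2 * C' + 3) with he
  have he0 : 0 < e := by positivity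
  have hHH : ∀ x, |H x * H' x| ≤ C * C' := fun x => by
    rw [abs_mul]; exact mul_le_mul (hC x) (hC' x) (abs_nonneg _) hC0
  have hmm : Measurable fun x => H x * H' x := hH.measurable.mul hH'.measurable
  have hinv : ∀ x ∈ S, ∀ k, H (shift k x) * H' (shift k x) = H x * H' x := fun x hx k => by
    rw [hH.shift_inv x hx, hH'.shift_inv x hx]
  have hint : Integrable (fun x => H x * H' x) (anchored Q α) :=
    (Admissible.integrable hN hT hS h hH).mul_bdd hH'.measurable.aestronglyMeasurable
      (c := C') (Eventually.of_forall hC')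
  obtain ⟨s, ⟨hs1, hs2⟩, hs0⟩ := (((hH.small e he0).and
    (h.eventually_bump_close hS hmm hint hHH hinv he0)).and self_mem_nhdsWithin).exists
  have hs : 0 < s := hs0
  set G : (ℤ → E) → ℝ := fun x => damp s x * H x with hG
  have hGm : Measurable G := (measurable_damp s).mul hH.measurable
  have hGC : ∀ x, |G x| ≤ C := fun x => by
    rw [hG]; simp only [abs_mul]
    exact (mul_le_of_le_one_left (abs_nonneg _) (abs_damp_le_one s x)).trans (hC x)
  have hGinv : ∀ x ∈ S, ∀ k, G (shift k x) = G x := fun x hx k => by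
    simp only [hG]; rw [damp_shift, hH.shift_inv x hx]
  have hGc : ∀ᵐ y ∂Q, FinCont N G (s • y) := by
    filter_upwards [hH.finCont s hs, hS.ae_mem] with y hy hyS
    exact FinCont.mul (abs_damp_le_one s) hC (finCont_damp hN hs (hS.subset (hyS s hs))) hy
  have hHc : ∀ᵐ y ∂Q, FinCont N (fun x => H x * H' x) (s • y) := by
    filter_upwards [hH.finCont s hs, hH'.finCont s hs] with y hy hy'
    exact FinCont.mul hC hC' hy hy'
  obtain ⟨m, ⟨hm1, hm2⟩, hm3, hm4⟩ := (((hH'.sum_exceed_block_le hS h hD hs he0).and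
    (h.eventually_localize hN hT hs hGm hGC hGc he0)).and
    ((h.eventually_localize hN hT hs hH'.measurable hC' (hH'.finCont s hs) he0).and
    (h.eventually_window hN hT hs (measurable_single hmm s) (fun x => abs_single_le hHH s ‖x 0‖ x)
      (Admissible.finCont_single hN hS hHH hs hHc) he0))).exists
  set I := s ^ (-α) * ∫ y, bump s ‖(s • y) 0‖ * (damp s (s • y) * (H (s • y) * H' (s • y))) ∂Q
    with hI
  set K := (3 * m : ℝ) * (C * C' * (s ^ (-α) + 1)) + 2 * m * |v| with hK
  have hr : ∀ᶠ n in atTop, K ≤ e * r n := by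
    have : Tendsto (fun n => e * (r n : ℝ)) atTop atTop :=
      (tendsto_natCast_atTop_atTop.comp h.r_top).const_mul_atTop he0
    exact this.eventually_ge_atTop K
  filter_upwards [hm1, hm2, hm3, hm4, hs1, h.tail_le hs, h.p_pos, hr]
    with n h1 h2 h3 h4 h5 h6 hp hr k hk0 hkr
  have := h.prob n
  set A : Set (ℤ → E) := {x | s < ‖x 0‖} with hA
  set B1 : (ℤ → E) → ℝ := fun x => H (trunc 1 (r n) x) with hB1
  set B2 : (ℤ → E) → ℝ := fun x => H' (trunc (1 + k) (r n + k) x) with hB2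
  have hB1m : Measurable B1 := hH.measurable.comp (measurable_trunc _ _)
  have hB2m : Measurable B2 := hH'.measurable.comp (measurable_trunc _ _)
  have hB1C : ∀ x, |B1 x| ≤ C := fun x => hC _
  have hB2C : ∀ x, |B2 x| ≤ C' := fun x => hC' _
  set T : ℤ → ℝ := fun l => ∫ x, bump s ‖x l‖ * (G (trunc 1 (r n) x) * B2 x) ∂(P n) with hTdef
  have hTm : ∀ l, Measurable fun x : ℤ → E => bump s ‖x l‖ * (G (trunc 1 (r n) x) * B2 x) :=
    fun l => ((continuous_bump s).measurable.comp (measurable_norm_apply l)).mul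
      ((hGm.comp (measurable_trunc _ _)).mul hB2m)
  have hTb : ∀ l x, |bump s ‖x l‖ * (G (trunc 1 (r n) x) * B2 x)| ≤
      {x : ℤ → E | s < ‖x l‖}.indicator (fun x => C * |B2 x|) x := by
    intro l x
    by_cases hx : s < ‖x l‖
    · rw [Set.indicator_of_mem (show x ∈ {x : ℤ → E | s < ‖x l‖} from hx), abs_mul, abs_mul,
        abs_of_nonneg (bump_nonneg _ _)]
      refine (mul_le_of_le_one_left (by positivity) (bump_le_one _ _)).trans ?_
      exact mul_le_mul_of_nonneg_right (hGC _) (abs_nonneg _)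
    · rw [bump_eq_zero hs (not_lt.1 hx), zero_mul, abs_zero]
      exact Set.indicator_nonneg (fun _ _ => by positivity) _
  have hTb' : ∀ l x, |bump s ‖x l‖ * (G (trunc 1 (r n) x) * B2 x)| ≤ C * C' := by
    intro l x
    rw [abs_mul, abs_mul, abs_of_nonneg (bump_nonneg _ _)]
    refine (mul_le_of_le_one_left (by positivity) (bump_le_one _ _)).trans ?_
    exact mul_le_mul (hGC _) (hB2C _) (abs_nonneg _) hC0
  have hTi : ∀ l, Integrable (fun x : ℤ → E => bump s ‖x l‖ * (G (trunc 1 (r n) x) * B2 x)) (P n) :=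
    fun l => h.integrable_of_bound (hTm l) (hTb' l)
  have hB2i : Integrable (fun x => C * |B2 x|) (P n) :=
    (h.integrable_of_bound hB2m.abs (C := C') fun x => by rw [abs_abs]; exact hB2C x).const_mul _
  have hT1 : ∀ l, |T l| ≤ C * ∫ x in {x | s < ‖x l‖}, |B2 x| ∂(P n) := by
    intro l
    refine abs_integral_le_integral_abs.trans ?_
    rw [← integral_const_mul, ← integral_indicator (measurableSet_exceed s l)]
    exact integral_mono (hTi l).abs (hB2i.indicator (measurableSet_exceed s l)) (hTb l)
  have hT2 : ∀ l, |T l| ≤ C * C' * (s ^ (-α) + 1) * p n := by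
    intro l
    refine (hT1 l).trans ?_
    have h7 := norm_setIntegral_le_of_norm_le_const (μ := P n) (s := {x | s < ‖x l‖}) (C := C')
      (f := fun x => |B2 x|) (measure_lt_top _ _) fun x _ => by
        rw [Real.norm_eq_abs, abs_abs]; exact hB2C x
    rw [h.real_exceed] at h7
    have h8 := (le_abs_self _).trans (h7.trans (mul_le_mul_of_nonneg_left h6 hC'0))
    calc _ ≤ C * (C' * ((s ^ (-α) + 1) * p n)) := mul_le_mul_of_nonneg_left h8 hC0
      _ = _ := by ring
  -- decomposition of the first block according to its exceedances
  have hdec : |∫ x, B1 x * B2 x ∂(P n) - ∑ l ∈ Finset.Icc (1 : ℤ) (r n), T l| ≤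
      C' * (e * (r n * p n)) := by
    have hB12 : Integrable (fun x => B1 x * B2 x) (P n) :=
      h.integrable_of_bound (hB1m.mul hB2m) (C := C * C') fun x => by
        rw [abs_mul]; exact mul_le_mul (hB1C x) (hB2C x) (abs_nonneg _) hC0
    have hqm : MeasurableSet {x : ℤ → E | ∀ j ∈ Finset.Icc (1 : ℤ) (r n), ‖x j‖ ≤ 2 * s} :=
      measurableSet_quiet _ _
    have hB1i : Integrable (fun x => |B1 x|) (P n) :=
      h.integrable_of_bound hB1m.abs (C := C) fun x => by rw [abs_abs]; exact hB1C x
    rw [hTdef, ← integral_finsetSum _ fun l _ => hTi l,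
      ← integral_sub hB12 (integrable_finsetSum _ fun l _ => hTi l)]
    refine abs_integral_le_integral_abs.trans (le_trans ?_ (mul_le_mul_of_nonneg_left h5 hC'0))
    rw [← integral_const_mul, ← integral_indicator hqm]
    refine integral_mono (hB12.sub (integrable_finsetSum _ fun l _ => hTi l)).abs
      ((hB1i.const_mul C').indicator hqm) fun x => ?_
    have h7 := abs_sub_sum_bump_le hs H 1 (r n) x
    have h8 : B1 x * B2 x - ∑ l ∈ Finset.Icc (1 : ℤ) (r n),
        bump s ‖x l‖ * (G (trunc 1 (r n) x) * B2 x) = (H (trunc 1 (r n) x) -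
        ∑ l ∈ Finset.Icc (1 : ℤ) (r n), bump s ‖x l‖ *
          (damp s (trunc 1 (r n) x) * H (trunc 1 (r n) x))) * B2 x := by
      rw [sub_mul, Finset.sum_mul]
      simp only [hG, hB1, mul_assoc]
    simp only
    rw [h8, abs_mul, mul_comm]
    refine (mul_le_mul (hB2C x) h7 (abs_nonneg _) hC'0).trans (le_of_eq ?_)
    by_cases hx : x ∈ {x : ℤ → E | ∀ j ∈ Finset.Icc (1 : ℤ) (r n), ‖x j‖ ≤ 2 * s}
    · rw [Set.indicator_of_mem hx, Set.indicator_of_mem hx]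
    · rw [Set.indicator_of_notMem hx, Set.indicator_of_notMem hx, mul_zero]
  -- exceedances in the common part of the two blocks
  set Jm := Finset.Icc (k + 1 + m) ((r n : ℤ) - m) with hJm
  set Jf := Finset.Icc 1 (k - (m : ℤ)) with hJf
  set g : ℝ := ∫ x in A, bump s ‖window m x 0‖ *
    (damp s (window m x) * (H (window m x) * H' (window m x))) ∂(P n) with hg
  have hmid : ∀ l, |T l - g| ≤
      C' * ∫ x in A, |G (trunc (1 - l) (r n - l) x) - G (window m x)| ∂(P n) +
      C * ∫ x in A, |H' (trunc (1 - (l - k)) (r n - (l - k)) x) - H' (window m x)| ∂(P n) := by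
    intro l
    have hd1m : Measurable fun x => G (trunc (1 - l) (r n - l) x) - G (window m x) :=
      (hGm.comp (measurable_trunc _ _)).sub (hGm.comp (measurable_trunc _ _))
    have hd2m : Measurable fun x =>
        H' (trunc (1 - (l - k)) (r n - (l - k)) x) - H' (window m x) :=
      (hH'.measurable.comp (measurable_trunc _ _)).sub (hH'.measurable.comp (measurable_trunc _ _))
    have hd1 : Integrable (fun x => C' * |G (trunc (1 - l) (r n - l) x) - G (window m x)|)
        ((P n).restrict A) :=
      ((h.integrable_of_bound hd1m (C := C + C) fun x =>
        (abs_sub _ _).trans (add_le_add (hGC _) (hGC _))).abs.const_mul _).integrableOn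
    have hd2 : Integrable (fun x => C *
        |H' (trunc (1 - (l - k)) (r n - (l - k)) x) - H' (window m x)|) ((P n).restrict A) :=
      ((h.integrable_of_bound hd2m (C := C' + C') fun x =>
        (abs_sub _ _).trans (add_le_add (hC' _) (hC' _))).abs.const_mul _).integrableOn
    have e1 : T l = ∫ x in A, bump s ‖x 0‖ * (G (trunc (1 - l) (r n - l) x) *
        H' (trunc (1 - (l - k)) (r n - (l - k)) x)) ∂(P n) :=
      h.integral_center_two hS n hs hGinv hH'.shift_inv k l
    have hi1 : Integrable (fun x => bump s ‖x 0‖ * (G (trunc (1 - l) (r n - l) x) *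
        H' (trunc (1 - (l - k)) (r n - (l - k)) x))) ((P n).restrict A) := by
      refine (h.integrable_of_bound (C := C * C') ?_ fun x => ?_).integrableOn
      · exact ((continuous_bump s).measurable.comp (measurable_norm_apply 0)).mul
          ((hGm.comp (measurable_trunc _ _)).mul (hH'.measurable.comp (measurable_trunc _ _)))
      · rw [abs_mul, abs_mul, abs_of_nonneg (bump_nonneg _ _)]
        exact (mul_le_of_le_one_left (by positivity) (bump_le_one _ _)).trans
          (mul_le_mul (hGC _) (hC' _) (abs_nonneg _) hC0)
    have hi2 : Integrable (fun x => bump s ‖window m x 0‖ *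
        (damp s (window m x) * (H (window m x) * H' (window m x)))) ((P n).restrict A) :=
      (h.integrable_of_bound ((measurable_single hmm s).comp (measurable_trunc _ _)) fun x =>
        abs_single_le hHH s ‖window m x 0‖ (window m x)).integrableOn
    rw [e1, hg, ← integral_sub hi1 hi2, ← integral_const_mul, ← integral_const_mul,
      ← integral_add hd1 hd2]
    refine abs_integral_le_integral_abs.trans
      (integral_mono (hi1.sub hi2).abs (hd1.add hd2) fun x => ?_)
    simp only
    rw [show window m x 0 = x 0 from if_pos ⟨by omega, by omega⟩, ← mul_assoc (damp s _),
      ← mul_sub, abs_mul, abs_of_nonneg (bump_nonneg _ _)]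
    refine (mul_le_of_le_one_left (abs_nonneg _) (bump_le_one _ _)).trans ?_
    set a1 := G (trunc (1 - l) (r n - l) x)
    set a2 := H' (trunc (1 - (l - k)) (r n - (l - k)) x)
    rw [show a1 * a2 - damp s (window m x) * H (window m x) * H' (window m x) =
      a2 * (a1 - G (window m x)) + G (window m x) * (a2 - H' (window m x)) by
        simp only [hG]; ring]
    refine (abs_add_le _ _).trans (add_le_add ?_ ?_)
    · rw [abs_mul]; exact mul_le_mul_of_nonneg_right (hC' _) (abs_nonneg _)
    · rw [abs_mul]; exact mul_le_mul_of_nonneg_right (hGC _) (abs_nonneg _)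
  have hmids : |∑ l ∈ Jm, T l - Jm.card * g| ≤ (C' + C) * (e * (r n * p n)) := by
    rw [← nsmul_eq_mul, ← Finset.sum_const, ← Finset.sum_sub_distrib]
    refine (Finset.abs_sum_le_sum_abs _ _).trans ((Finset.sum_le_sum fun l _ => hmid l).trans ?_)
    rw [Finset.sum_add_distrib, ← Finset.mul_sum, ← Finset.mul_sum, add_mul]
    refine add_le_add (mul_le_mul_of_nonneg_left (le_trans ?_ h2) hC'0)
      (mul_le_mul_of_nonneg_left (le_trans ?_ h3) hC0)
    · exact Finset.sum_le_sum_of_subset_of_nonneg (Finset.Icc_subset_Icc_left (by omega))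
        fun _ _ _ => integral_nonneg fun _ => abs_nonneg _
    · rw [← Finset.sum_image (s := Jm) (g := fun l => l - k) (f := fun j => ∫ x in A,
        |H' (trunc (1 - j) (r n - j) x) - H' (window m x)| ∂(P n)) fun a _ b _ hab => by
          simpa using hab]
      refine Finset.sum_le_sum_of_subset_of_nonneg (fun j hj => ?_)
        fun _ _ _ => integral_nonneg fun _ => abs_nonneg _
      obtain ⟨l, hl, rfl⟩ := Finset.mem_image.1 hj
      rw [hJm, Finset.mem_Icc] at hl
      exact Finset.mem_Icc.2 ⟨by omega, by omega⟩
  have hcard : |(Jm.card : ℝ) - (r n - k)| ≤ 2 * m := by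
    have : |(Jm.card : ℤ) - (r n - k)| ≤ 2 * m := by
      rw [hJm, Int.card_Icc, abs_le]; omega
    exact_mod_cast this
  have hcard' : (Jm.card : ℝ) ≤ r n := by
    have : (Jm.card : ℤ) ≤ r n := by rw [hJm, Int.card_Icc]; omega
    exact_mod_cast this
  -- exceedances well before the second block
  have hfar : |∑ l ∈ Jf, T l| ≤ C * (e * (r n * p n)) := by
    refine (Finset.abs_sum_le_sum_abs _ _).trans ((Finset.sum_le_sum fun l _ => hT1 l).trans ?_)
    rw [← Finset.mul_sum]
    exact mul_le_mul_of_nonneg_left (h1 k hkr) hC0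
  -- the boundary terms
  have hdisj : Disjoint Jf Jm := by
    rw [Finset.disjoint_left]
    intro l hl hl'
    rw [hJf, Finset.mem_Icc] at hl
    rw [hJm, Finset.mem_Icc] at hl'
    omega
  have hsub : Jf ∪ Jm ⊆ Finset.Icc (1 : ℤ) (r n) :=
    Finset.union_subset (Finset.Icc_subset_Icc_right (by omega))
      (Finset.Icc_subset_Icc (by omega) (by omega))
  have hedge : |∑ l ∈ Finset.Icc (1 : ℤ) (r n) \ (Jf ∪ Jm), T l| ≤
      3 * m * (C * C' * (s ^ (-α) + 1) * p n) := by
    refine (Finset.abs_sum_le_sum_abs _ _).trans ((Finset.sum_le_sum fun l _ => hT2 l).trans ?_)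
    rw [Finset.sum_const, nsmul_eq_mul]
    refine mul_le_mul_of_nonneg_right ?_ (by positivity)
    have hss : Finset.Icc (1 : ℤ) (r n) \ (Jf ∪ Jm) ⊆
        Finset.Icc (k - m + 1) (k + m) ∪ Finset.Icc ((r n : ℤ) - m + 1) (r n) := by
      intro l hl
      simp only [hJf, hJm, Finset.mem_sdiff, Finset.mem_union, Finset.mem_Icc] at hl ⊢
      omega
    have : (Finset.Icc (1 : ℤ) (r n) \ (Jf ∪ Jm)).card ≤ 3 * m := by
      refine (Finset.card_le_card hss).trans ((Finset.card_union_le _ _).trans ?_)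
      rw [Int.card_Icc, Int.card_Icc]
      omega
    exact_mod_cast this
  have hsum : ∑ l ∈ Finset.Icc (1 : ℤ) (r n), T l =
      ∑ l ∈ Finset.Icc (1 : ℤ) (r n) \ (Jf ∪ Jm), T l + (∑ l ∈ Jf, T l + ∑ l ∈ Jm, T l) := by
    rw [← Finset.sum_sdiff hsub, Finset.sum_union hdisj]
  have e1 : |Jm.card * g - Jm.card * (I * p n)| ≤ r n * (e * p n) := by
    rw [← mul_sub, abs_mul, abs_of_nonneg (Nat.cast_nonneg _)]
    exact mul_le_mul hcard' h4 (abs_nonneg _) (Nat.cast_nonneg _)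
  have e2 : |Jm.card * (I * p n) - Jm.card * (v * p n)| ≤ r n * (e * p n) := by
    rw [← mul_sub, ← sub_mul, abs_mul, abs_mul, abs_of_nonneg (Nat.cast_nonneg _), abs_of_pos hp]
    exact mul_le_mul hcard' (mul_le_mul_of_nonneg_right hs2 hp.le) (by positivity)
      (Nat.cast_nonneg _)
  have e3 : |Jm.card * (v * p n) - (r n - k) * p n * v| ≤ 2 * m * (|v| * p n) := by
    rw [show Jm.card * (v * p n) - (r n - k) * p n * v = (Jm.card - (r n - k)) * (v * p n) by ring,
      abs_mul, abs_mul, abs_of_pos hp]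
    exact mul_le_mul_of_nonneg_right hcard (by positivity)
  have e4 : K * p n ≤ e * r n * p n := mul_le_mul_of_nonneg_right hr hp.le
  have e5 : K * p n = 3 * m * (C * C' * (s ^ (-α) + 1) * p n) + 2 * m * (|v| * p n) := by
    rw [hK]; ring
  have e6 : δ * (r n * p n) = (2 * C + 2 * C' + 3) * (e * (r n * p n)) := by
    rw [he]; field_simp
  rw [hsum] at hdec
  rw [abs_le] at *
  constructor <;> linarith

end overlap

/-! ### Sums of stationary covariances -/

section sums

/-- A sum of nonnegative terms over integers within `M` of `a` from above or within `M` of `b` from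
below. -/
lemma sum_le_two_sided {f : ℤ → ℝ} (hf : ∀ k, 0 ≤ f k) (S : Finset ℤ) (a b : ℤ) (M : ℕ)
    (hS : ∀ k ∈ S, (a ≤ k ∧ k < a + M) ∨ (b - M < k ∧ k ≤ b)) :
    ∑ k ∈ S, f k ≤ ∑ i ∈ Finset.range M, f (a + i) + ∑ i ∈ Finset.range M, f (b - i) := by
  have h1 : S ⊆ (Finset.range M).image (fun i : ℕ => a + (i : ℤ)) ∪
      (Finset.range M).image (fun i : ℕ => b - (i : ℤ)) := by
    intro k hk
    rw [Finset.mem_union, Finset.mem_image, Finset.mem_image]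
    rcases hS k hk with h | h
    · exact Or.inl ⟨(k - a).toNat, Finset.mem_range.2 (by omega), by omega⟩
    · exact Or.inr ⟨(b - k).toNat, Finset.mem_range.2 (by omega), by omega⟩
  refine (Finset.sum_le_sum_of_subset_of_nonneg h1 fun k _ _ => hf k).trans ?_
  have h2 := Finset.sum_union_inter (f := f)
    (s₁ := (Finset.range M).image (fun i : ℕ => a + (i : ℤ)))
    (s₂ := (Finset.range M).image (fun i : ℕ => b - (i : ℤ)))
  rw [Finset.sum_image (s := Finset.range M) (g := fun i : ℕ => a + (i : ℤ)) fun i _ j _ h => by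
      simpa using h,
    Finset.sum_image (s := Finset.range M) (g := fun i : ℕ => b - (i : ℤ)) fun i _ j _ h => by
      simpa using h] at h2
  rw [← h2]
  exact le_add_of_nonneg_right (Finset.sum_nonneg fun k _ => hf k)

/-- Terms bounded by `A` up to the gap `ℓ`, and by the rate `D * b k` beyond it. -/
lemma sum_gap_le {g b : ℕ → ℝ} {A D : ℝ} {ℓ : ℕ} (hA : 0 ≤ A) (hD : 0 ≤ D) (hb : ∀ k, 0 ≤ b k)
    (h1 : ∀ k, g k ≤ A) (h2 : ∀ k, ℓ ≤ k → g k ≤ D * b k) (M : ℕ) :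
    ∑ k ∈ Finset.range M, g k ≤ ℓ * A + D * ∑ k ∈ Finset.range M, b (ℓ + k) := by
  rcases le_total M ℓ with hM | hM
  · refine (Finset.sum_le_sum fun k _ => h1 k).trans ?_
    rw [Finset.sum_const, Finset.card_range, nsmul_eq_mul]
    have h3 : 0 ≤ D * ∑ k ∈ Finset.range M, b (ℓ + k) :=
      mul_nonneg hD (Finset.sum_nonneg fun k _ => hb _)
    have h4 : (M : ℝ) * A ≤ ℓ * A := mul_le_mul_of_nonneg_right (by exact_mod_cast hM) hA
    linarith
  · obtain ⟨t, rfl⟩ := Nat.exists_eq_add_of_le hM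
    rw [Finset.sum_range_add]
    refine add_le_add ((Finset.sum_le_sum fun k _ => h1 k).trans (by simp)) ?_
    refine (Finset.sum_le_sum fun k _ => h2 (ℓ + k) (by omega)).trans ?_
    rw [← Finset.mul_sum]
    exact mul_le_mul_of_nonneg_left (Finset.sum_le_sum_of_subset_of_nonneg
      (Finset.range_subset_range.2 (by omega)) fun k _ _ => hb _) hD

/-- Sums of covariances over lags beyond a gap: the first `ℓ` lags on either side are bounded
trivially, the others by the mixing rate. -/
lemma sum_far_le {f : ℤ → ℝ} (hf : ∀ k, 0 ≤ f k) {b : ℕ → ℝ} {A D s : ℝ} {ℓ : ℕ} {a a' : ℤ}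
    (hA : 0 ≤ A) (hD : 0 ≤ D) (hb : ∀ k, 0 ≤ b k) (h1 : ∀ k, f k ≤ A)
    (h2 : ∀ k : ℕ, f (a + k) ≤ D * b k) (h3 : ∀ k : ℕ, f (a' - k) ≤ D * b k)
    (hs : ∀ M : ℕ, ∑ k ∈ Finset.range M, b (ℓ + k) ≤ s) (T : Finset ℤ)
    (hT : ∀ k ∈ T, a ≤ k ∨ k ≤ a') : ∑ k ∈ T, f k ≤ 2 * (ℓ * A + D * s) := by
  set M := T.sup (fun k => (k - a).natAbs + (k - a').natAbs) + 1 with hM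
  have hle : ∀ k ∈ T, (k - a).natAbs + (k - a').natAbs < M := fun k hk =>
    Nat.lt_succ_of_le (Finset.le_sup (f := fun k => (k - a).natAbs + (k - a').natAbs) hk)
  have h4 := sum_le_two_sided hf T a a' M fun k hk => by
    have := hle k hk
    rcases hT k hk with h | h
    · left; omega
    · right; omega
  have h5 := sum_gap_le (g := fun i => f (a + i)) hA hD hb (fun i => h1 _) (fun i _ => h2 i)
    (ℓ := ℓ) M
  have h6 := sum_gap_le (g := fun i => f (a' - i)) hA hD hb (fun i => h1 _) (fun i _ => h3 i)
    (ℓ := ℓ) M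
  have h7 := mul_le_mul_of_nonneg_left (hs M) hD
  linarith

lemma abs_sum_sub_sum_le (c : ℤ → ℝ) (A D : Finset ℤ) :
    |∑ k ∈ A, c k - ∑ k ∈ D, c k| ≤ ∑ k ∈ A \ D, |c k| + ∑ k ∈ D \ A, |c k| := by
  rw [← Finset.sum_sdiff_sub_sum_sdiff]
  exact (abs_sub _ _).trans (add_le_add (Finset.abs_sum_le_sum_abs _ _)
    (Finset.abs_sum_le_sum_abs _ _))

/-- The double sum of a function of the lag over `q` indices is `q` times the sum over the lags
smaller than `r`, up to the contribution `T` of the larger lags and boundary terms. -/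
lemma abs_double_sum_sub_le {c : ℤ → ℝ} {r q : ℕ} {V e B T : ℝ}
    (h1 : |∑ k ∈ Finset.Ioo (-(r : ℤ)) r, c k - V| ≤ e)
    (h2 : ∑ k ∈ Finset.Ioo (-(r : ℤ)) r, |c k| ≤ B)
    (h3 : ∑ k ∈ Finset.Ioo (-(q : ℤ)) q \ Finset.Ioo (-(r : ℤ)) r, |c k| ≤ T) :
    |∑ i ∈ Finset.range q, ∑ j ∈ Finset.range q, c ((j : ℤ) - i) - q * V| ≤
      q * (e + T) + 2 * r * B := by
  have hB : 0 ≤ B := (Finset.sum_nonneg fun _ _ => abs_nonneg _).trans h2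
  set bad : Finset ℕ := (Finset.range q).filter fun i => i < r ∨ q < i + r with hbad
  have hcard : (bad.card : ℝ) ≤ 2 * r := by
    have : bad ⊆ Finset.range r ∪ Finset.Ico (q - r) q := by
      intro i hi
      simp only [hbad, Finset.mem_filter, Finset.mem_range, Finset.mem_union,
        Finset.mem_Ico] at hi ⊢
      omega
    have h4 := (Finset.card_le_card this).trans (Finset.card_union_le _ _)
    rw [Finset.card_range, Nat.card_Ico] at h4
    have h5 : bad.card ≤ 2 * r := by omega
    exact_mod_cast h5
  -- for `r ≤ i ≤ q - r` the row contains all the lags smaller than `r`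
  have hrow : ∀ i ∈ Finset.range q, |∑ j ∈ Finset.range q, c ((j : ℤ) - i) - V| ≤
      (e + T) + if i < r ∨ q < i + r then B else 0 := by
    intro i hi
    rw [Finset.mem_range] at hi
    have e1 : ∑ j ∈ Finset.range q, c ((j : ℤ) - i) =
        ∑ k ∈ Finset.Ico (-(i : ℤ)) (q - i), c k := by
      refine Finset.sum_bij' (fun j _ => (j : ℤ) - i) (fun k _ => (k + i).toNat) ?_ ?_ ?_ ?_ ?_
      · intro j hj; rw [Finset.mem_range] at hj; rw [Finset.mem_Ico]; omega
      · intro k hk; rw [Finset.mem_Ico] at hk; rw [Finset.mem_range]; omega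
      · intro j hj; simp
      · intro k hk; rw [Finset.mem_Ico] at hk; omega
      · intro j hj; rfl
    rw [e1]
    have h4 := abs_sum_sub_sum_le c (Finset.Ico (-(i : ℤ)) (q - i)) (Finset.Ioo (-(r : ℤ)) r)
    have h5 : ∑ k ∈ Finset.Ico (-(i : ℤ)) (q - i) \ Finset.Ioo (-(r : ℤ)) r, |c k| ≤ T := by
      refine le_trans (Finset.sum_le_sum_of_subset_of_nonneg ?_ fun _ _ _ => abs_nonneg _) h3
      refine Finset.sdiff_subset_sdiff (fun k hk => ?_) subset_rfl
      rw [Finset.mem_Ico] at hk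
      rw [Finset.mem_Ioo]; omega
    have h6 : ∑ k ∈ Finset.Ioo (-(r : ℤ)) r \ Finset.Ico (-(i : ℤ)) (q - i), |c k| ≤
        if i < r ∨ q < i + r then B else 0 := by
      split_ifs with hc
      · exact (Finset.sum_le_sum_of_subset_of_nonneg Finset.sdiff_subset
          fun _ _ _ => abs_nonneg _).trans h2
      · rw [Finset.sdiff_eq_empty_iff_subset.2, Finset.sum_empty]
        intro k hk
        rw [Finset.mem_Ioo] at hk
        rw [Finset.mem_Ico]; omega
    have h7 := abs_sub_le (∑ k ∈ Finset.Ico (-(i : ℤ)) (q - i), c k)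
      (∑ k ∈ Finset.Ioo (-(r : ℤ)) r, c k) V
    linarith
  have e2 : ∑ i ∈ Finset.range q, ∑ j ∈ Finset.range q, c ((j : ℤ) - i) - q * V =
      ∑ i ∈ Finset.range q, (∑ j ∈ Finset.range q, c ((j : ℤ) - i) - V) := by
    rw [Finset.sum_sub_distrib, Finset.sum_const, Finset.card_range, nsmul_eq_mul]
  rw [e2]
  refine (Finset.abs_sum_le_sum_abs _ _).trans ((Finset.sum_le_sum hrow).trans ?_)
  rw [Finset.sum_add_distrib, Finset.sum_const, Finset.card_range, nsmul_eq_mul,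
    ← Finset.sum_filter, Finset.sum_const, nsmul_eq_mul]
  exact (add_le_add_iff_left _).2 (mul_le_mul_of_nonneg_right hcard hB)

/-- Two blocks of length `r` at lag `k` overlap in `r - |k|` times. -/
lemma sum_overlap_length (r : ℕ) :
    ∑ k ∈ Finset.Ioo (-(r : ℤ)) r, ((r : ℝ) - |(k : ℝ)|) = (r : ℝ) ^ 2 := by
  induction r with
  | zero => simp
  | succ r ih =>
    by_cases hr : r = 0
    · subst hr
      have : Finset.Ioo (-((0 + 1 : ℕ) : ℤ)) ((0 + 1 : ℕ) : ℤ) = {0} := by decide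
      rw [this]; simp
    have hI : Finset.Ioo (-((r + 1 : ℕ) : ℤ)) ((r + 1 : ℕ) : ℤ) =
        insert (r : ℤ) (insert (-(r : ℤ)) (Finset.Ioo (-(r : ℤ)) r)) := by
      ext k; simp only [Finset.mem_Ioo, Finset.mem_insert]; omega
    rw [hI, Finset.sum_insert (by simp; omega), Finset.sum_insert (by simp)]
    have : ∀ k : ℤ, (((r + 1 : ℕ) : ℝ) - |(k : ℝ)|) = (r - |(k : ℝ)|) + 1 := fun k => by
      push_cast; ring
    simp_rw [this]
    rw [Finset.sum_add_distrib, ih, Finset.sum_const, Int.card_Ioo, nsmul_eq_mul]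
    have e1 : (((r : ℤ) - -(r : ℤ) - 1).toNat : ℝ) = 2 * r - 1 := by
      have : (((r : ℤ) - -(r : ℤ) - 1).toNat : ℤ) = 2 * r - 1 := by omega
      exact_mod_cast this
    rw [e1]
    push_cast
    rw [abs_neg, abs_of_nonneg (Nat.cast_nonneg r)]
    ring

lemma tendsto_numBlocks_div {r : ℕ → ℕ} (hrn : Tendsto (fun n : ℕ => (r n : ℝ) / n) atTop (𝓝 0)) :
    Tendsto (fun n : ℕ => (n : ℝ) / numBlocks r n) atTop (𝓝 1) := by
  have h1 : Tendsto (fun n : ℕ => 1 + 1 / (n : ℝ) - (r n : ℝ) / n) atTop (𝓝 (1 + 0 - 0)) :=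
    (tendsto_const_nhds.add tendsto_one_div_atTop_nhds_zero_nat).sub hrn
  rw [add_zero, sub_zero] at h1
  have h2 := h1.inv₀ one_ne_zero
  rw [inv_one] at h2
  refine h2.congr' ?_
  filter_upwards [hrn.eventually_le_const (show (0 : ℝ) < 1 / 2 by norm_num), eventually_gt_atTop 0]
    with n hn h0
  have hn0 : (0 : ℝ) < n := by exact_mod_cast h0
  rw [div_le_iff₀ hn0] at hn
  have hle : r n ≤ n + 1 := by
    have : (r n : ℝ) ≤ (n + 1 : ℕ) := by push_cast; linarith
    exact_mod_cast this
  rw [numBlocks, Nat.cast_sub hle]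
  push_cast
  field_simp

/-- Normalised double sums of covariances converge to the limit of the normalised sums of the
covariances of overlapping blocks. -/
lemma tendsto_double_sum {c : ℕ → ℤ → ℝ} {r : ℕ → ℕ} {p : ℕ → ℝ} {v K : ℝ}
    (hrn : Tendsto (fun n : ℕ => (r n : ℝ) / n) atTop (𝓝 0)) (hr : Tendsto r atTop atTop)
    (hp : ∀ᶠ n in atTop, 0 < p n)
    (h1 : ∀ δ : ℝ, 0 < δ → ∀ᶠ n in atTop, |∑ k ∈ Finset.Ioo (-(r n : ℤ)) (r n), c n k -
      (r n) ^ 2 * p n * v| ≤ δ * ((r n) ^ 2 * p n))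
    (h2 : ∀ᶠ n in atTop, ∑ k ∈ Finset.Ioo (-(r n : ℤ)) (r n), |c n k| ≤ K * ((r n) ^ 2 * p n))
    (h3 : ∀ δ : ℝ, 0 < δ → ∀ᶠ n in atTop, ∀ M : ℕ,
      ∑ k ∈ Finset.Ioo (-(M : ℤ)) M \ Finset.Ioo (-(r n : ℤ)) (r n), |c n k| ≤
        δ * ((r n) ^ 2 * p n)) :
    Tendsto (fun n : ℕ => n * p n / (numBlocks r n * r n * p n) ^ 2 *
      ∑ i ∈ Finset.range (numBlocks r n), ∑ j ∈ Finset.range (numBlocks r n), c n ((j : ℤ) - i))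
      atTop (𝓝 v) := by
  have hq := tendsto_numBlocks_div hrn
  rw [Metric.tendsto_nhds]
  intro ε hε
  have hv : Tendsto (fun n : ℕ => (n : ℝ) / numBlocks r n * v) atTop (𝓝 (1 * v)) :=
    hq.mul_const v
  rw [one_mul] at hv
  have hrq : Tendsto (fun n : ℕ => 2 * |K| * ((r n : ℝ) / n * ((n : ℝ) / numBlocks r n))) atTop
      (𝓝 (2 * |K| * (0 * 1))) := (hrn.mul hq).const_mul _
  rw [zero_mul, mul_zero] at hrq
  filter_upwards [Metric.tendsto_nhds.1 hv (ε / 4) (by positivity),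
    hrq.eventually_le_const (show (0 : ℝ) < ε / 16 by positivity),
    hq.eventually_le_const (show (1 : ℝ) < 2 by norm_num),
    hq.eventually_const_lt (show (0 : ℝ) < 1 by norm_num), h1 (ε / 16) (by positivity), h2,
    h3 (ε / 16) (by positivity), hp, hr.eventually_gt_atTop 0, eventually_gt_atTop 0]
    with n a1 a2 a3 a4 a5 a6 a7 hp hr0 hn0
  set q := numBlocks r n with hqdef
  have hn : (0 : ℝ) < n := by exact_mod_cast hn0
  have hr : (0 : ℝ) < r n := by exact_mod_cast hr0
  have hq0 : (0 : ℝ) < q := by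
    by_contra! hneg
    have : (n : ℝ) / q ≤ 0 := div_nonpos_of_nonneg_of_nonpos hn.le hneg
    linarith
  have h4 := abs_double_sum_sub_le a5 a6 (a7 q)
  set Sn := ∑ i ∈ Finset.range q, ∑ j ∈ Finset.range q, c n ((j : ℤ) - i) with hSn
  set R := (r n : ℝ) ^ 2 * p n with hR
  have hR0 : 0 < R := by positivity
  have e1 : n * p n / (q * r n * p n) ^ 2 * Sn - n / q * v =
      n / (q ^ 2 * R) * (Sn - q * (R * v)) := by
    rw [hR]; field_simp
  have h5 : |n * p n / (q * r n * p n) ^ 2 * Sn - n / q * v| ≤ ε / 2 := by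
    rw [e1, abs_mul, abs_of_pos (by positivity)]
    refine (mul_le_mul_of_nonneg_left h4 (by positivity)).trans ?_
    have hKR : 2 * (r n : ℝ) * (K * R) ≤ 2 * r n * (|K| * R) :=
      mul_le_mul_of_nonneg_left (mul_le_mul_of_nonneg_right (le_abs_self K) hR0.le) (by positivity)
    calc (n : ℝ) / (q ^ 2 * R) * (q * (ε / 16 * R + ε / 16 * R) + 2 * r n * (K * R))
        ≤ n / (q ^ 2 * R) * (q * (ε / 16 * R + ε / 16 * R) + 2 * r n * (|K| * R)) :=
          mul_le_mul_of_nonneg_left (by linarith) (by positivity)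
      _ = n / q * (ε / 8 + 2 * |K| * (r n / n * (n / q))) := by field_simp; ring
      _ ≤ 2 * (ε / 8 + ε / 16) := mul_le_mul a3 (by linarith) (by positivity) (by norm_num)
      _ ≤ ε / 2 := by linarith
  have h6 := dist_triangle (n * p n / (q * r n * p n) ^ 2 * Sn) (n / q * v) v
  rw [Real.dist_eq _ (n / q * v : ℝ)] at h6
  linarith

end sums

/-! ### Limits of the covariances -/

/-- The covariance of `F` and `F'` evaluated at two blocks of length `r`, the second one shifted
by the lag `k`. -/
noncomputable def blockCov {E : Type*} [NormedAddCommGroup E] [MeasurableSpace E]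
    (P : Measure (ℤ → E)) (r : ℕ) (F F' : (ℤ → E) → ℝ) (k : ℤ) : ℝ :=
  cov[fun x => F (trunc 1 r x), fun x => F' (trunc (1 + k) (r + k) x); P]

section bounds

variable {X : Type*} [MeasurableSpace X] {μ : Measure X} [IsProbabilityMeasure μ] {f g : X → ℝ}
  {C C' : ℝ}

lemma memLp_of_abs_le (hf : Measurable f) (hC : ∀ x, |f x| ≤ C) : MemLp f 2 μ :=
  MemLp.of_bound hf.aestronglyMeasurable C (Eventually.of_forall hC)

lemma cov_eq_sub_of_bound (hf : Measurable f) (hC : ∀ x, |f x| ≤ C) (hg : Measurable g)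
    (hC' : ∀ x, |g x| ≤ C') :
    cov[f, g; μ] = ∫ x, f x * g x ∂μ - (∫ x, f x ∂μ) * ∫ x, g x ∂μ :=
  covariance_eq_sub (memLp_of_abs_le hf hC) (memLp_of_abs_le hg hC')

/-- Only one of the two functions has to be small in mean. -/
lemma abs_cov_le_of_bound (hf : Measurable f) (hC : ∀ x, |f x| ≤ C) (hg : Measurable g)
    (hC' : ∀ x, |g x| ≤ C') : |cov[f, g; μ]| ≤ 2 * C' * ∫ x, |f x| ∂μ := by
  have hfi : Integrable f μ :=
    Integrable.of_bound hf.aestronglyMeasurable C (Eventually.of_forall hC)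
  have hfg : Integrable (fun x => f x * g x) μ :=
    hfi.mul_bdd hg.aestronglyMeasurable (Eventually.of_forall fun x => (hC' x : ‖g x‖ ≤ C'))
  rw [cov_eq_sub_of_bound hf hC hg hC']
  have h1 : |∫ x, f x * g x ∂μ| ≤ C' * ∫ x, |f x| ∂μ := by
    refine abs_integral_le_integral_abs.trans ?_
    rw [← integral_const_mul]
    refine integral_mono hfg.abs (hfi.abs.const_mul _) fun x => ?_
    simp only
    rw [abs_mul, mul_comm]
    exact mul_le_mul_of_nonneg_right (hC' x) (abs_nonneg _)
  have h2 : |(∫ x, f x ∂μ) * ∫ x, g x ∂μ| ≤ C' * ∫ x, |f x| ∂μ := by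
    rw [abs_mul, mul_comm]
    refine mul_le_mul ?_ abs_integral_le_integral_abs (abs_nonneg _) ?_
    · have := norm_integral_le_of_norm_le_const (μ := μ) (f := g) (C := C')
        (Eventually.of_forall hC')
      simpa using this
    · obtain ⟨x⟩ := nonempty_of_isProbabilityMeasure μ
      exact (abs_nonneg _).trans (hC' x)
  linarith [abs_sub (∫ x, f x * g x ∂μ) ((∫ x, f x ∂μ) * ∫ x, g x ∂μ)]

end bounds

section limits

variable {E : Type*} [NormedAddCommGroup E] [NormedSpace ℝ E] [MeasurableSpace E] [BorelSpace E]
  [SecondCountableTopology E]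
variable {P : ℕ → Measure (ℤ → E)} {Q : Measure (ℤ → E)} {α : ℝ} {p : ℕ → ℝ} {r ℓ : ℕ → ℕ}
  {b : ℕ → ℝ}
variable {N : (ℤ → E) → ℝ≥0∞} {S : Set (ℤ → E)} {H H' F F' : (ℤ → E) → ℝ}

lemma BlockLimit.cov_shift (h : BlockLimit P Q α p r) (n : ℕ) (k : ℤ) (f g : (ℤ → E) → ℝ) :
    cov[fun x => f (shift k x), fun x => g (shift k x); P n] = cov[f, g; P n] := by
  have := covariance_map_equiv (μ := P n) f g (shiftEquiv k)
  rw [show (P n).map (shiftEquiv (E := E) k) = P n from h.shift_inv n k] at this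
  exact this.symm

/-- By stationarity, the covariance of two blocks depends on the lag only. -/
lemma BlockLimit.cov_block (h : BlockLimit P Q α p r) (hS : SeqSpace Q S)
    (hF : ∀ x ∈ S, ∀ k, F (shift k x) = F x) (hF' : ∀ x ∈ S, ∀ k, F' (shift k x) = F' x)
    (n : ℕ) (i j : ℤ) :
    cov[fun x => F (trunc (1 + i) (r n + i) x), fun x => F' (trunc (1 + j) (r n + j) x); P n] =
      blockCov (P n) (r n) F F' (j - i) := by
  rw [blockCov, ← h.cov_shift n i (fun x => F (trunc 1 (r n) x))
    fun x => F' (trunc (1 + (j - i)) (r n + (j - i)) x)]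
  simp_rw [hS.apply_trunc_shift hF, hS.apply_trunc_shift hF']
  rw [show 1 + (j - i) + i = 1 + j by ring, show (r n : ℤ) + (j - i) + i = r n + j by ring]

/-- Negative lags amount to exchanging the two functionals. -/
lemma BlockLimit.blockCov_neg (h : BlockLimit P Q α p r) (hS : SeqSpace Q S)
    (hF : ∀ x ∈ S, ∀ k, F (shift k x) = F x) (hF' : ∀ x ∈ S, ∀ k, F' (shift k x) = F' x)
    (n : ℕ) (k : ℤ) : blockCov (P n) (r n) F F' (-k) = blockCov (P n) (r n) F' F k := by
  have := h.cov_block hS hF hF' n k 0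
  rw [zero_sub] at this
  rw [← this, covariance_comm, blockCov]
  simp only [add_zero]

/-- The trivial bound on the covariance of two blocks, uniform in the lag. -/
lemma Admissible.abs_blockCov_le (h : BlockLimit P Q α p r) (hH : Admissible P Q p r N S H)
    (hH' : Admissible P Q p r N S H') :
    ∃ K : ℝ, 0 < K ∧ ∀ᶠ n in atTop, ∀ k, |blockCov (P n) (r n) H H' k| ≤ K * (r n * p n) := by
  obtain ⟨C, hC⟩ := hH.bounded
  obtain ⟨C', hC'⟩ := hH'.bounded
  have hC'0 : 0 ≤ C' := (abs_nonneg _).trans (hC' 0)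
  obtain ⟨K, hK, hKn⟩ := hH.integral_abs_le h
  refine ⟨2 * (C' + 1) * K, by positivity, ?_⟩
  filter_upwards [hKn] with n hn k
  have := h.prob n
  have h1 := abs_cov_le_of_bound (μ := P n) (hH.measurable.comp (measurable_trunc 1 (r n)))
    (fun x => hC _) (hH'.measurable.comp (measurable_trunc (1 + k) (r n + k)))
    (C' := C' + 1) (fun x => (hC' _).trans (by linarith))
  refine h1.trans ?_
  rw [mul_assoc _ K]
  exact mul_le_mul_of_nonneg_left hn (by positivity)

/-- The mixing bound on the covariance of two blocks separated by a gap of length `i`. -/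
lemma WeakDep.abs_blockCov_le (hD : WeakDep P p r ℓ b) (h : BlockLimit P Q α p r)
    (hm : Measurable F) (hm' : Measurable F') {C C' : ℝ} (hC : ∀ x, |F x| ≤ C)
    (hC' : ∀ x, |F' x| ≤ C') (n i : ℕ) :
    |blockCov (P n) (r n) F F' (r n + i)| ≤ 4 * C * C' * b i := by
  have := h.prob n
  have hC0 : 0 ≤ C := (abs_nonneg _).trans (hC 0)
  have hC'0 : 0 ≤ C' := (abs_nonneg _).trans (hC' 0)
  rw [blockCov, cov_eq_sub_of_bound (f := fun x => F (trunc 1 (r n) x))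
    (g := fun x => F' (trunc (1 + (r n + i)) (r n + (r n + i)) x))
    (hm.comp (measurable_trunc _ _)) (fun x => hC _)
    (hm'.comp (measurable_trunc _ _)) (fun x => hC' _)]
  have h1 := hD.cov_le n (i + 1) 1 (r n) (r n + (r n + i)) F F' C C' hm hm' hC hC'
  have e : (r n : ℤ) + ((i + 1 : ℕ) : ℤ) = 1 + (r n + i) := by push_cast; ring
  rw [e] at h1
  exact h1.trans (mul_le_mul_of_nonneg_left (hD.antitone (Nat.le_succ i)) (by positivity))

/-- The covariances of the blocks at lag `k ≤ r`. The product of the expectations is `O((r n * p n)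
^ 2)`, hence negligible. -/
lemma Admissible.blockCov_overlap (hN : SeqNorm N) (hT : TailSmall P p r N) (hS : SeqSpace Q S)
    (h : BlockLimit P Q α p r) (hD : WeakDep P p r ℓ b) (hH : Admissible P Q p r N S H)
    (hH' : Admissible P Q p r N S H') {δ : ℝ} (hδ : 0 < δ) :
    ∀ᶠ n in atTop, ∀ k : ℤ, 0 ≤ k → k ≤ r n → |blockCov (P n) (r n) H H' k -
        (r n - k) * p n * ∫ x, H x * H' x ∂(anchored Q α)| ≤ δ * (r n * p n) := by
  obtain ⟨C, hC⟩ := hH.bounded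
  obtain ⟨C', hC'⟩ := hH'.bounded
  obtain ⟨K, hK, hKn⟩ := hH.integral_abs_le h
  obtain ⟨K', hK', hKn'⟩ := hH'.integral_abs_le h
  filter_upwards [Admissible.overlap hN hT hS h hD hH hH' (half_pos hδ), hKn, hKn', h.p_pos,
    h.rp_zero.eventually_le_const (show 0 < δ / 2 / (K * K') by positivity)]
    with n h1 h2 h3 hp h4 k hk0 hkr
  have := h.prob n
  rw [blockCov, cov_eq_sub_of_bound (f := fun x => H (trunc 1 (r n) x))
    (g := fun x => H' (trunc (1 + k) (r n + k) x))
    (hH.measurable.comp (measurable_trunc _ _)) (fun x => hC _)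
    (hH'.measurable.comp (measurable_trunc _ _)) (fun x => hC' _), hH'.integral_shift hS h]
  have h5 := h1 k hk0 hkr
  have hrp : 0 ≤ r n * p n := by positivity
  have h6 : |(∫ x, H (trunc 1 (r n) x) ∂(P n)) * ∫ x, H' (trunc 1 (r n) x) ∂(P n)| ≤
      δ / 2 * (r n * p n) := by
    rw [abs_mul]
    refine (mul_le_mul (abs_integral_le_integral_abs.trans h2)
      (abs_integral_le_integral_abs.trans h3) (abs_nonneg _) (by positivity)).trans ?_
    rw [le_div_iff₀ (by positivity)] at h4
    calc K * (r n * p n) * (K' * (r n * p n)) = r n * p n * (K * K') * (r n * p n) := by ring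
      _ ≤ _ := mul_le_mul_of_nonneg_right h4 hrp
  rw [abs_le] at *
  constructor <;> linarith

/-- The normalised covariances of the sliding blocks statistics converge to the cluster index of
the product. -/
lemma Admissible.tendsto_cov (hN : SeqNorm N) (hT : TailSmall P p r N) (hS : SeqSpace Q S)
    (h : BlockLimit P Q α p r) (hD : WeakDep P p r ℓ b) (hH : Admissible P Q p r N S H)
    (hH' : Admissible P Q p r N S H')
    (hrn : Tendsto (fun n : ℕ => (r n : ℝ) / n) atTop (𝓝 0)) :
    Tendsto (fun n : ℕ => n * p n / (numBlocks r n * r n * p n) ^ 2 *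
      ∑ i ∈ Finset.range (numBlocks r n), ∑ j ∈ Finset.range (numBlocks r n),
        blockCov (P n) (r n) H H' ((j : ℤ) - i))
      atTop (𝓝 (∫ x, H x * H' x ∂(anchored Q α))) := by
  obtain ⟨C, hC⟩ := hH.bounded
  obtain ⟨C', hC'⟩ := hH'.bounded
  have hC0 : 0 ≤ C := (abs_nonneg _).trans (hC 0)
  have hC'0 : 0 ≤ C' := (abs_nonneg _).trans (hC' 0)
  obtain ⟨K, hK, hKn⟩ := hH.abs_blockCov_le h hH'
  have hcard : ∀ n, ((Finset.Ioo (-(r n : ℤ)) (r n)).card : ℝ) ≤ 2 * r n := fun n => by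
    have : (Finset.Ioo (-(r n : ℤ)) (r n)).card ≤ 2 * r n := by rw [Int.card_Ioo]; omega
    exact_mod_cast this
  have hswap : ∀ n k, blockCov (P n) (r n) H H' (-k) = blockCov (P n) (r n) H' H k :=
    fun n k => h.blockCov_neg hS hH.shift_inv hH'.shift_inv n k
  set v := ∫ x, H x * H' x ∂(anchored Q α) with hv
  have hv' : ∫ x, H' x * H x ∂(anchored Q α) = v := by simp_rw [mul_comm, hv]
  -- in turn: the limit of the sum over the lags `|k| < r`, a bound on the sum of the absolute
  -- values, and the negligibility of the larger lags
  refine tendsto_double_sum (K := 2 * K) hrn h.r_top h.p_pos (fun δ hδ => ?_) ?_ fun δ hδ => ?_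
  · filter_upwards [Admissible.blockCov_overlap hN hT hS h hD hH hH' (half_pos hδ),
      Admissible.blockCov_overlap hN hT hS h hD hH' hH (half_pos hδ), h.p_pos] with n h1 h2 hp
    have hk : ∀ k ∈ Finset.Ioo (-(r n : ℤ)) (r n), |blockCov (P n) (r n) H H' k -
        (r n - |(k : ℝ)|) * (p n * v)| ≤ δ / 2 * (r n * p n) := by
      intro k hk
      rw [Finset.mem_Ioo] at hk
      rcases le_total 0 k with h0 | h0
      · rw [abs_of_nonneg (by exact_mod_cast h0 : (0 : ℝ) ≤ k), ← mul_assoc]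
        exact h1 k h0 hk.2.le
      · rw [abs_of_nonpos (by exact_mod_cast h0 : (k : ℝ) ≤ 0), ← mul_assoc, ← neg_neg k, hswap,
          ← hv']
        have := h2 (-k) (by omega) (by omega)
        push_cast at this ⊢
        simpa using this
    have e : (r n : ℝ) ^ 2 * p n * v =
        ∑ k ∈ Finset.Ioo (-(r n : ℤ)) (r n), (r n - |(k : ℝ)|) * (p n * v) := by
      rw [← Finset.sum_mul, sum_overlap_length]; ring
    rw [e, ← Finset.sum_sub_distrib]
    refine (Finset.abs_sum_le_sum_abs _ _).trans ((Finset.sum_le_sum hk).trans ?_)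
    rw [Finset.sum_const, nsmul_eq_mul]
    refine (mul_le_mul_of_nonneg_right (hcard n) (by positivity)).trans (le_of_eq (by ring))
  · filter_upwards [hKn, h.p_pos] with n h1 hp
    refine (Finset.sum_le_sum fun k _ => h1 k).trans ?_
    rw [Finset.sum_const, nsmul_eq_mul]
    refine (mul_le_mul_of_nonneg_right (hcard n) (by positivity)).trans (le_of_eq (by ring))
  · set D := 4 * C * C' with hDdef
    have hD0 : 0 ≤ D := by positivity
    filter_upwards [hKn, hD.sum_le (δ / (4 * (D + 1))) (by positivity),
      hD.gap_le (δ / (4 * K)) (by positivity), h.p_pos, h.r_top.eventually_ge_atTop 1]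
      with n h1 h2 h3 hp hr M
    have hr1 : (1 : ℝ) ≤ r n := by exact_mod_cast hr
    refine (sum_far_le (fun k => abs_nonneg _) (a := r n) (a' := -(r n : ℤ)) (b := b) (ℓ := ℓ n)
      (A := K * (r n * p n)) (D := D) (by positivity) hD0 hD.nonneg h1
      (fun k => hD.abs_blockCov_le h hH.measurable hH'.measurable hC hC' n k) (fun k => ?_) h2 _
      fun k hk => ?_).trans ?_
    · rw [show -(r n : ℤ) - k = -(r n + k) by ring, hswap, hDdef, mul_assoc 4 C, mul_comm C C',
        ← mul_assoc 4]
      exact hD.abs_blockCov_le h hH'.measurable hH.measurable hC' hC n k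
    · simp only [Finset.mem_sdiff, Finset.mem_Ioo] at hk
      omega
    · have h4 : (ℓ n : ℝ) * (K * (r n * p n)) ≤ δ / (4 * K) * r n * (K * (r n * p n)) :=
        mul_le_mul_of_nonneg_right h3 (by positivity)
      have h5 : δ / (4 * K) * r n * (K * (r n * p n)) = δ / 4 * (r n ^ 2 * p n) := by field_simp
      have h6 : D * (δ / (4 * (D + 1)) * (r n * p n)) ≤ δ / 4 * (r n * p n) := by
        have : D * (δ / (4 * (D + 1)) * (r n * p n)) = D / (D + 1) * (δ / 4 * (r n * p n)) := by
          field_simp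
        rw [this]
        exact mul_le_of_le_one_left (by positivity) ((div_le_one (by positivity)).2 (by linarith))
      have h7 : δ / 4 * (r n * p n) ≤ δ / 4 * (r n ^ 2 * p n) := by
        refine mul_le_mul_of_nonneg_left (mul_le_mul_of_nonneg_right ?_ hp.le) (by positivity)
        rw [sq]; exact le_mul_of_one_le_left (by positivity) hr1
      linarith

end limits

/-! ### Covariances with the exceedance functional -/

/-- The indicator of an exceedance of the level `s`. -/
noncomputable def exceed {E : Type*} [NormedAddCommGroup E] (s : ℝ) : E → ℝ :=
  {z : E | s < ‖z‖}.indicator 1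

/-- The number of exceedances of the level `s` (zero if there are infinitely many). -/
noncomputable def countExceed {E : Type*} [NormedAddCommGroup E] (s : ℝ) (x : ℤ → E) : ℝ :=
  ∑' j, exceed s (x j)

section exceedances

variable {E : Type*} [NormedAddCommGroup E] [NormedSpace ℝ E] [MeasurableSpace E] [BorelSpace E]
  [SecondCountableTopology E]
variable {P : ℕ → Measure (ℤ → E)} {Q : Measure (ℤ → E)} {α : ℝ} {p : ℕ → ℝ} {r ℓ : ℕ → ℕ}
  {b : ℕ → ℝ}
variable {N : (ℤ → E) → ℝ≥0∞} {S : Set (ℤ → E)} {H H' F F' : (ℤ → E) → ℝ}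

lemma measurable_exceed (s : ℝ) : Measurable (exceed (E := E) s) :=
  measurable_const.indicator (measurableSet_lt measurable_const measurable_norm)

lemma exceed_nonneg (s : ℝ) (z : E) : 0 ≤ exceed s z :=
  Set.indicator_nonneg (fun _ _ => zero_le_one) z

lemma exceed_le_one (s : ℝ) (z : E) : exceed s z ≤ 1 :=
  Set.indicator_le_self' (fun _ _ => zero_le_one) z

lemma abs_exceed_le (s : ℝ) (z : E) : |exceed s z| ≤ 1 := by
  rw [abs_of_nonneg (exceed_nonneg s z)]; exact exceed_le_one s z

lemma exceed_eq_zero {s : ℝ} {z : E} (h : ‖z‖ ≤ s) : exceed s z = 0 :=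
  Set.indicator_of_notMem (s := {z : E | s < ‖z‖}) (not_lt.2 h) _

lemma exceed_eq_one {s : ℝ} {z : E} (h : s < ‖z‖) : exceed s z = 1 :=
  Set.indicator_of_mem (s := {z : E | s < ‖z‖}) h _

lemma rescale_exc {s : ℝ} (hs : 0 < s) : rescale s exc = countExceed (E := E) s := by
  funext x
  refine tsum_congr fun j => ?_
  have : 1 < ‖(s⁻¹ • x) j‖ ↔ s < ‖x j‖ := by
    rw [Pi.smul_apply, norm_smul, Real.norm_eq_abs, abs_of_pos (inv_pos.2 hs), ← div_eq_inv_mul,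
      lt_div_iff₀ hs, one_mul]
  simp only [this, exceed, Set.indicator_apply, Set.mem_ofPred_eq, Pi.one_apply]

lemma countExceed_shift (s : ℝ) (k : ℤ) (x : ℤ → E) :
    countExceed s (shift k x) = countExceed s x :=
  (Equiv.addRight k).tsum_eq fun j => exceed s (x j)

lemma countExceed_trunc {s : ℝ} (hs : 0 < s) (a c : ℤ) (x : ℤ → E) :
    countExceed s (trunc a c x) = ∑ j ∈ Finset.Icc a c, exceed s (x j) := by
  rw [countExceed, tsum_eq_sum (s := Finset.Icc a c)]
  · refine Finset.sum_congr rfl fun j hj => ?_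
    rw [trunc_apply, if_pos (Finset.mem_Icc.1 hj)]
  · intro j hj
    rw [trunc_apply, if_neg (fun h => hj (Finset.mem_Icc.2 h))]
    exact exceed_eq_zero (by simpa using hs.le)

lemma measurable_exceed_apply (s : ℝ) (j : ℤ) : Measurable fun x : ℤ → E => exceed s (x j) :=
  (measurable_exceed s).comp (measurable_pi_apply j)

/-- The cluster index of the product of a bounded functional with the number of exceedances. -/
lemma BlockLimit.integral_anchored_countExceed (h : BlockLimit P Q α p r) (hS : SeqSpace Q S)
    (hm : Measurable H) {C : ℝ} (hC : ∀ x, |H x| ≤ C)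
    (hinv : ∀ x ∈ S, ∀ k, H (shift k x) = H x) {s : ℝ} (hs : 0 < s) :
    Integrable (fun x => H x * countExceed s x) (anchored Q α) ∧
      ∫ x, H x * countExceed s x ∂(anchored Q α) = s ^ (-α) * ∫ y, H (s • y) ∂Q := by
  have h1 := h.integral_anchored hS hs (w := exceed s) (measurable_exceed s) (exceed_nonneg s)
    (exceed_le_one s) (fun z hz => exceed_eq_zero hz) hm hC hinv
  have e : (fun x => H x * countExceed s x) = fun x => (∑' j, exceed s (x j)) * H x := by
    funext x; rw [mul_comm]; rfl
  rw [e]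
  refine ⟨h1.1, h1.2.trans ?_⟩
  congr 1
  refine integral_congr_ae ?_
  filter_upwards [h.one_lt_norm] with y hy
  rw [exceed_eq_one, one_mul]
  rw [norm_smul, Real.norm_eq_abs, abs_of_pos hs]
  exact lt_mul_of_one_lt_right hs hy

/-- The covariance of a functional of the block with an exceedance at time `l`. -/
noncomputable def exceedCov (P : Measure (ℤ → E)) (r : ℕ) (H : (ℤ → E) → ℝ) (s : ℝ) (l : ℤ) : ℝ :=
  cov[fun x => H (trunc 1 r x), fun x => exceed s (x l); P]

/-- The covariance with the number of exceedances of the block at lag `k` is the sum of the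
covariances with the exceedances at the times of that block. -/
lemma BlockLimit.blockCov_countExceed (h : BlockLimit P Q α p r) (hm : Measurable H) {C : ℝ}
    (hC : ∀ x, |H x| ≤ C) {s : ℝ} (hs : 0 < s) (n : ℕ) (k : ℤ) :
    blockCov (P n) (r n) H (countExceed s) k =
      ∑ l ∈ Finset.Icc (1 : ℤ) (r n), exceedCov (P n) (r n) H s (k + l) := by
  have := h.prob n
  simp_rw [blockCov, countExceed_trunc hs]
  rw [covariance_fun_sum_right' (fun l _ => memLp_of_abs_le (measurable_exceed_apply s l)
    fun x => abs_exceed_le s _) (memLp_of_abs_le (f := fun x => H (trunc 1 (r n) x))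
      (hm.comp (measurable_trunc _ _)) fun x => hC _)]
  refine Finset.sum_bij' (fun l _ => l - k) (fun l _ => k + l) ?_ ?_ ?_ ?_ ?_
  · intro l hl; rw [Finset.mem_Icc] at hl ⊢; omega
  · intro l hl; rw [Finset.mem_Icc] at hl ⊢; omega
  · intro l _; ring
  · intro l _; ring
  · intro l _; rw [exceedCov, add_sub_cancel]

/-- The trivial bound on the covariance of a block with an exceedance, uniform in its time. -/
lemma BlockLimit.abs_exceedCov_le (h : BlockLimit P Q α p r) (hm : Measurable H) {C : ℝ}
    (hC : ∀ x, |H x| ≤ C) {s : ℝ} (hs : 0 < s) :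
    ∀ᶠ n in atTop, ∀ l, |exceedCov (P n) (r n) H s l| ≤ 2 * C * ((s ^ (-α) + 1) * p n) := by
  have hC0 : 0 ≤ C := (abs_nonneg _).trans (hC 0)
  filter_upwards [h.tail_le hs] with n hn l
  have := h.prob n
  rw [exceedCov, covariance_comm]
  refine (abs_cov_le_of_bound (measurable_exceed_apply s l) (fun x => abs_exceed_le s _)
    (hm.comp (measurable_trunc _ _)) fun x => hC _).trans ?_
  refine mul_le_mul_of_nonneg_left (le_trans (le_of_eq ?_) hn) (by positivity)
  simp_rw [abs_of_nonneg (exceed_nonneg s _)]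
  rw [← h.real_exceed n l s]
  exact integral_indicator_one (measurableSet_exceed s l)

/-- The mixing bound on the covariance of a block with an exceedance after or before it. -/
lemma WeakDep.abs_exceedCov_le (hD : WeakDep P p r ℓ b) (h : BlockLimit P Q α p r)
    (hm : Measurable H) {C : ℝ} (hC : ∀ x, |H x| ≤ C) (s : ℝ) (n k : ℕ) :
    |exceedCov (P n) (r n) H s (r n + 1 + k)| ≤ 4 * C * b k ∧
      |exceedCov (P n) (r n) H s (0 - k)| ≤ 4 * C * b k := by
  have := h.prob n
  have hC0 : 0 ≤ C := (abs_nonneg _).trans (hC 0)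
  have hb : b (k + 1) ≤ b k := hD.antitone (Nat.le_succ k)
  have ht : ∀ (l : ℤ) (x : ℤ → E), exceed s (trunc l l x l) = exceed s (x l) := fun l x => by
    rw [trunc_apply, if_pos ⟨le_rfl, le_rfl⟩]
  constructor
  · have h1 := hD.cov_le n (k + 1) 1 (r n) (r n + 1 + k) H (fun x => exceed s (x (r n + 1 + k))) C 1
      hm (measurable_exceed_apply s _) hC fun x => abs_exceed_le s _
    rw [show (r n : ℤ) + ((k + 1 : ℕ) : ℤ) = r n + 1 + k by push_cast; ring] at h1
    simp only [ht] at h1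
    rw [exceedCov, cov_eq_sub_of_bound (f := fun x => H (trunc 1 (r n) x))
      (hm.comp (measurable_trunc _ _)) (fun x => hC _) (measurable_exceed_apply s _)
      fun x => abs_exceed_le s _]
    refine h1.trans ?_
    rw [mul_one]
    exact mul_le_mul_of_nonneg_left hb (by positivity)
  · have h1 := hD.cov_le n (k + 1) (0 - k) (0 - k) (r n) (fun x => exceed s (x (0 - k))) H 1 C
      (measurable_exceed_apply s _) hm (fun x => abs_exceed_le s _) hC
    rw [show (0 : ℤ) - k + ((k + 1 : ℕ) : ℤ) = 1 by push_cast; ring] at h1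
    simp only [ht] at h1
    rw [exceedCov, covariance_comm, cov_eq_sub_of_bound (g := fun x => H (trunc 1 (r n) x))
      (measurable_exceed_apply s _) (fun x => abs_exceed_le s _)
      (hm.comp (measurable_trunc _ _)) fun x => hC _]
    refine h1.trans ?_
    rw [mul_one]
    exact mul_le_mul_of_nonneg_left hb (by positivity)

/-- The exceedances outside the block are asymptotically uncorrelated with the block. -/
lemma WeakDep.sum_exceedCov_far_le (hD : WeakDep P p r ℓ b) (h : BlockLimit P Q α p r)
    (hm : Measurable H) {C : ℝ} (hC : ∀ x, |H x| ≤ C) {s δ : ℝ} (hs : 0 < s) (hδ : 0 < δ) :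
    ∀ᶠ n in atTop, ∀ T : Finset ℤ, (∀ l ∈ T, (r n : ℤ) + 1 ≤ l ∨ l ≤ 0) →
      ∑ l ∈ T, |exceedCov (P n) (r n) H s l| ≤ δ * (r n * p n) := by
  have hC0 : 0 ≤ C := (abs_nonneg _).trans (hC 0)
  set A := 2 * (C + 1) * (s ^ (-α) + 1) with hA
  have hA0 : 0 < A := by positivity
  set D := 4 * (C + 1) with hDdef
  have hD0 : 0 < D := by positivity
  filter_upwards [h.abs_exceedCov_le hm (C := C + 1) (fun x => (hC x).trans (by linarith)) hs,
    hD.sum_le (δ / (4 * D)) (by positivity), hD.gap_le (δ / (4 * A)) (by positivity), h.p_pos]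
    with n h1 h2 h3 hp T hT
  have hb := hD.abs_exceedCov_le h hm (C := C + 1) (fun x => (hC x).trans (by linarith)) s n
  refine (sum_far_le (fun l => abs_nonneg _) (b := b) (ℓ := ℓ n) (A := A * p n) (D := D)
    (by positivity) hD0.le hD.nonneg (fun l => (h1 l).trans (le_of_eq (by rw [hA]; ring)))
    (fun k => (hb k).1) (fun k => (hb k).2) h2 T hT).trans ?_
  have h4 : (ℓ n : ℝ) * (A * p n) ≤ δ / (4 * A) * r n * (A * p n) :=
    mul_le_mul_of_nonneg_right h3 (by positivity)
  have h5 : δ / (4 * A) * r n * (A * p n) = δ / 4 * (r n * p n) := by field_simp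
  have h6 : D * (δ / (4 * D) * (r n * p n)) = δ / 4 * (r n * p n) := by field_simp
  linarith [h4, h5, h6, show 0 ≤ r n * p n by positivity]

/-- The exceedances inside the block. -/
lemma Admissible.sum_exceedCov (hN : SeqNorm N) (hT : TailSmall P p r N) (hS : SeqSpace Q S)
    (h : BlockLimit P Q α p r) (hH : Admissible P Q p r N S H) {s δ : ℝ} (hs : 0 < s)
    (hδ : 0 < δ) :
    ∀ᶠ n in atTop, |∑ l ∈ Finset.Icc (1 : ℤ) (r n), exceedCov (P n) (r n) H s l -
      (s ^ (-α) * ∫ y, H (s • y) ∂Q) * (r n * p n)| ≤ δ * (r n * p n) := by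
  obtain ⟨C, hC⟩ := hH.bounded
  obtain ⟨K, hK, hKn⟩ := hH.integral_abs_le h
  filter_upwards [h.eventually_sum_center hN hT hs hH.measurable hC (hH.finCont s hs) (half_pos hδ),
    hKn, h.p_pos, h.tail_le hs,
    h.rp_zero.eventually_le_const (show 0 < δ / 2 / (K * (s ^ (-α) + 1)) by positivity)]
    with n h1 h2 hp h3 h4
  have := h.prob n
  have e : ∀ l, exceedCov (P n) (r n) H s l =
      ∫ x in {x | s < ‖x 0‖}, H (trunc (1 - l) (r n - l) x) ∂(P n) -
        (∫ x, H (trunc 1 (r n) x) ∂(P n)) * (P n).real {x | s < ‖x 0‖} := by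
    intro l
    rw [exceedCov, cov_eq_sub_of_bound (f := fun x => H (trunc 1 (r n) x))
      (hH.measurable.comp (measurable_trunc _ _)) (fun x => hC _) (measurable_exceed_apply s _)
      fun x => abs_exceed_le s _]
    congr 1
    · rw [← h.setIntegral_shift n l {x | s < ‖x 0‖} fun x => H (trunc (1 - l) (r n - l) x),
        ← integral_indicator ((measurable_shift l) (measurableSet_exceed s 0))]
      refine integral_congr_ae (Eventually.of_forall fun x => ?_)
      have hmem : x ∈ shift l ⁻¹' {x : ℤ → E | s < ‖x 0‖} ↔ s < ‖x l‖ := by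
        rw [Set.mem_preimage, Set.mem_ofPred_eq, shift_apply, zero_add]
      simp only [hS.apply_trunc_shift hH.shift_inv, sub_add_cancel]
      by_cases hx : s < ‖x l‖
      · rw [Set.indicator_of_mem (hmem.2 hx), exceed_eq_one hx, mul_one]
      · rw [Set.indicator_of_notMem (fun hc => hx (hmem.1 hc)), exceed_eq_zero (not_lt.1 hx),
          mul_zero]
    · rw [← h.real_exceed n l s]
      congr 1
      exact integral_indicator_one (measurableSet_exceed s l)
  simp_rw [e]
  rw [Finset.sum_sub_distrib, Finset.sum_const, nsmul_eq_mul, card_Icc_int]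
  have hrp : 0 ≤ r n * p n := by positivity
  have h5 : |r n * ((∫ x, H (trunc 1 (r n) x) ∂(P n)) * (P n).real {x | s < ‖x 0‖})| ≤
      δ / 2 * (r n * p n) := by
    rw [abs_mul, abs_mul, abs_of_nonneg (Nat.cast_nonneg _), abs_of_nonneg measureReal_nonneg]
    refine (mul_le_mul_of_nonneg_left (mul_le_mul (abs_integral_le_integral_abs.trans h2) h3
      measureReal_nonneg (by positivity)) (Nat.cast_nonneg _)).trans ?_
    rw [le_div_iff₀ (by positivity)] at h4
    calc (r n : ℝ) * (K * (r n * p n) * ((s ^ (-α) + 1) * p n)) =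
        r n * p n * (K * (s ^ (-α) + 1)) * (r n * p n) := by ring
      _ ≤ _ := mul_le_mul_of_nonneg_right h4 hrp
  rw [abs_le] at *
  constructor <;> linarith

/-- The normalised covariances of the sliding blocks statistics of a functional and of the number
of exceedances. -/
lemma Admissible.tendsto_cov_countExceed (hN : SeqNorm N) (hT : TailSmall P p r N)
    (hS : SeqSpace Q S) (h : BlockLimit P Q α p r) (hD : WeakDep P p r ℓ b)
    (hH : Admissible P Q p r N S H) (hrn : Tendsto (fun n : ℕ => (r n : ℝ) / n) atTop (𝓝 0))
    {s : ℝ} (hs : 0 < s) :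
    Tendsto (fun n : ℕ => n * p n / (numBlocks r n * r n * p n) ^ 2 *
      ∑ i ∈ Finset.range (numBlocks r n), ∑ j ∈ Finset.range (numBlocks r n),
        blockCov (P n) (r n) H (countExceed s) ((j : ℤ) - i))
      atTop (𝓝 (s ^ (-α) * ∫ y, H (s • y) ∂Q)) := by
  obtain ⟨C, hC⟩ := hH.bounded
  have hC0 : 0 ≤ C := (abs_nonneg _).trans (hC 0)
  set v := s ^ (-α) * ∫ y, H (s • y) ∂Q with hv
  have habs : ∀ n k, |blockCov (P n) (r n) H (countExceed s) k| ≤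
      ∑ l ∈ Finset.Icc (1 : ℤ) (r n), |exceedCov (P n) (r n) H s (k + l)| := fun n k => by
    rw [h.blockCov_countExceed hH.measurable hC hs]
    exact Finset.abs_sum_le_sum_abs _ _
  have hmove : ∀ (T : Finset ℤ) (l : ℤ) (f : ℤ → ℝ),
      ∑ k ∈ T, f (k + l) = ∑ k ∈ T.image fun k => k + l, f k := fun T l f =>
    (Finset.sum_image fun a _ c _ hac => by simpa using hac).symm
  -- after exchanging the sums over the lag `k` and over the position `l`, the times `k + l` run
  -- through a translate of the set of lags
  refine tendsto_double_sum (K := 2 * (2 * C * (s ^ (-α) + 1))) hrn h.r_top h.p_pos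
    (fun δ hδ => ?_) ?_ fun δ hδ => ?_
  · filter_upwards [hH.sum_exceedCov hN hT hS h hs (half_pos hδ),
      hD.sum_exceedCov_far_le h hH.measurable hC hs (half_pos hδ), h.p_pos] with n h1 h2 hp
    simp_rw [h.blockCov_countExceed hH.measurable hC hs]
    rw [Finset.sum_comm]
    have e : (r n : ℝ) ^ 2 * p n * v =
        ∑ l ∈ Finset.Icc (1 : ℤ) (r n), v * (r n * p n) := by
      rw [Finset.sum_const, nsmul_eq_mul, card_Icc_int]; ring
    rw [e, ← Finset.sum_sub_distrib]
    refine (Finset.abs_sum_le_sum_abs _ _).trans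
      ((Finset.sum_le_sum (g := fun _ => δ * (r n * p n)) fun l hl => ?_).trans (le_of_eq ?_))
    · rw [Finset.mem_Icc] at hl
      rw [hmove _ l fun k => exceedCov (P n) (r n) H s k]
      set T := (Finset.Ioo (-(r n : ℤ)) (r n)).image fun k => k + l with hTdef
      -- every window of lags contains the block itself
      have hsub : Finset.Icc (1 : ℤ) (r n) ⊆ T := by
        intro k hk
        rw [Finset.mem_Icc] at hk
        exact Finset.mem_image.2 ⟨k - l, Finset.mem_Ioo.2 ⟨by omega, by omega⟩, by ring⟩
      rw [← Finset.sum_sdiff hsub]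
      have h3 := (Finset.abs_sum_le_sum_abs (fun k => exceedCov (P n) (r n) H s k)
        (T \ Finset.Icc (1 : ℤ) (r n))).trans (h2 _ fun k hk => by
          rw [Finset.mem_sdiff, Finset.mem_Icc] at hk; omega)
      rw [abs_le] at *
      constructor <;> linarith
    · rw [Finset.sum_const, nsmul_eq_mul, card_Icc_int]; ring
  · filter_upwards [h.abs_exceedCov_le hH.measurable hC hs, h.p_pos] with n h1 hp
    refine (Finset.sum_le_sum fun k _ => (habs n k).trans
      (Finset.sum_le_sum fun l _ => h1 (k + l))).trans ?_
    rw [Finset.sum_const, Finset.sum_const, nsmul_eq_mul, nsmul_eq_mul, card_Icc_int]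
    have : ((Finset.Ioo (-(r n : ℤ)) (r n)).card : ℝ) ≤ 2 * r n := by
      have : (Finset.Ioo (-(r n : ℤ)) (r n)).card ≤ 2 * r n := by rw [Int.card_Ioo]; omega
      exact_mod_cast this
    exact (mul_le_mul_of_nonneg_right this (by positivity)).trans (le_of_eq (by ring))
  · filter_upwards [hD.sum_exceedCov_far_le h hH.measurable hC hs hδ] with n h2 M
    refine (Finset.sum_le_sum fun k _ => habs n k).trans ?_
    rw [Finset.sum_comm]
    refine (Finset.sum_le_sum (g := fun _ => δ * (r n * p n)) fun l hl => ?_).trans (le_of_eq ?_)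
    · rw [Finset.mem_Icc] at hl
      rw [hmove _ l fun k => |exceedCov (P n) (r n) H s k|]
      refine h2 _ fun k hk => ?_
      obtain ⟨j, hj, rfl⟩ := Finset.mem_image.1 hk
      simp only [Finset.mem_sdiff, Finset.mem_Ioo] at hj
      omega
    · rw [Finset.sum_const, nsmul_eq_mul, card_Icc_int]; ring

end exceedances

/-! ### The covariance inequality for β-mixing -/

section mixing

variable {Ω : Type*} {m m₁ m₂ m0 : MeasurableSpace Ω} {μ : Measure Ω} [IsProbabilityMeasure μ]

/-- The function equal to `1` on `A` and to `-1` off `A`. -/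
noncomputable def signOf (A : Set Ω) : Ω → ℝ := fun ω => 2 * A.indicator 1 ω - 1

lemma abs_signOf (A : Set Ω) (ω : Ω) : |signOf A ω| ≤ 1 := by
  by_cases h : ω ∈ A
  · simp [signOf, h]; norm_num
  · simp [signOf, h]

lemma measurable_signOf {A : Set Ω} (hA : MeasurableSet[m] A) :
    Measurable[m] (signOf A) :=
  ((measurable_const.indicator hA).const_mul 2).sub_const 1

/-- Among the functions bounded by `C` which are measurable with respect to a sub-σ-field, the
covariance with a given variable is largest for `C` times the sign of the centred conditional
expectation. -/
lemma exists_abs_cov_le_sign (hm : m ≤ m0) {f g : Ω → ℝ} {C C' : ℝ}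
    (hf : Measurable[m] f) (hg : Measurable g) (hC : ∀ ω, |f ω| ≤ C) (hC' : ∀ ω, |g ω| ≤ C') :
    ∃ A, MeasurableSet[m] A ∧ |∫ ω, f ω * g ω ∂μ - (∫ ω, f ω ∂μ) * ∫ ω, g ω ∂μ| ≤
      C * (∫ ω, signOf A ω * g ω ∂μ - (∫ ω, signOf A ω ∂μ) * ∫ ω, g ω ∂μ) := by
  have hgi : Integrable g μ := Integrable.of_bound hg.aestronglyMeasurable C'
    (Eventually.of_forall hC')
  set D : Ω → ℝ := fun ω => (μ[g|m]) ω - ∫ ω, g ω ∂μ with hD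
  have hDm : Measurable[m] D := stronglyMeasurable_condExp.measurable.sub_const _
  have hDi : Integrable D μ := integrable_condExp.sub (integrable_const _)
  have key : ∀ (h : Ω → ℝ) (K : ℝ), Measurable[m] h → (∀ ω, |h ω| ≤ K) →
      ∫ ω, h ω * g ω ∂μ - (∫ ω, h ω ∂μ) * ∫ ω, g ω ∂μ = ∫ ω, h ω * D ω ∂μ := by
    intro h K hh hK
    have hhm : AEStronglyMeasurable h μ := (hh.mono hm le_rfl).aestronglyMeasurable
    have hhi : Integrable h μ := Integrable.of_bound hhm K (Eventually.of_forall hK)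
    have hhg : Integrable (h * g) μ := hgi.bdd_mul hhm (Eventually.of_forall hK)
    have hhc : Integrable (fun ω => h ω * (μ[g|m]) ω) μ :=
      integrable_condExp.bdd_mul hhm (Eventually.of_forall hK)
    have e1 : ∫ ω, h ω * g ω ∂μ = ∫ ω, h ω * (μ[g|m]) ω ∂μ := by
      have := integral_condExp (μ := μ) (f := h * g) hm
      rw [show ∫ ω, h ω * g ω ∂μ = ∫ ω, (h * g) ω ∂μ from rfl, ← this]
      exact integral_congr_ae (condExp_mul_of_stronglyMeasurable_left hh.stronglyMeasurable hhg hgi)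
    simp_rw [hD, mul_sub]
    rw [e1, integral_sub hhc (hhi.mul_const _), integral_mul_const]
  refine ⟨{ω | 0 ≤ D ω}, measurableSet_le measurable_const hDm, ?_⟩
  rw [key f C hf hC, key (signOf {ω | 0 ≤ D ω}) 1
    (measurable_signOf (measurableSet_le measurable_const hDm)) (abs_signOf _)]
  have e : ∀ ω, signOf {ω | 0 ≤ D ω} ω * D ω = |D ω| := by
    intro ω
    by_cases h : 0 ≤ D ω
    · rw [abs_of_nonneg h, signOf, Set.indicator_of_mem (show ω ∈ {ω | 0 ≤ D ω} from h)]
      simp; ring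
    · rw [abs_of_neg (not_le.1 h), signOf,
        Set.indicator_of_notMem (show ω ∉ {ω | 0 ≤ D ω} from h)]
      ring
  simp_rw [e]
  rw [← integral_const_mul]
  refine abs_integral_le_integral_abs.trans (integral_mono_of_nonneg
    (Eventually.of_forall fun _ => abs_nonneg _) (hDi.abs.const_mul C)
    (Eventually.of_forall fun ω => ?_))
  simp only [abs_mul]
  exact mul_le_mul_of_nonneg_right (hC ω) (abs_nonneg _)

lemma isFinPartition_pair {A : Set Ω} (hA : MeasurableSet[m] A) :
    IsFinPartition m ![A, Aᶜ] := by
  refine ⟨fun i => ?_, fun i j hij => ?_, ?_⟩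
  · fin_cases i
    · exact hA
    · exact hA.compl
  · fin_cases i <;> fin_cases j <;> simp_all [disjoint_compl_right, disjoint_compl_left]
  · ext ω
    simp only [Set.mem_iUnion, Fin.exists_fin_two, Matrix.cons_val_zero, Matrix.cons_val_one,
      Set.mem_univ, iff_true]
    exact em _

/-- The strong mixing coefficient is at most half the β-mixing coefficient. -/
lemma ofReal_two_mul_abs_le_betaCoeff (h₁ : m₁ ≤ m0) (h₂ : m₂ ≤ m0)
    {A B : Set Ω} (hA : MeasurableSet[m₁] A) (hB : MeasurableSet[m₂] B) :
    ENNReal.ofReal (2 * |μ.real (A ∩ B) - μ.real A * μ.real B|) ≤ betaCoeff μ m₁ m₂ := by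
  have hA' := h₁ _ hA
  have hB' := h₂ _ hB
  have h1 : μ.real (A ∩ Bᶜ) = μ.real A - μ.real (A ∩ B) := by
    have h4 := measureReal_inter_add_sdiff (μ := μ) (s := A) hB'
    rw [Set.sdiff_eq] at h4; linarith
  have h2 : μ.real (Aᶜ ∩ B) = μ.real B - μ.real (A ∩ B) := by
    have h4 := measureReal_inter_add_sdiff (μ := μ) (s := B) hA'
    rw [Set.sdiff_eq, Set.inter_comm B, Set.inter_comm B] at h4; linarith
  have h3 : μ.real (Aᶜ ∩ Bᶜ) = 1 - μ.real A - μ.real B + μ.real (A ∩ B) := by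
    have h4 := measureReal_inter_add_sdiff (μ := μ) (s := Aᶜ) hB'
    rw [Set.sdiff_eq, h2, probReal_compl_eq_one_sub hA'] at h4
    linarith
  unfold betaCoeff
  refine le_iSup₂_of_le 2 2 (le_iSup₂_of_le ![A, Aᶜ] ![B, Bᶜ] (le_iSup₂_of_le
    (isFinPartition_pair hA) (isFinPartition_pair hB) (le_of_eq ?_)))
  congr 1
  simp only [Fin.sum_univ_two, Matrix.cons_val_zero, Matrix.cons_val_one, h1, h2, h3,
    probReal_compl_eq_one_sub hA', probReal_compl_eq_one_sub hB']
  set d := μ.real (A ∩ B) - μ.real A * μ.real B with hd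
  rw [show μ.real A - μ.real (A ∩ B) - μ.real A * (1 - μ.real B) = -d by rw [hd]; ring,
    show μ.real B - μ.real (A ∩ B) - (1 - μ.real A) * μ.real B = -d by rw [hd]; ring,
    show 1 - μ.real A - μ.real B + μ.real (A ∩ B) - (1 - μ.real A) * (1 - μ.real B) = d by
      rw [hd]; ring, abs_neg]
  ring

/-- The covariance inequality for β-mixing σ-fields. Replacing first `f` and then `g` by a sign
reduces it to the covariance of two events. The coefficient is truncated at `1`, so that it may be
read in the reals. -/
lemma abs_cov_le_betaCoeff (h₁ : m₁ ≤ m0) (h₂ : m₂ ≤ m0)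
    {f g : Ω → ℝ} {C C' : ℝ} (hf : Measurable[m₁] f) (hg : Measurable[m₂] g)
    (hC : ∀ ω, |f ω| ≤ C) (hC' : ∀ ω, |g ω| ≤ C') :
    |∫ ω, f ω * g ω ∂μ - (∫ ω, f ω ∂μ) * ∫ ω, g ω ∂μ| ≤
      4 * C * C' * (min (betaCoeff μ m₁ m₂) 1).toReal := by
  obtain ⟨ω0⟩ := nonempty_of_isProbabilityMeasure μ
  have hC0 : 0 ≤ C := (abs_nonneg _).trans (hC ω0)
  have hC'0 : 0 ≤ C' := (abs_nonneg _).trans (hC' ω0)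
  obtain ⟨A, hA, h3⟩ := exists_abs_cov_le_sign (μ := μ) h₁ hf (hg.mono h₂ le_rfl) hC hC'
  have hA' := h₁ _ hA
  obtain ⟨B, hB, h4⟩ := exists_abs_cov_le_sign (μ := μ) h₂ hg (measurable_signOf hA') hC'
    (abs_signOf A)
  have hB' := h₂ _ hB
  have hi : ∀ {A : Set Ω}, MeasurableSet A → Integrable (A.indicator (1 : Ω → ℝ)) μ := fun hA =>
    (integrable_const 1).indicator hA
  have hs : ∀ {A : Set Ω}, MeasurableSet A → ∫ ω, signOf A ω ∂μ = 2 * μ.real A - 1 := by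
    intro A hA
    simp only [signOf]
    rw [integral_sub ((hi hA).const_mul 2) (integrable_const _), integral_const_mul,
      integral_indicator_one hA]
    simp
  have hAB : ∫ ω, signOf B ω * signOf A ω ∂μ =
      4 * μ.real (A ∩ B) - 2 * μ.real A - 2 * μ.real B + 1 := by
    have e : ∀ ω, signOf B ω * signOf A ω = 4 * (A ∩ B).indicator 1 ω - 2 * A.indicator 1 ω -
        2 * B.indicator 1 ω + 1 := by
      intro ω
      by_cases ha : ω ∈ A <;> by_cases hb : ω ∈ B <;> simp [signOf, ha, hb] <;> norm_num
    simp_rw [e]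
    have i1 : Integrable (fun ω => 4 * (A ∩ B).indicator (1 : Ω → ℝ) ω) μ :=
      (hi (hA'.inter hB')).const_mul 4
    have i2 : Integrable (fun ω => 2 * A.indicator (1 : Ω → ℝ) ω) μ := (hi hA').const_mul 2
    have i3 : Integrable (fun ω => 2 * B.indicator (1 : Ω → ℝ) ω) μ := (hi hB').const_mul 2
    have i4 : Integrable (fun ω => 4 * (A ∩ B).indicator (1 : Ω → ℝ) ω -
      2 * A.indicator (1 : Ω → ℝ) ω) μ := i1.sub i2
    have i5 : Integrable (fun ω => 4 * (A ∩ B).indicator (1 : Ω → ℝ) ω -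
      2 * A.indicator (1 : Ω → ℝ) ω - 2 * B.indicator (1 : Ω → ℝ) ω) μ := i4.sub i3
    rw [integral_add i5 (integrable_const _), integral_sub i4 i3, integral_sub i1 i2,
      integral_const_mul, integral_const_mul, integral_const_mul,
      integral_indicator_one (hA'.inter hB'), integral_indicator_one hA',
      integral_indicator_one hB']
    simp
  rw [hAB, hs hA', hs hB'] at h4
  set d := μ.real (A ∩ B) - μ.real A * μ.real B with hd
  have h5 : ∫ ω, signOf A ω * g ω ∂μ - (∫ ω, signOf A ω ∂μ) * ∫ ω, g ω ∂μ ≤ C' * (4 * d) := by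
    have e : ∫ ω, signOf A ω * g ω ∂μ - (∫ ω, signOf A ω ∂μ) * ∫ ω, g ω ∂μ =
        ∫ ω, g ω * signOf A ω ∂μ - (∫ ω, g ω ∂μ) * (2 * μ.real A - 1) := by
      simp_rw [mul_comm (signOf A _), hs hA']; ring
    rw [e]
    refine (le_abs_self _).trans (h4.trans (le_of_eq ?_))
    rw [hd]; ring
  have h6 : d ≤ (min (betaCoeff μ m₁ m₂) 1).toReal := by
    have h7 := ofReal_two_mul_abs_le_betaCoeff (μ := μ) h₁ h₂ hA hB
    have h8 : |d| ≤ 1 := abs_le.2 ⟨by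
      have := mul_le_one₀ (measureReal_le_one (μ := μ) (s := A)) measureReal_nonneg
        (measureReal_le_one (μ := μ) (s := B))
      have := measureReal_nonneg (μ := μ) (s := A ∩ B)
      linarith, by
      have := measureReal_le_one (μ := μ) (s := A ∩ B)
      have := mul_nonneg (measureReal_nonneg (μ := μ) (s := A))
        (measureReal_nonneg (μ := μ) (s := B))
      linarith⟩
    refine (le_abs_self d).trans ((ENNReal.ofReal_le_iff_le_toReal
      (ne_top_of_le_ne_top ENNReal.one_ne_top (min_le_right _ _))).1 (le_min ?_ ?_))
    · exact (ENNReal.ofReal_le_ofReal (by linarith [abs_nonneg d])).trans h7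
    · rw [← ENNReal.ofReal_one]; exact ENNReal.ofReal_le_ofReal h8
  calc _ ≤ C * (C' * (4 * d)) := h3.trans (mul_le_mul_of_nonneg_left h5 hC0)
    _ ≤ C * (C' * (4 * (min (betaCoeff μ m₁ m₂) 1).toReal)) := by gcongr
    _ = _ := by ring

end mixing

/-! ### From the time series to its path space -/

/-- The path of the series rescaled by `u`. -/
noncomputable def scaledPath {Ω E : Type*} [NormedAddCommGroup E] [NormedSpace ℝ E]
    (X : ℤ → Ω → E) (u : ℝ) (ω : Ω) : ℤ → E := fun j => u⁻¹ • X j ω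

/-- The law of the rescaled path. -/
noncomputable def pathLaw {Ω E : Type*} [MeasurableSpace Ω] [NormedAddCommGroup E]
    [NormedSpace ℝ E] [MeasurableSpace E] (μ : Measure Ω) (X : ℤ → Ω → E) (u : ℝ) :
    Measure (ℤ → E) := μ.map (scaledPath X u)

/-- The β-mixing rate, truncated at one to be finite. -/
noncomputable def mixRate {Ω E : Type*} [MeasurableSpace Ω] [MeasurableSpace E]
    (μ : Measure Ω) (X : ℤ → Ω → E) (k : ℕ) : ℝ := (min (betaRate μ X k) 1).toReal

section reduction

variable {Ω Ω' E : Type*} [mΩ : MeasurableSpace Ω] [MeasurableSpace Ω'] [NormedAddCommGroup E]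
  [NormedSpace ℝ E] [MeasurableSpace E] [BorelSpace E] [SecondCountableTopology E]
variable {μ : Measure Ω} [IsProbabilityMeasure μ] {μ' : Measure Ω'} [IsProbabilityMeasure μ']
variable {X : ℤ → Ω → E} {Y : ℤ → Ω' → E} {α : ℝ} {r ℓ : ℕ → ℕ} {u : ℕ → ℝ}

lemma measurable_scaledPath (hX : ∀ j, Measurable (X j)) (u : ℝ) : Measurable (scaledPath X u) :=
  measurable_pi_lambda _ fun j => (hX j).const_smul u⁻¹

lemma isProbabilityMeasure_pathLaw (hX : ∀ j, Measurable (X j)) (u : ℝ) :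
    IsProbabilityMeasure (pathLaw μ X u) :=
  Measure.isProbabilityMeasure_map (measurable_scaledPath hX u).aemeasurable

lemma pathLaw_shift (hX : ∀ j, Measurable (X j)) (hstat : IsStationary μ X) (u : ℝ) (k : ℤ) :
    (pathLaw μ X u).map (shift k) = pathLaw μ X u := by
  have hm : Measurable fun ω j => X j ω := measurable_pi_lambda _ hX
  have hm' : Measurable fun ω j => X (j + k) ω := measurable_pi_lambda _ fun j => hX _
  have hs := measurable_smul_path (E := E) u⁻¹
  have e1 : pathLaw μ X u = (μ.map fun ω j => X j ω).map (u⁻¹ • ·) := by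
    rw [pathLaw, Measure.map_map hs hm]; rfl
  conv_rhs => rw [e1, ← hstat k, Measure.map_map hs hm']
  rw [pathLaw, Measure.map_map (measurable_shift k) (measurable_scaledPath hX u)]
  rfl

lemma lt_norm_scaledPath {u : ℝ} (hu : 0 < u) (s : ℝ) (j : ℤ) (ω : Ω) :
    s < ‖scaledPath X u ω j‖ ↔ s * u < ‖X j ω‖ := by
  rw [scaledPath, norm_smul, Real.norm_eq_abs, abs_of_pos (inv_pos.2 hu), ← div_eq_inv_mul,
    lt_div_iff₀ hu]

lemma pathLaw_real (hX : ∀ j, Measurable (X j)) (u : ℝ) {A : Set (ℤ → E)} (hA : MeasurableSet A) :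
    (pathLaw μ X u).real A = μ.real (scaledPath X u ⁻¹' A) :=
  map_measureReal_apply (measurable_scaledPath hX u) hA

lemma eventually_tailProb_pos (hR : ConditionR μ X r u) :
    ∀ᶠ n in atTop, 0 < tailProb μ X (u n) := by
  filter_upwards [hR.2.2.1.eventually_gt_atTop 0] with n hn
  exact pos_of_mul_pos_right hn (Nat.cast_nonneg n)

lemma eventually_tailProb_le (hα : HasTailIndex μ X α) (hR : ConditionR μ X r u) {s : ℝ}
    (hs : 0 < s) : ∀ᶠ n in atTop, tailProb μ X (s * u n) ≤ (s ^ (-α) + 1) * tailProb μ X (u n) := by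
  filter_upwards [((hα.2 s hs).comp hR.1).eventually_lt_const (lt_add_one _),
    eventually_tailProb_pos hR] with n hn hp
  exact ((div_lt_iff₀ hp).1 hn).le

/-- The integral over an exceedance event, as a conditional expectation. -/
lemma setIntegral_eq_tailProb_mul (f : Ω → ℝ) (v : ℝ) :
    ∫ ω in {ω | v < ‖X 0 ω‖}, f ω ∂μ =
      tailProb μ X v * ∫ ω, f ω ∂(cond μ {ω | v < ‖X 0 ω‖}) := by
  rw [ProbabilityTheory.cond, integral_smul_measure, ENNReal.toReal_inv, tailProb, smul_eq_mul,
    ← mul_assoc]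
  by_cases h : μ {ω | v < ‖X 0 ω‖} = 0
  · rw [Measure.restrict_eq_zero.2 h]; simp
  · rw [measureReal_def, mul_inv_cancel₀ (ENNReal.toReal_ne_zero.2 ⟨h, measure_ne_top _ _⟩),
      one_mul]

/-- Weak convergence of the windows around an exceedance of the level `s`: the definition of the
tail process, with threshold `s * u n`, and regular variation of the tail. -/
lemma tendsto_window_of_tailProcess (hX : ∀ j, Measurable (X j)) (hY : ∀ j, Measurable (Y j))
    (hα : HasTailIndex μ X α) (htail : IsTailProcess μ X μ' Y) (hR : ConditionR μ X r u) {s : ℝ}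
    (hs : 0 < s) (m : ℕ) (F : (ℤ → E) → ℝ) (hF : Continuous F) (hC : ∃ C, ∀ x, |F x| ≤ C)
    (hFm : ∀ x, F (window m x) = F x) :
    Tendsto (fun n => (∫ x in {x | s < ‖x 0‖}, F x ∂(pathLaw μ X (u n))) / tailProb μ X (u n)) atTop
      (𝓝 (s ^ (-α) * ∫ y, F (s • y) ∂(μ'.map fun ω j => Y j ω))) := by
  obtain ⟨C, hC⟩ := hC
  -- extension of a finite window by zeros, which turns `F` into a continuous function of the window
  set ext : (Set.Icc (-(m : ℤ)) m → E) → ℤ → E := fun w j => if h : j ∈ Set.Icc (-(m : ℤ)) m then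
    w ⟨j, h⟩ else 0 with hext
  have hextc : Continuous ext := continuous_pi fun j => by
    by_cases h : j ∈ Set.Icc (-(m : ℤ)) m
    · simp only [hext, h, dite_true]; exact continuous_apply _
    · simp only [hext, h, dite_false]; exact continuous_const
  have hextw : ∀ x : ℤ → E, ext (fun l => x l) = window m x := by
    intro x; funext j
    by_cases h : j ∈ Set.Icc (-(m : ℤ)) m
    · simp only [hext, h, dite_true]; exact (if_pos h).symm
    · simp only [hext, h, dite_false]; exact (if_neg h).symm
  set f : BoundedContinuousFunction (Set.Icc (-(m : ℤ)) m → E) ℝ :=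
    BoundedContinuousFunction.ofNormedAddCommGroup (fun w => F (s • ext w))
      (hF.comp (hextc.const_smul s)) C fun w => hC _ with hf
  have hfx : ∀ x : ℤ → E, f (fun l => x l) = F (s • x) := fun x => by
    change F (s • ext fun l => x l) = _
    rw [hextw, ← hFm (s • x), window, smul_trunc]
  have hsu : Tendsto (fun n => s * u n) atTop atTop := hR.1.const_mul_atTop hs
  have h1 := (htail (-(m : ℤ)) m f).comp hsu
  have h2 := ((hα.2 s hs).comp hR.1).mul h1
  have e : ∫ y, F (s • y) ∂(μ'.map fun ω j => Y j ω) = ∫ ω, f (fun l => Y l ω) ∂μ' := by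
    rw [integral_map (f := fun y => F (s • y)) (measurable_pi_lambda _ hY).aemeasurable
      (hF.measurable.comp (measurable_smul_path s)).aestronglyMeasurable]
    exact integral_congr_ae (Eventually.of_forall fun ω => (hfx fun j => Y j ω).symm)
  rw [e]
  refine h2.congr' ?_
  filter_upwards [hR.1.eventually_gt_atTop 0] with n hu
  simp only [Function.comp_apply]
  rw [div_mul_eq_mul_div, ← setIntegral_eq_tailProb_mul, pathLaw,
    setIntegral_map (measurableSet_exceed s 0) hF.measurable.aestronglyMeasurable
      (measurable_scaledPath hX _).aemeasurable]
  congr 2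
  · congr 1
    ext ω
    exact (lt_norm_scaledPath hu s 0 ω).symm
  · funext ω
    rw [show (fun l : Set.Icc (-(m : ℤ)) m => (s * u n)⁻¹ • X l ω) =
      fun l : Set.Icc (-(m : ℤ)) m => ((fun j : ℤ => (s * u n)⁻¹ • X j ω) : ℤ → E) l from rfl,
      hfx (fun j : ℤ => (s * u n)⁻¹ • X j ω)]
    congr 1
    funext j
    simp only [Pi.smul_apply, scaledPath, smul_smul]
    congr 1
    field_simp

/-- The anticlustering condition, with the conditioning event `{‖X₀‖ > s * u n}` integrated out by
regular variation. -/
lemma anticluster_of_conditionDH (hX : ∀ j, Measurable (X j)) (hα : HasTailIndex μ X α)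
    (hR : ConditionR μ X r u) (hDH : ConditionDH μ X r u) {s η δ : ℝ} (hs : 0 < s) (hη : 0 < η)
    (hδ : 0 < δ) :
    ∀ᶠ m : ℕ in atTop, ∀ᶠ n in atTop, (pathLaw μ X (u n)).real
      {x | s < ‖x 0‖ ∧ ∃ i : ℤ, (m : ℤ) ≤ |i| ∧ |i| ≤ r n ∧ η < ‖x i‖} ≤
        δ * tailProb μ X (u n) := by
  set e := δ / (s ^ (-α) + 1) with he
  have he0 : 0 < e := by positivity
  filter_upwards [(hDH η s hη hs).eventually_lt_const (ENNReal.ofReal_pos.2 he0)] with m hm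
  filter_upwards [eventually_lt_of_limsup_lt hm, hR.1.eventually_gt_atTop 0,
    eventually_tailProb_le hα hR hs] with n hn hu h3
  have hset : MeasurableSet {x : ℤ → E | s < ‖x 0‖ ∧
      ∃ i : ℤ, (m : ℤ) ≤ |i| ∧ |i| ≤ r n ∧ η < ‖x i‖} := by
    have := (measurableSet_exceed (E := E) s 0).inter
      (measurableSet_far η fun i => (m : ℤ) ≤ |i| ∧ |i| ≤ r n)
    simp only [and_assoc] at this
    exact this
  rw [pathLaw_real hX _ hset]
  set A : Set Ω := {ω | u n * s < ‖X 0 ω‖} with hA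
  set B : Set Ω := {ω | ∃ j : ℤ, (m : ℤ) ≤ |j| ∧ |j| ≤ r n ∧ u n * η < ‖X j ω‖} with hB
  have hpre : scaledPath X (u n) ⁻¹' {x : ℤ → E | s < ‖x 0‖ ∧
      ∃ i : ℤ, (m : ℤ) ≤ |i| ∧ |i| ≤ r n ∧ η < ‖x i‖} = A ∩ B := by
    ext ω
    simp only [Set.mem_preimage, Set.mem_ofPred_eq, lt_norm_scaledPath hu, hA, hB,
      Set.mem_inter_iff, mul_comm (u n)]
  have hAm : MeasurableSet A := measurableSet_lt measurable_const (hX 0).norm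
  have hcond : μ.real (A ∩ B) ≤ e * μ.real A := by
    rw [cond_apply hAm] at hn
    rw [measureReal_def, measureReal_def, ← ENNReal.toReal_ofReal he0.le, ← ENNReal.toReal_mul]
    refine ENNReal.toReal_mono (ENNReal.mul_ne_top ENNReal.ofReal_ne_top (measure_ne_top _ _)) ?_
    by_cases h0 : μ A = 0
    · rw [measure_mono_null Set.inter_subset_left h0]; exact bot_le
    · rw [← ENNReal.div_le_iff h0 (measure_ne_top _ _), div_eq_mul_inv, mul_comm]
      exact hn.le
  have hAt : μ.real A = tailProb μ X (s * u n) := by rw [tailProb, mul_comm]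
  rw [hpre]
  refine hcond.trans ?_
  rw [hAt]
  refine (mul_le_mul_of_nonneg_left h3 he0.le).trans (le_of_eq ?_)
  rw [he]; field_simp

/-- The path space framework of a stationary regularly varying series. -/
theorem blockLimit_pathLaw (hX : ∀ j, Measurable (X j)) (hY : ∀ j, Measurable (Y j))
    (hstat : IsStationary μ X) (hα : HasTailIndex μ X α) (htail : IsTailProcess μ X μ' Y)
    (hR : ConditionR μ X r u) (hDH : ConditionDH μ X r u) :
    BlockLimit (fun n => pathLaw μ X (u n)) (μ'.map fun ω j => Y j ω) α
      (fun n => tailProb μ X (u n)) r where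
  prob _ := isProbabilityMeasure_pathLaw hX _
  probQ := Measure.isProbabilityMeasure_map (measurable_pi_lambda _ hY).aemeasurable
  α_pos := hα.1
  p_pos := eventually_tailProb_pos hR
  shift_inv _ := pathLaw_shift hX hstat _
  r_top := hR.2.1
  rp_zero := hR.2.2.2.2
  tendsto_window _ hs := tendsto_window_of_tailProcess hX hY hα htail hR hs
  anticluster _ _ _ := anticluster_of_conditionDH hX hα hR hDH

/-- The condition on small jumps, in terms of the law of the rescaled path. -/
lemma smallJumps_of_conditionANSJB (hX : ∀ j, Measurable (X j)) (hR : ConditionR μ X r u)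
    (hJ : ConditionANSJB μ X r u) :
    SmallJumps (fun n => pathLaw μ X (u n)) (fun n => tailProb μ X (u n)) r := by
  intro η δ hη hδ
  filter_upwards [(hJ η hη).eventually_lt_const (ENNReal.ofReal_pos.2 hδ)] with ε hε
  filter_upwards [eventually_lt_of_limsup_lt hε, hR.1.eventually_gt_atTop 0,
    eventually_tailProb_pos hR, hR.2.1.eventually_gt_atTop 0] with n hn hu hp hr
  have hrp : 0 < r n * tailProb μ X (u n) := mul_pos (by exact_mod_cast hr) hp
  rw [pathLaw_real hX _ (measurableSet_lt measurable_const (measurable_smallSum ε _))]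
  have hpre : scaledPath X (u n) ⁻¹' {x : ℤ → E | η < ∑ j ∈ Finset.Icc (1 : ℤ) (r n),
      if ‖x j‖ ≤ ε then ‖x j‖ else 0} = {ω | η * u n <
        ∑ j ∈ Finset.Icc (1 : ℤ) (r n), if ‖X j ω‖ ≤ ε * u n then ‖X j ω‖ else 0} := by
    ext ω
    have e1 : ∀ j, (if ‖scaledPath X (u n) ω j‖ ≤ ε then ‖scaledPath X (u n) ω j‖ else 0) =
        (if ‖X j ω‖ ≤ ε * u n then ‖X j ω‖ else 0) / u n := by
      intro j
      have e2 : ‖scaledPath X (u n) ω j‖ = ‖X j ω‖ / u n := by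
        rw [scaledPath, norm_smul, Real.norm_eq_abs, abs_of_pos (inv_pos.2 hu), div_eq_inv_mul]
      have e3 : ‖scaledPath X (u n) ω j‖ ≤ ε ↔ ‖X j ω‖ ≤ ε * u n := by rw [e2, div_le_iff₀ hu]
      by_cases hc : ‖X j ω‖ ≤ ε * u n
      · rw [if_pos (e3.2 hc), if_pos hc, e2]
      · rw [if_neg fun h => hc (e3.1 h), if_neg hc, zero_div]
    simp only [Set.mem_preimage, Set.mem_ofPred_eq, e1]
    rw [← Finset.sum_div, lt_div_iff₀ hu]
  rw [hpre, measureReal_def]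
  refine ENNReal.toReal_le_of_le_ofReal (by positivity) ?_
  rw [ENNReal.ofReal_mul hδ.le]
  refine (ENNReal.div_le_iff (ENNReal.ofReal_pos.2 hrp).ne' ENNReal.ofReal_ne_top).1 ?_
  convert hn.le

lemma betaRate_antitone : Antitone (betaRate μ X) := by
  intro k l hkl
  have hle : (⨆ (j : ℤ) (_ : (l : ℤ) ≤ j), MeasurableSpace.comap (X j) inferInstance) ≤
      ⨆ (j : ℤ) (_ : (k : ℤ) ≤ j), MeasurableSpace.comap (X j) inferInstance :=
    biSup_mono fun j hj => le_trans (by exact_mod_cast hkl) hj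
  refine iSup_mono fun M => iSup_mono fun N => iSup_mono fun A => iSup_mono fun B =>
    iSup_mono fun hA => iSup_le fun hB => le_iSup_of_le ⟨fun i => hle _ (hB.1 i), hB.2⟩ le_rfl

lemma mixRate_antitone : Antitone (mixRate μ X) := fun _ _ hkl =>
  ENNReal.toReal_mono (ne_top_of_le_ne_top ENNReal.one_ne_top (min_le_right _ _))
    (min_le_min_right _ (betaRate_antitone hkl))

/-- β-mixing yields weak dependence on path space. By stationarity the past may be taken to end at
time `0`. -/
theorem weakDep_mixRate (hX : ∀ j, Measurable (X j)) {Q : Measure (ℤ → E)}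
    (h : BlockLimit (fun n => pathLaw μ X (u n)) Q α (fun n => tailProb μ X (u n)) r)
    (hℓr : Tendsto (fun n => (ℓ n : ℝ) / r n) atTop (𝓝 0)) (hmix : MixingTail μ X r ℓ u) :
    WeakDep (fun n => pathLaw μ X (u n)) (fun n => tailProb μ X (u n)) r ℓ (mixRate μ X) where
  nonneg _ := ENNReal.toReal_nonneg
  antitone := mixRate_antitone
  cov_le n k a c d f g C C' hf hg hC hC' := by
    have hpath := measurable_scaledPath hX (u n)
    -- move the end `c` of the first window to time `0`
    have hmap : ∀ G : (ℤ → E) → ℝ, Measurable G → ∫ x, G x ∂(pathLaw μ X (u n)) =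
        ∫ ω, G (shift (-c) (scaledPath X (u n) ω)) ∂μ := by
      intro G hG
      rw [← h.integral_shift n (-c), pathLaw, integral_map (f := fun x => G (shift (-c) x))
        hpath.aemeasurable (hG.comp (measurable_shift _)).aestronglyMeasurable]
    have hfm : Measurable fun x => f (trunc a c x) := hf.comp (measurable_trunc a c)
    have hgm : Measurable fun x => g (trunc (c + k) d x) := hg.comp (measurable_trunc (c + k) d)
    have hfgm : Measurable fun x => f (trunc a c x) * g (trunc (c + k) d x) := hfm.mul hgm
    rw [hmap _ hfgm, hmap _ hfm, hmap _ hgm]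
    set m₁ : MeasurableSpace Ω := ⨆ (j : ℤ) (_ : j ≤ 0), MeasurableSpace.comap (X j) inferInstance
      with hm₁
    set m₂ : MeasurableSpace Ω := ⨆ (j : ℤ) (_ : (k : ℤ) ≤ j),
      MeasurableSpace.comap (X j) inferInstance with hm₂
    have h₁ : m₁ ≤ mΩ := iSup₂_le fun j _ => (hX j).comap_le
    have h₂ : m₂ ≤ mΩ := iSup₂_le fun j _ => (hX j).comap_le
    set φ : Ω → ℤ → E := fun ω => trunc a c (shift (-c) (scaledPath X (u n) ω)) with hφ
    set ψ : Ω → ℤ → E := fun ω => trunc (c + k) d (shift (-c) (scaledPath X (u n) ω)) with hψ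
    have hφm : Measurable[m₁] φ := by
      refine @measurable_pi_lambda _ _ _ m₁ _ _ fun j => ?_
      by_cases hj : a ≤ j ∧ j ≤ c
      · have e : (fun ω => φ ω j) = fun ω => (u n)⁻¹ • X (j + -c) ω := by
          funext ω; simp only [hφ, trunc_apply, if_pos hj]; rfl
        rw [e]
        exact (measurable_iff_comap_le.2 (le_iSup₂_of_le (j + -c) (by omega) le_rfl)).const_smul _
      · have e : (fun ω => φ ω j) = fun _ => 0 := by
          funext ω; simp only [hφ, trunc_apply, if_neg hj]
        rw [e]
        exact measurable_const
    have hψm : Measurable[m₂] ψ := by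
      refine @measurable_pi_lambda _ _ _ m₂ _ _ fun j => ?_
      by_cases hj : c + k ≤ j ∧ j ≤ d
      · have e : (fun ω => ψ ω j) = fun ω => (u n)⁻¹ • X (j + -c) ω := by
          funext ω; simp only [hψ, trunc_apply, if_pos hj]; rfl
        rw [e]
        exact (measurable_iff_comap_le.2 (le_iSup₂_of_le (j + -c) (by omega) le_rfl)).const_smul _
      · have e : (fun ω => ψ ω j) = fun _ => 0 := by
          funext ω; simp only [hψ, trunc_apply, if_neg hj]
        rw [e]
        exact measurable_const
    have key := abs_cov_le_betaCoeff (μ := μ) h₁ h₂ (hf.comp hφm) (hg.comp hψm)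
      (fun ω => hC _) (fun ω => hC' _)
    exact key
  sum_le δ hδ := by
    filter_upwards [hmix.eventually_le_const (ENNReal.ofReal_pos.2 hδ), h.p_pos,
      h.r_top.eventually_gt_atTop 0] with n hn hp hr M
    have hrp : 0 < r n * tailProb μ X (u n) := mul_pos (by exact_mod_cast hr) hp
    rw [ENNReal.div_le_iff (ENNReal.ofReal_pos.2 hrp).ne' ENNReal.ofReal_ne_top,
      ← ENNReal.ofReal_mul hδ.le] at hn
    unfold mixRate
    rw [← ENNReal.toReal_sum fun k _ =>
      ne_top_of_le_ne_top ENNReal.one_ne_top (min_le_right _ _)]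
    refine ENNReal.toReal_le_of_le_ofReal (by positivity) (le_trans ?_ hn)
    exact (Finset.sum_le_sum fun k _ => min_le_left _ _).trans (ENNReal.sum_le_tsum _)
  gap_le δ hδ := by
    filter_upwards [hℓr.eventually_le_const hδ, h.r_top.eventually_gt_atTop 0] with n hn hr
    exact (div_le_iff₀ (by exact_mod_cast hr)).1 hn

end reduction

/-! ### The classes of functionals -/

section classes

variable {E : Type*} [NormedAddCommGroup E] [NormedSpace ℝ E] [MeasurableSpace E] [BorelSpace E]
  [SecondCountableTopology E]
variable {P : ℕ → Measure (ℤ → E)} {Q : Measure (ℤ → E)} {α : ℝ} {p : ℕ → ℝ} {r : ℕ → ℕ}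
variable {N : (ℤ → E) → ℝ≥0∞} {S : Set (ℤ → E)} {H H' : (ℤ → E) → ℝ}

lemma smul_mem_l0 {x : ℤ → E} (hx : x ∈ l0 E) (c : ℝ) : c • x ∈ l0 E := by
  have : Tendsto (fun j => c • x j) cofinite (𝓝 (c • (0 : E))) :=
    (show Tendsto x cofinite (𝓝 0) from hx).const_smul c
  rwa [smul_zero] at this

lemma smul_mem_l1 {x : ℤ → E} (hx : x ∈ l1 E) (c : ℝ) : c • x ∈ l1 E := by
  have := (show Summable fun j => ‖x j‖ from hx).mul_left ‖c‖
  exact this.congr fun j => (norm_smul c (x j)).symm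

lemma sumNorm_ne_top_iff {x : ℤ → E} : sumNorm x ≠ ∞ ↔ x ∈ l1 E := by
  refine ⟨fun h => ?_, fun h => ?_⟩
  · have := ENNReal.summable_toReal h
    simpa [l1] using this
  · exact (show Summable fun j => ‖x j‖ from h).tsum_ofReal_ne_top.imp_symm fun h' => by
      simpa [sumNorm, ofReal_norm] using h'

lemma measurableSet_l1 : MeasurableSet (l1 E) := by
  have : l1 E = sumNorm ⁻¹' {∞}ᶜ := Set.ext fun x => sumNorm_ne_top_iff.symm
  rw [this]
  exact seqNorm_sumNorm.measurable (measurableSet_singleton ∞).compl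

/-- By anticlustering, the tail process tends to zero almost surely. -/
lemma BlockLimit.seqSpace_l0 (h : BlockLimit P Q α p r) : SeqSpace Q (l0 E) where
  measurable := measurableSet_l0
  mem_of_support _ := mem_l0_of_support
  subset := subset_rfl
  ae_mem := by
    filter_upwards [h.ae_tendsto_window seqNorm_supNorm h.tailSmall_supNorm one_pos] with y hy c _
    have := mem_l0_of_tendsto hy
    rw [one_smul] at this
    exact smul_mem_l0 this c

/-- When the small jumps are negligible, the tail process is almost surely summable. -/
lemma BlockLimit.seqSpace_l1 (h : BlockLimit P Q α p r) (hsj : SmallJumps P p r) :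
    SeqSpace Q (l1 E) where
  measurable := measurableSet_l1
  mem_of_support _ := mem_l1_of_support
  subset := l1_subset_l0
  ae_mem := by
    filter_upwards [h.ae_tendsto_window seqNorm_sumNorm (h.tailSmall_sumNorm hsj) one_pos]
      with y hy c _
    have := mem_l1_of_tendsto hy
    rw [one_smul] at this
    exact smul_mem_l1 this c

lemma Admissible.zero (h : BlockLimit P Q α p r) :
    Admissible P Q p r N S (0 : (ℤ → E) → ℝ) where
  measurable := measurable_const
  bounded := ⟨0, fun x => by simp⟩
  finCont _ _ := Eventually.of_forall fun y => finCont_const 0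
  shift_inv _ _ _ := rfl
  small δ hδ := by
    refine Eventually.of_forall fun s => ?_
    filter_upwards [h.p_pos] with n hn
    simpa using by positivity

lemma Admissible.integrable_abs_trunc (h : BlockLimit P Q α p r) (hH : Admissible P Q p r N S H)
    (n : ℕ) (a c : ℤ) : Integrable (fun x => |H (trunc a c x)|) (P n) := by
  obtain ⟨C, hC⟩ := hH.bounded
  have := h.prob n
  exact h.integrable_of_bound ((hH.measurable.comp (measurable_trunc _ _)).abs) (C := C) fun x => by
    rw [abs_abs]; exact hC _

lemma Admissible.add (h : BlockLimit P Q α p r) (hH : Admissible P Q p r N S H)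
    (hH' : Admissible P Q p r N S H') : Admissible P Q p r N S (H + H') where
  measurable := hH.measurable.add hH'.measurable
  bounded := by
    obtain ⟨C, hC⟩ := hH.bounded
    obtain ⟨C', hC'⟩ := hH'.bounded
    exact ⟨C + C', fun x => (abs_add_le _ _).trans (add_le_add (hC x) (hC' x))⟩
  finCont s hs := by
    filter_upwards [hH.finCont s hs, hH'.finCont s hs] with y h1 h2
    exact h1.add h2
  shift_inv x hx k := by
    simp only [Pi.add_apply, hH.shift_inv x hx k, hH'.shift_inv x hx k]
  small δ hδ := by
    filter_upwards [hH.small _ (half_pos hδ), hH'.small _ (half_pos hδ)] with s h1 h2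
    filter_upwards [h1, h2] with n h1 h2
    have i1 := (hH.integrable_abs_trunc h n 1 (r n)).integrableOn
      (s := {x | ∀ j ∈ Finset.Icc (1 : ℤ) (r n), ‖x j‖ ≤ 2 * s})
    have i2 := (hH'.integrable_abs_trunc h n 1 (r n)).integrableOn
      (s := {x | ∀ j ∈ Finset.Icc (1 : ℤ) (r n), ‖x j‖ ≤ 2 * s})
    refine (integral_mono_of_nonneg (Eventually.of_forall fun x => abs_nonneg _) (i1.add i2)
      (Eventually.of_forall fun x => abs_add_le _ _)).trans ?_
    rw [Pi.add_def, integral_add i1 i2]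
    linarith

lemma Admissible.const_smul (hH : Admissible P Q p r N S H) (c : ℝ) :
    Admissible P Q p r N S (c • H) where
  measurable := hH.measurable.const_smul c
  bounded := by
    obtain ⟨C, hC⟩ := hH.bounded
    refine ⟨|c| * C, fun x => ?_⟩
    rw [Pi.smul_apply, smul_eq_mul, abs_mul]
    exact mul_le_mul_of_nonneg_left (hC x) (abs_nonneg c)
  finCont s hs := by
    obtain ⟨C, hC⟩ := hH.bounded
    filter_upwards [hH.finCont s hs] with y h1
    exact FinCont.mul (C := |c|) (fun _ => le_rfl) hC (finCont_const c) h1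
  shift_inv x hx k := by
    simp only [Pi.smul_apply, hH.shift_inv x hx k]
  small δ hδ := by
    filter_upwards [hH.small (δ / (|c| + 1)) (by positivity)] with s h1
    filter_upwards [h1] with n h1
    simp only [Pi.smul_apply, smul_eq_mul, abs_mul]
    rw [integral_const_mul]
    refine (mul_le_mul_of_nonneg_right (by linarith : |c| ≤ |c| + 1)
      (integral_nonneg fun _ => abs_nonneg _)).trans
      ((mul_le_mul_of_nonneg_left h1 (by positivity)).trans (le_of_eq ?_))
    field_simp

lemma Admissible.of_mem_span (h : BlockLimit P Q α p r) {𝒜 : Set ((ℤ → E) → ℝ)}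
    (h𝒜 : ∀ H ∈ 𝒜, Admissible P Q p r N S H) (hH : H ∈ Submodule.span ℝ 𝒜) :
    Admissible P Q p r N S H := by
  induction hH using Submodule.span_induction with
  | mem H hH => exact h𝒜 H hH
  | zero => exact Admissible.zero h
  | add _ _ _ _ h1 h2 => exact h1.add h h2
  | smul c _ _ h1 => exact h1.const_smul c

/-- At an `N`-limit of its windows, continuity is characterised by countably many envelopes
evaluated at windows: upper semicontinuity of `H` and of `-H` at `x`. -/
lemma finCont_iff_upper (hN : SeqNorm N) {C : ℝ} (hC : ∀ x, |H x| ≤ C) {x : ℤ → E}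
    (hx : Tendsto (fun m : ℕ => N (x - window m x)) atTop (𝓝 0)) :
    FinCont N H x ↔ ∀ i : ℕ,
      (∃ k m₀ : ℕ, ∀ m ≥ m₀, upper N H k (window m x) ≤ H x + 1 / ((i : ℝ) + 1)) ∧
      ∃ k m₀ : ℕ, ∀ m ≥ m₀, upper N (fun z => -H z) k (window m x) ≤ -H x + 1 / ((i : ℝ) + 1) := by
  have hC' : ∀ x, |(fun z => -H z) x| ≤ C := fun x => by simpa using hC x
  constructor
  · have key : ∀ G : (ℤ → E) → ℝ, (∀ x, |G x| ≤ C) → FinCont N G x → ∀ i : ℕ,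
        ∃ k m₀ : ℕ, ∀ m ≥ m₀, upper N G k (window m x) ≤ G x + 1 / ((i : ℝ) + 1) := by
      intro G hG hc i
      have hi : G x < G x + 1 / ((i : ℝ) + 1) := lt_add_of_pos_right _ (by positivity)
      obtain ⟨k, hk⟩ := ((tendsto_upper hN hG hx hc).eventually_lt_const hi).exists
      obtain ⟨m₀, hm⟩ := eventually_atTop.1
        ((tendsto_upper_window hN hG k hx).eventually_lt_const hk)
      exact ⟨k, m₀, fun m hmm => (hm m hmm).le⟩
    exact fun hc i => ⟨key H hC hc i, key _ hC' hc.neg i⟩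
  · have key : ∀ G : (ℤ → E) → ℝ, (∀ x, |G x| ≤ C) → ∀ e : ℝ,
        (∃ k m₀ : ℕ, ∀ m ≥ m₀, upper N G k (window m x) ≤ G x + e) →
        ∃ k : ℕ, ∀ y, (Function.support y).Finite → G y ≤ G x + e + k * sdist N x y := by
      rintro G hG e ⟨k, m₀, hm⟩
      refine ⟨k, fun y hy => ?_⟩
      have h1 : upper N G k x ≤ G x + e :=
        le_of_tendsto (tendsto_upper_window hN hG k hx) (eventually_atTop.2 ⟨m₀, hm⟩)
      have h2 := sub_le_upper (N := N) hG k x hy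
      linarith
    intro hi ε hε
    obtain ⟨i, hlt⟩ := exists_nat_one_div_lt (half_pos hε)
    obtain ⟨k, hk⟩ := key H hC _ (hi i).1
    obtain ⟨k', hk'⟩ := key _ hC' _ (hi i).2
    set K : ℝ := k + k' + 1 with hK
    have hK0 : 0 < K := by positivity
    refine ⟨ε / (2 * K), by positivity, fun y hy hle => ?_⟩
    rw [hN.sub_comm] at hle
    have hd := sdist_le_of_le (by positivity) hle
    have hd0 := sdist_nonneg (N := N) x y
    have e1 : K * sdist N x y ≤ ε / 2 := by
      refine (mul_le_mul_of_nonneg_left hd hK0.le).trans (le_of_eq ?_)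
      field_simp
    have e2 : k * sdist N x y ≤ K * sdist N x y := mul_le_mul_of_nonneg_right
      (by rw [hK]; linarith [k'.cast_nonneg (α := ℝ)]) hd0
    have e3 : k' * sdist N x y ≤ K * sdist N x y := mul_le_mul_of_nonneg_right
      (by rw [hK]; linarith [k.cast_nonneg (α := ℝ)]) hd0
    have h1 := hk y hy
    have h2 := hk' y hy
    exact abs_le.2 ⟨by linarith, by linarith⟩

/-- Almost sure continuity is a property of the law of the tail process. The set of continuity
points need not be measurable, so it is replaced by the events of `finCont_iff_upper`. -/
lemma BlockLimit.ae_finCont_map {Ω' : Type*} [MeasurableSpace Ω'] {μ' : Measure Ω'}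
    {Z : Ω' → ℤ → E} (hZ : Measurable Z) (h : BlockLimit P (μ'.map Z) α p r) (hN : SeqNorm N)
    (hT : TailSmall P p r N) (hm : Measurable H) {C : ℝ} (hC : ∀ x, |H x| ≤ C) {s : ℝ}
    (hs : 0 < s) (hH : ∀ᵐ ω ∂μ', FinCont N H (s • Z ω)) :
    ∀ᵐ y ∂(μ'.map Z), FinCont N H (s • y) := by
  have hw := h.ae_tendsto_window hN hT hs
  have hC' : ∀ x, |(fun z => -H z) x| ≤ C := fun x => by simpa using hC x
  have hmeas : ∀ G : (ℤ → E) → ℝ, Measurable G → (∀ x, |G x| ≤ C) → ∀ e : ℝ, MeasurableSet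
      {y : ℤ → E | ∃ k m₀ : ℕ, ∀ m ≥ m₀, upper N G k (window m (s • y)) ≤ G (s • y) + e} := by
    intro G hG hGC e
    have : {y : ℤ → E | ∃ k m₀ : ℕ, ∀ m ≥ m₀, upper N G k (window m (s • y)) ≤ G (s • y) + e} =
        ⋃ k : ℕ, ⋃ m₀ : ℕ, ⋂ m : ℕ, ⋂ _ : m ≥ m₀,
          {y | upper N G k (window m (s • y)) ≤ G (s • y) + e} := by
      ext y; simp
    rw [this]
    refine MeasurableSet.iUnion fun k => MeasurableSet.iUnion fun m₀ => MeasurableSet.iInter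
      fun m => MeasurableSet.iInter fun _ => measurableSet_le ?_ ?_
    · exact (continuous_upper_trunc hN hGC k _ _).measurable.comp (measurable_smul_path s)
    · exact (hG.comp (measurable_smul_path s)).add_const e
  have hA : ∀ᵐ y ∂(μ'.map Z), ∀ i : ℕ,
      (∃ k m₀ : ℕ, ∀ m ≥ m₀, upper N H k (window m (s • y)) ≤ H (s • y) + 1 / ((i : ℝ) + 1)) ∧
      ∃ k m₀ : ℕ, ∀ m ≥ m₀, upper N (fun z => -H z) k (window m (s • y)) ≤
        -H (s • y) + 1 / ((i : ℝ) + 1) := by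
    refine ae_all_iff.2 fun i => ?_
    refine (ae_map_iff hZ.aemeasurable ((hmeas H hm hC _).inter (hmeas _ hm.neg hC' _))).2 ?_
    filter_upwards [hH, ae_of_ae_map hZ.aemeasurable hw] with ω h1 h2
    exact (finCont_iff_upper hN hC h2).1 h1 i
  filter_upwards [hA, hw] with y h1 h2
  exact (finCont_iff_upper hN hC h2).2 h1

variable {Ω' : Type*} [MeasurableSpace Ω'] {μ' : Measure Ω'} {Y : ℤ → Ω' → E}

/-- Functionals supported away from zero are admissible. -/
lemma BlockLimit.admissible_of_mem_classA (hY : ∀ j, Measurable (Y j))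
    (h : BlockLimit P (μ'.map fun ω j => Y j ω) α p r) (hH : H ∈ classA μ' Y) :
    Admissible P (μ'.map fun ω j => Y j ω) p r supNorm (l0 E) H := by
  obtain ⟨hm, ⟨C, hC⟩, hcont, hinv, ε, hε, hzero⟩ := hH
  refine ⟨hm, ⟨C, hC⟩, fun s hs => ?_, hinv, fun δ hδ => ?_⟩
  · rcases hcont with hL | hcont
    · filter_upwards [h.seqSpace_l0.ae_mem] with y hy
      exact finCont_of_lipschitz hL (hy s hs)
    · exact h.ae_finCont_map (measurable_pi_lambda _ hY) seqNorm_supNorm h.tailSmall_supNorm hm hC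
        hs ((hcont s hs).mono fun ω hω => finCont_of_continuousAtUniform hω)
  · filter_upwards [nhdsWithin_le_nhds (eventually_lt_nhds (half_pos hε))] with s hs
    filter_upwards [h.p_pos] with n hn
    have hm0 : MeasurableSet {x : ℤ → E | ∀ j ∈ Finset.Icc (1 : ℤ) (r n), ‖x j‖ ≤ 2 * s} :=
      measurableSet_quiet _ _
    rw [setIntegral_congr_fun (g := fun _ => 0) hm0 fun x hx => ?_]
    · simpa using by positivity
    · have : H (trunc 1 (r n) x) = 0 := by
        refine hzero _ (mem_l0_of_support (trunc_support_finite _ _ _)) fun j => ?_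
        rw [trunc_apply]
        split_ifs with hj
        · exact (hx j (Finset.mem_Icc.2 hj)).trans (by linarith)
        · simpa using hε.le
      simp [this]

/-- Indicators of large values of a Lipschitz functional on `ℓ₁` are admissible when the sums of
small jumps are negligible. -/
lemma BlockLimit.admissible_of_mem_classB (hY : ∀ j, Measurable (Y j))
    (h : BlockLimit P (μ'.map fun ω j => Y j ω) α p r) (hsj : SmallJumps P p r)
    (hH : H ∈ classB μ' Y) :
    Admissible P (μ'.map fun ω j => Y j ω) p r sumNorm (l1 E) H := by
  obtain ⟨⟨K, ⟨hK, hK0, hKinv, L, hL⟩, rfl⟩, hcont⟩ := hH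
  set A : Set (ℤ → E) := {x | 1 < K x} with hA
  have hAm : MeasurableSet A := measurableSet_lt measurable_const hK
  have hm : Measurable (A.indicator (1 : (ℤ → E) → ℝ)) := measurable_const.indicator hAm
  have hC : ∀ x, |A.indicator (1 : (ℤ → E) → ℝ) x| ≤ 1 := fun x => by
    by_cases hx : x ∈ A <;> simp [hx]
  refine ⟨hm, ⟨1, hC⟩, fun s hs => ?_, fun x hx k => ?_, fun δ hδ => ?_⟩
  · exact h.ae_finCont_map (measurable_pi_lambda _ hY) seqNorm_sumNorm (h.tailSmall_sumNorm hsj) hm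
      hC hs ((hcont s hs).mono fun ω hω => finCont_of_continuousAtL1 hω)
  · have : K (shift k x) = K x := hKinv x hx k
    simp only [Set.indicator_apply, hA, Set.mem_ofPred_eq, this, Pi.one_apply]
  · set L' := |L| + 1 with hL'
    have hL'0 : 0 < L' := by positivity
    have hmap : Tendsto (fun s : ℝ => 2 * s) (𝓝[>] 0) (𝓝[>] 0) := by
      refine tendsto_nhdsWithin_iff.2 ⟨?_, ?_⟩
      · have : Tendsto (fun s : ℝ => 2 * s) (𝓝 0) (𝓝 (2 * 0)) := tendsto_id.const_mul 2
        rw [mul_zero] at this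
        exact this.mono_left nhdsWithin_le_nhds
      · filter_upwards [self_mem_nhdsWithin] with s hs
        exact mul_pos two_pos (Set.mem_Ioi.1 hs)
    filter_upwards [hmap.eventually (hsj L'⁻¹ δ (inv_pos.2 hL'0) hδ)] with s hs
    filter_upwards [hs] with n hn
    have := h.prob n
    refine le_trans ?_ hn
    set B := {x : ℤ → E | ∀ j ∈ Finset.Icc (1 : ℤ) (r n), ‖x j‖ ≤ 2 * s} with hB
    have hBm : MeasurableSet B := measurableSet_quiet _ _
    set D := {x : ℤ → E | L'⁻¹ <
      ∑ j ∈ Finset.Icc (1 : ℤ) (r n), if ‖x j‖ ≤ 2 * s then ‖x j‖ else 0} with hD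
    have hDm : MeasurableSet D := measurableSet_lt measurable_const (measurable_smallSum _ _)
    rw [← integral_indicator_one hDm, ← integral_indicator hBm]
    refine integral_mono_of_nonneg
      (Eventually.of_forall fun x => Set.indicator_nonneg (fun _ _ => abs_nonneg _) x)
      ((integrable_const (1 : ℝ)).indicator hDm) (Eventually.of_forall fun x => ?_)
    have hD0 : 0 ≤ D.indicator (1 : (ℤ → E) → ℝ) x :=
      Set.indicator_nonneg (fun _ _ => zero_le_one) x
    by_cases hx : x ∈ B
    swap
    · simpa [hx] using hD0
    by_cases hxA : trunc 1 (r n) x ∈ A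
    swap
    · simpa [hx, hxA] using hD0
    -- on a quiet block with `K > 1`, the Lipschitz property forces a large sum of small jumps
    have hlip := hL _ (mem_l1_of_support (trunc_support_finite 1 (r n) x)) 0
      (mem_l1_of_support (by simp))
    have hsum : ∑' j, ‖trunc 1 (r n) x j - (0 : ℤ → E) j‖ =
        ∑ j ∈ Finset.Icc (1 : ℤ) (r n), if ‖x j‖ ≤ 2 * s then ‖x j‖ else 0 := by
      rw [tsum_eq_sum (s := Finset.Icc (1 : ℤ) (r n))]
      · refine Finset.sum_congr rfl fun j hj => ?_
        rw [Pi.zero_apply, sub_zero, trunc_apply, if_pos (Finset.mem_Icc.1 hj), if_pos (hx j hj)]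
      · intro j hj
        rw [trunc_apply, if_neg (fun hh => hj (Finset.mem_Icc.2 hh))]
        simp
    rw [hsum, hK0, sub_zero] at hlip
    set T := ∑ j ∈ Finset.Icc (1 : ℤ) (r n), if ‖x j‖ ≤ 2 * s then ‖x j‖ else 0 with hT
    have hT0 : 0 ≤ T := Finset.sum_nonneg fun j _ => by split_ifs <;> simp
    have h1 : 1 < L' * T := by
      have h2 : 1 < |K (trunc 1 (r n) x)| := (show 1 < K _ from hxA).trans_le (le_abs_self _)
      have h3 : L * T ≤ L' * T :=
        mul_le_mul_of_nonneg_right ((le_abs_self L).trans (by linarith)) hT0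
      linarith
    have hxD : x ∈ D := by
      change L'⁻¹ < T
      rwa [inv_lt_iff_one_lt_mul₀' hL'0]
    simp [hx, hxA, hxD]

end classes

/-! ### The covariances of the empirical cluster process -/

section final

variable {Ω Ω' E : Type*} [MeasurableSpace Ω] [MeasurableSpace Ω'] [NormedAddCommGroup E]
  [NormedSpace ℝ E] [MeasurableSpace E] [BorelSpace E] [SecondCountableTopology E]
variable {μ : Measure Ω} {X : ℤ → Ω → E} {r ℓ : ℕ → ℕ} {u : ℕ → ℝ} {Q : Measure (ℤ → E)} {α : ℝ}
variable {N : (ℤ → E) → ℝ≥0∞} {S : Set (ℤ → E)} {F F' H H' : (ℤ → E) → ℝ}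

/-- The rescaled block of the series is a truncation of the rescaled path. -/
lemma smul_block (X : ℤ → Ω → E) (v : ℝ) (a c : ℤ) (ω : Ω) :
    v⁻¹ • block X a c ω = trunc a c (scaledPath X v ω) := by
  funext j
  simp only [Pi.smul_apply, block, trunc_apply, scaledPath]
  split_ifs <;> simp

/-- The covariances of the empirical process, as double sums of covariances of blocks. -/
lemma cov_empProcess (hX : ∀ j, Measurable (X j)) (ν : Measure (ℤ → E))
    (h : BlockLimit (fun n => pathLaw μ X (u n)) Q α (fun n => tailProb μ X (u n)) r)
    (hS : SeqSpace Q S) (hF : ∀ x ∈ S, ∀ k, F (shift k x) = F x)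
    (hF' : ∀ x ∈ S, ∀ k, F' (shift k x) = F' x) (n : ℕ)
    (hFL : ∀ a c, MemLp (fun x => F (trunc a c x)) 2 (pathLaw μ X (u n)))
    (hFL' : ∀ a c, MemLp (fun x => F' (trunc a c x)) 2 (pathLaw μ X (u n))) :
    cov[empProcess μ X ν r u n F, empProcess μ X ν r u n F'; μ] =
      n * tailProb μ X (u n) / (numBlocks r n * r n * tailProb μ X (u n)) ^ 2 *
        ∑ i ∈ Finset.range (numBlocks r n), ∑ j ∈ Finset.range (numBlocks r n),
          blockCov (pathLaw μ X (u n)) (r n) F F' ((j : ℤ) - i) := by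
  have := h.prob n
  set a := numBlocks r n * r n * tailProb μ X (u n) with ha
  set c := n * tailProb μ X (u n) with hc
  have hc0 : 0 ≤ c := mul_nonneg n.cast_nonneg measureReal_nonneg
  set T : ((ℤ → E) → ℝ) → (ℤ → E) → ℝ := fun G x =>
    ∑ i ∈ Finset.range (numBlocks r n), G (trunc (1 + i) (r n + i) x) with hT
  have hTL : ∀ G : (ℤ → E) → ℝ, (∀ a c, MemLp (fun x => G (trunc a c x)) 2 (pathLaw μ X (u n))) →
      MemLp (T G) 2 (pathLaw μ X (u n)) := fun G hG => memLp_finsetSum _ fun i _ => hG _ _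
  have he : ∀ G : (ℤ → E) → ℝ, empProcess μ X ν r u n G =
      (fun x => Real.sqrt c * ((T G x) / a - ∫ x, G x ∂ν)) ∘ scaledPath X (u n) := by
    intro G
    funext ω
    simp only [empProcess, slidingStat, smul_block, Function.comp_apply, hT, ← hc, ← ha]
    simp_rw [add_comm (1 : ℤ), add_comm (r n : ℤ)]
  have hpath := measurable_scaledPath hX (u n)
  have hae : ∀ G : (ℤ → E) → ℝ, (∀ a c, MemLp (fun x => G (trunc a c x)) 2 (pathLaw μ X (u n))) →
      AEStronglyMeasurable (fun x => Real.sqrt c * ((T G x) / a - ∫ x, G x ∂ν))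
        (μ.map (scaledPath X (u n))) := fun G hG =>
    ((((hTL G hG).aestronglyMeasurable.aemeasurable.div_const a).sub_const _).const_mul
      _).aestronglyMeasurable
  rw [he F, he F', ← covariance_map (hae F hFL) (hae F' hFL') hpath.aemeasurable]
  change cov[_, _; pathLaw μ X (u n)] = _
  have hint : ∀ G : (ℤ → E) → ℝ, (∀ a c, MemLp (fun x => G (trunc a c x)) 2 (pathLaw μ X (u n))) →
      Integrable (fun x => T G x / a) (pathLaw μ X (u n)) := fun G hG =>
    ((hTL G hG).integrable one_le_two).div_const a
  rw [covariance_const_mul_left, covariance_const_mul_right,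
    covariance_sub_const_left (hint F hFL), covariance_sub_const_right (hint F' hFL'),
    covariance_fun_div_left, covariance_fun_div_right, hT]
  simp only
  rw [covariance_fun_sum_fun_sum' (fun i _ => hFL _ _) (fun i _ => hFL' _ _)]
  simp_rw [h.cov_block hS hF hF' n]
  rw [← mul_assoc, Real.mul_self_sqrt hc0, div_div, ← pow_two, mul_div_assoc', div_mul_eq_mul_div]

lemma memLp_countExceed {P : Measure (ℤ → E)} [IsProbabilityMeasure P] {s : ℝ} (hs : 0 < s)
    (a c : ℤ) : MemLp (fun x : ℤ → E => countExceed s (trunc a c x)) 2 P := by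
  simp_rw [countExceed_trunc hs]
  exact memLp_finsetSum _ fun j _ =>
    memLp_of_abs_le (measurable_exceed_apply s j) fun x => abs_exceed_le s _

lemma Admissible.memLp {P : ℕ → Measure (ℤ → E)} {p : ℕ → ℝ} (h : BlockLimit P Q α p r)
    (hH : Admissible P Q p r N S H) (n : ℕ) (a c : ℤ) :
    MemLp (fun x => H (trunc a c x)) 2 (P n) := by
  obtain ⟨C, hC⟩ := hH.bounded
  have := h.prob n
  exact memLp_of_abs_le (f := fun x => H (trunc a c x)) (hH.measurable.comp (measurable_trunc a c))
    fun x => hC _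

end final

end SlidingBlocks

open SlidingBlocks in
theorem mainTheorem3
    {Ω Ω' E : Type*} [MeasurableSpace Ω] [MeasurableSpace Ω']
    [NormedAddCommGroup E] [NormedSpace ℝ E] [FiniteDimensional ℝ E]
    [MeasurableSpace E] [BorelSpace E]
    (μ : Measure Ω) [IsProbabilityMeasure μ] (μ' : Measure Ω') [IsProbabilityMeasure μ']
    (X : ℤ → Ω → E) (hX : ∀ j, Measurable (X j))
    (Y : ℤ → Ω' → E) (hY : ∀ j, Measurable (Y j))
    (α : ℝ) (r ℓ : ℕ → ℕ) (u : ℕ → ℝ)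
    (hstat : IsStationary μ X) (hα : HasTailIndex μ X α) (htail : IsTailProcess μ X μ' Y)
    (hR : ConditionR μ X r u) (hDH : ConditionDH μ X r u)
    (hℓ : Tendsto ℓ atTop atTop)
    (hℓr : Tendsto (fun n => (ℓ n : ℝ) / r n) atTop (𝓝 0))
    (hmix : MixingTail μ X r ℓ u)
    (𝒢 : Set ((ℤ → E) → ℝ)) (h𝒢 : IsUniformClass μ X r ℓ u 𝒢)
    (hclass : 𝒢 ⊆ Submodule.span ℝ (classA μ' Y) ∨
      (𝒢 ⊆ Submodule.span ℝ (classB μ' Y) ∧ ConditionANSJB μ X r u)) :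
    (∀ H ∈ 𝒢, Integrable H (clusterMeasure α μ' Y)) ∧
    (MixingBlocks μ X r u → ∀ H ∈ 𝒢, ∀ H' ∈ 𝒢,
      Integrable (fun x => H x * H' x) (clusterMeasure α μ' Y) ∧
      Tendsto (fun n => cov[empProcess μ X (clusterMeasure α μ' Y) r u n H,
          empProcess μ X (clusterMeasure α μ' Y) r u n H'; μ])
        atTop (𝓝 (∫ x, H x * H' x ∂(clusterMeasure α μ' Y)))) ∧
    (∀ s : ℝ, 0 < s → Integrable (rescale s exc) (clusterMeasure α μ' Y) ∧
      ∀ H ∈ 𝒢,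
      Integrable (fun x => H x * rescale s exc x) (clusterMeasure α μ' Y) ∧
      Tendsto (fun n => cov[empProcess μ X (clusterMeasure α μ' Y) r u n H,
          empProcess μ X (clusterMeasure α μ' Y) r u n (rescale s exc); μ])
        atTop (𝓝 (∫ x, H x * rescale s exc x ∂(clusterMeasure α μ' Y))) ∧
      ∫ x, H x * rescale s exc x ∂(clusterMeasure α μ' Y) =
        s ^ (-α) * ∫ ω, H (fun j => s • Y j ω) ∂μ') := by
  have : ProperSpace E := FiniteDimensional.proper_real E
  have h := blockLimit_pathLaw hX hY hstat hα htail hR hDH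
  have hD := weakDep_mixRate hX h hℓr hmix
  have hYm : Measurable fun ω j => Y j ω := measurable_pi_lambda _ hY
  obtain ⟨N, S, hN, hT, hS, h𝒜⟩ : ∃ (N : (ℤ → E) → ℝ≥0∞) (S : Set (ℤ → E)), SeqNorm N ∧
      TailSmall (fun n => pathLaw μ X (u n)) (fun n => tailProb μ X (u n)) r N ∧
      SeqSpace (μ'.map fun ω j => Y j ω) S ∧ ∀ H ∈ 𝒢, Admissible (fun n => pathLaw μ X (u n))
        (μ'.map fun ω j => Y j ω) (fun n => tailProb μ X (u n)) r N S H := by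
    rcases hclass with hA | ⟨hB, hJ⟩
    · exact ⟨supNorm, l0 E, seqNorm_supNorm, h.tailSmall_supNorm, h.seqSpace_l0, fun H hH =>
        Admissible.of_mem_span h (fun G hG => h.admissible_of_mem_classA hY hG) (hA hH)⟩
    · have hsj := smallJumps_of_conditionANSJB hX hR hJ
      exact ⟨sumNorm, l1 E, seqNorm_sumNorm, h.tailSmall_sumNorm hsj, h.seqSpace_l1 hsj,
        fun H hH => Admissible.of_mem_span h
          (fun G hG => h.admissible_of_mem_classB hY hsj hG) (hB hH)⟩
  have hν : clusterMeasure α μ' Y = anchored (μ'.map fun ω j => Y j ω) α :=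
    BlockLimit.clusterMeasure_eq hY h
  rw [hν]
  have hint : ∀ H ∈ 𝒢, Integrable H (anchored (μ'.map fun ω j => Y j ω) α) := fun H hH =>
    (h𝒜 H hH).integrable hN hT hS h
  have hprob := h.prob
  refine ⟨hint, fun _ H hH H' hH' => ⟨?_, ?_⟩, fun s hs => ⟨?_, fun H hH => ?_⟩⟩
  · obtain ⟨C, hC⟩ := (h𝒜 H' hH').bounded
    exact (hint H hH).mul_bdd (h𝒜 H' hH').measurable.aestronglyMeasurable
      (Eventually.of_forall hC)
  · refine ((h𝒜 H hH).tendsto_cov hN hT hS h hD (h𝒜 H' hH') hR.2.2.2.1).congr fun n => ?_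
    exact (cov_empProcess hX _ h hS (h𝒜 H hH).shift_inv (h𝒜 H' hH').shift_inv n
      ((h𝒜 H hH).memLp h n) ((h𝒜 H' hH').memLp h n)).symm
  · rw [rescale_exc hs]
    simpa only [one_mul] using (h.integral_anchored_countExceed hS (H := fun _ => 1)
      measurable_const (C := 1) (by simp) (fun _ _ _ => rfl) hs).1
  · obtain ⟨C, hC⟩ := (h𝒜 H hH).bounded
    have hi := h.integral_anchored_countExceed hS (h𝒜 H hH).measurable hC (h𝒜 H hH).shift_inv hs
    have hlaw : ∫ y, H (s • y) ∂(μ'.map fun ω j => Y j ω) =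
        ∫ ω, H (fun j => s • Y j ω) ∂μ' :=
      integral_map hYm.aemeasurable
        ((h𝒜 H hH).measurable.comp (measurable_smul_path s)).aestronglyMeasurable
    rw [rescale_exc hs]
    refine ⟨hi.1, ?_, hi.2.trans (by rw [hlaw])⟩
    rw [hi.2]
    refine ((h𝒜 H hH).tendsto_cov_countExceed hN hT hS h hD hR.2.2.2.1 hs).congr fun n => ?_
    exact (cov_empProcess hX _ h hS (h𝒜 H hH).shift_inv
      (fun x _ k => countExceed_shift s k x) n ((h𝒜 H hH).memLp h n)
      (fun a c => memLp_countExceed hs a c)).symm
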